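/- Fix an integer $q\ge 2$ and let $[q]=\{0,\dots,q-1\}$. A function $f:[q]^d\to\mathbb C$ is symmetric if its value does not change when its arguments are permuted. For $0\le k\le d$ and $\tau\in[q]^k$ let $\mathrm{Pin}_\tau(f):[q]^{d-k}\to\mathbb C$ be the function $\sigma\mapsto f(\sigma_1,\dots,\sigma_{d-k},\tau_1,\dots,\tau_k)$; $f$ is called $C$-regular if $|\{\mathrm{Pin}_\tau(f):\tau\in[q]^k\}|\le C$ for every $0\le k\le d$. A Holant instance $\Omega=(G,\{f_v\}_{v\in V})$ consists of a finite simple graph $G=(V,E)$ and, for every vertex $v$, a symmetric function $f_v:[q]^{\deg(v)}\to\mathbb C$, and $$\mathrm{hol}(\Omega)=\sum_{\sigma\in[q]^E}\ \prod_{v\in V}f_v\bigl(\sigma|_{E(v)}\bigr),$$ where $E(v)$ is the set of edges incident to $v$. Let $n=|V|$ and let $\mathrm{tw}(G)$ be the treewidth of $G$ (taken to be $0$ if $n=0$). **Theorem.** There is an algorithm with the following property. For every $C$ there are a constant $K$ and a polynomial $p$, depending only on $q$ and $C$, such that on every Holant instance $\Omega$ all of whose functions $f_v$ are $C$-regular,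 the algorithm outputs the exact value $\mathrm{hol}(\Omega)$ after at most $2^{K\cdot\mathrm{tw}(G)}\cdot p(n)$ steps. That is, $\mathrm{hol}(\Omega)$ is computed in time $2^{O(\mathrm{tw}(G))}\cdot\mathrm{poly}(n)$ for constant $q$ and $C$. Here the input is $G$, as adjacency lists, together with, for every $v$, the table of $f_v$, which lists the value of $f_v$ for each vector $(c_0,\dots,c_{q-1})$ of multiplicities with $c_0+\dots+c_{q-1}=\deg(v)$. Running time is counted in the arithmetic (algebraic) model: an addition, subtraction, multiplication or equality test of two complex numbers costs one step, the only built-in numerical constants are $0$ and $1$, and every elementary operation on discrete data (building a pair, taking one apart, calling a function, branching) costs one step. -/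

import Mathlib

namespace Holant

/-! ### Symmetric functions, pinning, regularity -/

/-- A `d`-ary function on the domain `[q] = {0, …, q-1}` is symmetric if permuting its arguments
does not change its value. -/
def IsSymmetric {q d : ℕ} (f : (Fin d → Fin q) → ℂ) : Prop :=
  ∀ (ρ : Equiv.Perm (Fin d)) (x : Fin d → Fin q), f (x ∘ ρ) = f x

/-- Pinning: fix the last `k` arguments of a `d`-ary function to `τ`; the result is an `l`-ary
function, where `d = l + k`. -/
def pin {q d l k : ℕ} (h : d = l + k) (f : (Fin d → Fin q) → ℂ) (τ : Fin k → Fin q) :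
    (Fin l → Fin q) → ℂ :=
  fun σ => f (Fin.append σ τ ∘ Fin.cast h)

/-- `f` is `C`-regular: for every `0 ≤ k ≤ d`, pinning `k` arguments of `f` in all possible ways
yields at most `C` distinct functions. -/
def IsRegular {q d : ℕ} (C : ℕ) (f : (Fin d → Fin q) → ℂ) : Prop :=
  ∀ (l k : ℕ) (h : d = l + k), (Set.range (pin h f)).ncard ≤ C

/-! ### Holant instances -/

/-- A Holant instance over the domain `[q]`: a finite simple graph on the vertices `0, …, n-1`
with a symmetric complex-valued function of arity `deg v` at every vertex `v`. -/
structure Instance (q : ℕ) where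
  n : ℕ
  graph : SimpleGraph (Fin n)
  decAdj : DecidableRel graph.Adj
  f : ∀ v : Fin n, (Fin (graph.degree v) → Fin q) → ℂ
  symm : ∀ v, IsSymmetric (f v)

attribute [instance] Instance.decAdj

namespace Instance

variable {q : ℕ} (Ω : Instance q)

/-- The `i`-th neighbour of `v`, in increasing order. -/
def nbr (v : Fin Ω.n) (i : Fin (Ω.graph.degree v)) : Fin Ω.n :=
  (Ω.graph.neighborFinset v).orderEmbOfFin rfl i

theorem adj_nbr (v : Fin Ω.n) (i : Fin (Ω.graph.degree v)) : Ω.graph.Adj v (Ω.nbr v i) :=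
  (Ω.graph.mem_neighborFinset v _).1 (Finset.orderEmbOfFin_mem _ rfl i)

/-- The `i`-th edge incident to `v`. -/
def incEdge (v : Fin Ω.n) (i : Fin (Ω.graph.degree v)) : Ω.graph.edgeSet :=
  ⟨s(v, Ω.nbr v i), Ω.adj_nbr v i⟩

/-- The Holant `∑_{σ ∈ [q]^E} ∏_v f_v(σ|_{E(v)})`. (The order in which the edges at `v` are listed
is immaterial, since `f_v` is symmetric.) -/
noncomputable def hol : ℂ :=
  ∑ σ : Ω.graph.edgeSet → Fin q, ∏ v : Fin Ω.n, Ω.f v (fun i => σ (Ω.incEdge v i))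

end Instance

/-! ### Treewidth -/

/-- A tree decomposition of `G`: a finite tree `T` with a bag of vertices at every node, such that
every vertex and every edge lies in a bag, and the nodes whose bags contain a given vertex induce
a connected part of `T`. -/
structure TreeDecomposition {V : Type*} (G : SimpleGraph V) where
  m : ℕ
  tree : SimpleGraph (Fin m)
  isTree : tree.IsTree
  bag : Fin m → Finset V
  vertex_mem : ∀ v, ∃ i, v ∈ bag i
  edge_mem : ∀ u v, G.Adj u v → ∃ i, u ∈ bag i ∧ v ∈ bag i
  connected : ∀ v, (tree.induce {i | v ∈ bag i}).Preconnected

/-- The treewidth of a finite graph: the least `w` such that some tree decomposition has all its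
bags of size at most `w + 1` (so the graph without vertices gets treewidth `0`). -/
noncomputable def treewidth {V : Type*} (G : SimpleGraph V) : ℕ :=
  sInf {w | ∃ D : TreeDecomposition G, ∀ i, (D.bag i).card ≤ w + 1}

/-! ### The model of computation

Programs of a strict first-order functional language with general recursion. They operate on
finite binary trees whose leaves are `nil` or complex numbers. Every evaluation step costs one
unit: building or taking apart a pair, a function call, a ring operation on complex numbers, a
test whether two complex numbers are equal. The only numerical constants are `0` and `1`. -/

/-- The values: finite binary trees with leaves `nil` or a complex number. -/
inductive Val where
  | nil : Val
  | num (z : ℂ) : Val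
  | pair (a b : Val) : Val

/-- The expressions. A variable is given by its position in the environment (de Bruijn index).
`caseOf e e₀ e₁` evaluates `e`; if the result is `nil` it goes on with `e₀`, and if it is a pair
`(a, b)` with `e₁`, where `a` and `b` become the variables `0` and `1`. In `letIn e e₁` the value
of `e` becomes the variable `0` of `e₁`. `call i e` applies the `i`-th function of the program to
`e`. `ifEq a b e₁ e₂` branches on whether the complex numbers `a` and `b` are equal. -/
inductive Expr where
  | var (i : ℕ) : Expr
  | nil : Expr
  | pair (a b : Expr) : Expr
  | caseOf (e e₀ e₁ : Expr) : Expr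
  | letIn (e e₁ : Expr) : Expr
  | call (i : ℕ) (e : Expr) : Expr
  | zero : Expr
  | one : Expr
  | add (a b : Expr) : Expr
  | sub (a b : Expr) : Expr
  | mul (a b : Expr) : Expr
  | ifEq (a b e₁ e₂ : Expr) : Expr

/-- A program: a finite list of (mutually recursive) one-argument functions, given by their bodies.
In a body the argument is the variable `0`. The function at position `0` is the main function. -/
abbrev Program := List Expr

/-- `Eval P ρ e v t`: in the program `P`, under the environment `ρ`, the expression `e` evaluates
to the value `v` in exactly `t` steps. -/
inductive Eval (P : Program) : List Val → Expr → Val → ℕ → Prop where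
  | var {ρ : List Val} {i : ℕ} {v : Val} : ρ[i]? = some v → Eval P ρ (.var i) v 1
  | nil {ρ : List Val} : Eval P ρ .nil .nil 1
  | pair {ρ : List Val} {a b : Expr} {u v : Val} {s t : ℕ} :
      Eval P ρ a u s → Eval P ρ b v t → Eval P ρ (.pair a b) (.pair u v) (s + t + 1)
  | caseNil {ρ : List Val} {e e₀ e₁ : Expr} {v : Val} {s t : ℕ} :
      Eval P ρ e .nil s → Eval P ρ e₀ v t → Eval P ρ (.caseOf e e₀ e₁) v (s + t + 1)
  | casePair {ρ : List Val} {e e₀ e₁ : Expr} {a b v : Val} {s t : ℕ} :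
      Eval P ρ e (.pair a b) s → Eval P (a :: b :: ρ) e₁ v t →
      Eval P ρ (.caseOf e e₀ e₁) v (s + t + 1)
  | letIn {ρ : List Val} {e e₁ : Expr} {u v : Val} {s t : ℕ} :
      Eval P ρ e u s → Eval P (u :: ρ) e₁ v t → Eval P ρ (.letIn e e₁) v (s + t + 1)
  | call {ρ : List Val} {i : ℕ} {e body : Expr} {u v : Val} {s t : ℕ} :
      Eval P ρ e u s → P[i]? = some body → Eval P [u] body v t →
      Eval P ρ (.call i e) v (s + t + 1)
  | zero {ρ : List Val} : Eval P ρ .zero (.num 0) 1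
  | one {ρ : List Val} : Eval P ρ .one (.num 1) 1
  | add {ρ : List Val} {a b : Expr} {x y : ℂ} {s t : ℕ} :
      Eval P ρ a (.num x) s → Eval P ρ b (.num y) t →
      Eval P ρ (.add a b) (.num (x + y)) (s + t + 1)
  | sub {ρ : List Val} {a b : Expr} {x y : ℂ} {s t : ℕ} :
      Eval P ρ a (.num x) s → Eval P ρ b (.num y) t →
      Eval P ρ (.sub a b) (.num (x - y)) (s + t + 1)
  | mul {ρ : List Val} {a b : Expr} {x y : ℂ} {s t : ℕ} :
      Eval P ρ a (.num x) s → Eval P ρ b (.num y) t →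
      Eval P ρ (.mul a b) (.num (x * y)) (s + t + 1)
  | ifTrue {ρ : List Val} {a b e₁ e₂ : Expr} {x y : ℂ} {v : Val} {s t r : ℕ} :
      Eval P ρ a (.num x) s → Eval P ρ b (.num y) t → x = y → Eval P ρ e₁ v r →
      Eval P ρ (.ifEq a b e₁ e₂) v (s + t + r + 1)
  | ifFalse {ρ : List Val} {a b e₁ e₂ : Expr} {x y : ℂ} {v : Val} {s t r : ℕ} :
      Eval P ρ a (.num x) s → Eval P ρ b (.num y) t → x ≠ y → Eval P ρ e₂ v r →
      Eval P ρ (.ifEq a b e₁ e₂) v (s + t + r + 1)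

/-- On the input `x` the program `P` halts after `t` steps with the output `y`. -/
def Program.Runs (P : Program) (x y : Val) (t : ℕ) : Prop :=
  Eval P [x] (.call 0 (.var 0)) y t

/-! ### The encoding of an instance as an input -/

/-- A list of values as a value. -/
def Val.ofList : List Val → Val
  | [] => .nil
  | v :: l => .pair v (Val.ofList l)

/-- A natural number in unary. -/
def Val.ofNat (k : ℕ) : Val := Val.ofList (List.replicate k .nil)

/-- The word `0⋯0 1⋯1 ⋯` over `[q]` in which every letter `i` occurs `c i` times. -/
def countWord {q : ℕ} (c : Fin q → ℕ) : List (Fin q) :=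
  (List.finRange q).flatMap (fun i => List.replicate (c i) i)

theorem length_countWord {q : ℕ} (c : Fin q → ℕ) : (countWord c).length = ∑ i, c i := by
  simp [countWord, List.length_flatMap, Fin.sum_univ_def]

/-- The value of a symmetric function on the arguments among which every `i` occurs `c i` times. -/
def atCounts {q d : ℕ} (f : (Fin d → Fin q) → ℂ) (c : Fin q → ℕ) (hc : ∑ i, c i = d) : ℂ :=
  f (fun j => (countWord c).get (j.cast ((length_countWord c).trans hc).symm))

/-- The table of a symmetric function `f` of arity `d`: the list of the pairs of a count vector
`(c₀, …, c_{q-1})` with sum `d` and the value of `f` there, over all these count vectors. -/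
noncomputable def encodeFun {q d : ℕ} (f : (Fin d → Fin q) → ℂ) : Val :=
  Val.ofList ((List.Nat.antidiagonalTuple q d).attach.map (fun c =>
    .pair (Val.ofList (List.ofFn (fun i => Val.ofNat (c.1 i))))
      (.num (atCounts f c.1 (List.Nat.mem_antidiagonalTuple.1 c.2)))))

/-- The encoding of an instance: the list, over the vertices `v = 0, …, n-1`, of the pairs of the
list of the neighbours of `v` and the table of `f_v`. -/
noncomputable def Instance.encode {q : ℕ} (Ω : Instance q) : Val :=
  Val.ofList (List.ofFn (fun v : Fin Ω.n =>
    .pair (Val.ofList (List.ofFn (fun i => Val.ofNat (Ω.nbr v i)))) (encodeFun (Ω.f v))))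

end Holant

/-! The algorithm is dynamic programming over a recursive bisection of the edge set. An assignment
to a set `F` of edges affects the rest of the instance only through the vector, at each vertex `v`,
counting how often every value occurs on the edges of `F` at `v`. Since `f_v` is symmetric, this
vector determines the function that remains after pinning those arguments, and by regularity at most
`C` such functions occur for a given number of arguments. At a vertex with none or all of its edges
in `F` nothing has to be remembered. Hence `F` is described by at most `C ^ |∂F|` weighted states,
where `∂F` consists of the vertices with edges both inside and outside `F` (`WellFormed.length_le`),
and the tables of two disjoint sets are merged by adding states and multiplying weights
(`WellFormed.represents_merge`). Equivalence of count vectors is tested on the given value tables,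
so `C` need not be known.

It remains to split the edge set down to single edges with all boundaries of size at most `3k + 2`,
where `k = tw + 1`. If `|∂F| ≤ 3k`, one edge is cut off, which adds at most two boundary vertices.
Otherwise a bag of a tree decomposition separates `∂F` into two parts of at most two thirds of its
size, and splitting `F` accordingly gives boundaries of size at most `2|∂F|/3 + k` (`exists_split`).
No tree decomposition is computed: all `2 ^ |∂F|` bipartitions of `∂F` are tried, a minimum
separation is found for each by bipartite matching and Kőnig's theorem (`side_spec`), and the best
split is kept.

For the running time, `Poly` expresses computability in time polynomial in a measure that need not
be visible in the encoding. The measure of an instance includes `(C + 2) ^ (3 tw + 5)`, although the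
program never sees this number. Polynomial in the measure then means `2 ^ O(tw) * poly(n)`, with one
program for all `C`. -/

namespace Holant

/-! ### Evaluation with an upper bound on the number of steps -/

/-- `e` evaluates to `v` in at most `t` steps. -/
def EvalLe (P : Program) (ρ : List Val) (e : Expr) (v : Val) (t : ℕ) : Prop :=
  ∃ s ≤ t, Eval P ρ e v s

namespace EvalLe

variable {P : Program} {ρ : List Val}

theorem mono {e : Expr} {v : Val} {s t : ℕ} (h : EvalLe P ρ e v s) (hst : s ≤ t) :
    EvalLe P ρ e v t := by
  obtain ⟨r, hr, he⟩ := h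
  exact ⟨r, hr.trans hst, he⟩

theorem var {i : ℕ} {v : Val} (h : ρ[i]? = some v) : EvalLe P ρ (.var i) v 1 :=
  ⟨1, le_rfl, .var h⟩

theorem nil : EvalLe P ρ .nil .nil 1 := ⟨1, le_rfl, .nil⟩

theorem zero : EvalLe P ρ .zero (.num 0) 1 := ⟨1, le_rfl, .zero⟩

theorem one : EvalLe P ρ .one (.num 1) 1 := ⟨1, le_rfl, .one⟩

theorem pair {a b : Expr} {u v : Val} {s t : ℕ} (ha : EvalLe P ρ a u s) (hb : EvalLe P ρ b v t) :
    EvalLe P ρ (.pair a b) (.pair u v) (s + t + 1) := by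
  obtain ⟨s', hs, ha⟩ := ha
  obtain ⟨t', ht, hb⟩ := hb
  exact ⟨_, by omega, .pair ha hb⟩

theorem caseNil {e e₀ e₁ : Expr} {v : Val} {s t : ℕ} (h : EvalLe P ρ e .nil s)
    (h₀ : EvalLe P ρ e₀ v t) : EvalLe P ρ (.caseOf e e₀ e₁) v (s + t + 1) := by
  obtain ⟨s', hs, ha⟩ := h
  obtain ⟨t', ht, hb⟩ := h₀
  exact ⟨_, by omega, .caseNil ha hb⟩

theorem casePair {e e₀ e₁ : Expr} {a b v : Val} {s t : ℕ} (h : EvalLe P ρ e (.pair a b) s)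
    (h₁ : EvalLe P (a :: b :: ρ) e₁ v t) : EvalLe P ρ (.caseOf e e₀ e₁) v (s + t + 1) := by
  obtain ⟨s', hs, ha⟩ := h
  obtain ⟨t', ht, hb⟩ := h₁
  exact ⟨_, by omega, .casePair ha hb⟩

theorem call {i : ℕ} {e body : Expr} {u v : Val} {s t : ℕ} (h : EvalLe P ρ e u s)
    (hi : P[i]? = some body) (hb : EvalLe P [u] body v t) :
    EvalLe P ρ (.call i e) v (s + t + 1) := by
  obtain ⟨s', hs, ha⟩ := h
  obtain ⟨t', ht, hb⟩ := hb
  exact ⟨_, by omega, .call ha hi hb⟩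

theorem add {a b : Expr} {x y : ℂ} {s t : ℕ} (ha : EvalLe P ρ a (.num x) s)
    (hb : EvalLe P ρ b (.num y) t) : EvalLe P ρ (.add a b) (.num (x + y)) (s + t + 1) := by
  obtain ⟨s', hs, ha⟩ := ha
  obtain ⟨t', ht, hb⟩ := hb
  exact ⟨_, by omega, .add ha hb⟩

theorem mul {a b : Expr} {x y : ℂ} {s t : ℕ} (ha : EvalLe P ρ a (.num x) s)
    (hb : EvalLe P ρ b (.num y) t) : EvalLe P ρ (.mul a b) (.num (x * y)) (s + t + 1) := by
  obtain ⟨s', hs, ha⟩ := ha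
  obtain ⟨t', ht, hb⟩ := hb
  exact ⟨_, by omega, .mul ha hb⟩

theorem ifTrue {a b e₁ e₂ : Expr} {x y : ℂ} {v : Val} {s t r : ℕ}
    (ha : EvalLe P ρ a (.num x) s) (hb : EvalLe P ρ b (.num y) t) (hxy : x = y)
    (h : EvalLe P ρ e₁ v r) : EvalLe P ρ (.ifEq a b e₁ e₂) v (s + t + r + 1) := by
  obtain ⟨s', hs, ha⟩ := ha
  obtain ⟨t', ht, hb⟩ := hb
  obtain ⟨r', hr, h⟩ := h
  exact ⟨_, by omega, .ifTrue ha hb hxy h⟩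

theorem ifFalse {a b e₁ e₂ : Expr} {x y : ℂ} {v : Val} {s t r : ℕ}
    (ha : EvalLe P ρ a (.num x) s) (hb : EvalLe P ρ b (.num y) t) (hxy : x ≠ y)
    (h : EvalLe P ρ e₂ v r) : EvalLe P ρ (.ifEq a b e₁ e₂) v (s + t + r + 1) := by
  obtain ⟨s', hs, ha⟩ := ha
  obtain ⟨t', ht, hb⟩ := hb
  obtain ⟨r', hr, h⟩ := h
  exact ⟨_, by omega, .ifFalse ha hb hxy h⟩

end EvalLe

/-! ### Linking programs -/

/-- Renumber the called functions. -/
def Expr.shift (k : ℕ) : Expr → Expr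
  | .var i => .var i
  | .nil => .nil
  | .pair a b => .pair (a.shift k) (b.shift k)
  | .caseOf e e₀ e₁ => .caseOf (e.shift k) (e₀.shift k) (e₁.shift k)
  | .letIn e e₁ => .letIn (e.shift k) (e₁.shift k)
  | .call i e => .call (i + k) (e.shift k)
  | .zero => .zero
  | .one => .one
  | .add a b => .add (a.shift k) (b.shift k)
  | .sub a b => .sub (a.shift k) (b.shift k)
  | .mul a b => .mul (a.shift k) (b.shift k)
  | .ifEq a b e₁ e₂ => .ifEq (a.shift k) (b.shift k) (e₁.shift k) (e₂.shift k)

/-- Only the rule for calls consults the program, so a derivation carries over rule by rule with the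
same cost. -/
theorem Eval.shift {P R : Program} {k : ℕ}
    (hR : ∀ i b, P[i]? = some b → R[i + k]? = some (b.shift k)) {ρ : List Val} {e : Expr} {v : Val}
    {t : ℕ} (h : Eval P ρ e v t) : Eval R ρ (e.shift k) v t := by
  induction h with
  | var h => exact .var h
  | nil => exact .nil
  | pair _ _ h₁ h₂ => exact .pair h₁ h₂
  | caseNil _ _ h₁ h₂ => exact .caseNil h₁ h₂
  | casePair _ _ h₁ h₂ => exact .casePair h₁ h₂
  | letIn _ _ h₁ h₂ => exact .letIn h₁ h₂
  | call _ hi _ h₁ h₂ => exact .call h₁ (hR _ _ hi) h₂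
  | zero => exact .zero
  | one => exact .one
  | add _ _ h₁ h₂ => exact .add h₁ h₂
  | sub _ _ h₁ h₂ => exact .sub h₁ h₂
  | mul _ _ h₁ h₂ => exact .mul h₁ h₂
  | ifTrue _ _ hxy _ h₁ h₂ h₃ => exact .ifTrue h₁ h₂ hxy h₃
  | ifFalse _ _ hxy _ h₁ h₂ h₃ => exact .ifFalse h₁ h₂ hxy h₃

/-- The functions `M`, which may call those of `P` and `Q`. -/
def link (M : List Expr) (P Q : Program) : Program :=
  M ++ (P.map (Expr.shift M.length) ++ Q.map (Expr.shift (M.length + P.length)))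

/-- The main function of `P` maps `x` to `y` in at most `t` steps. -/
def Program.RunsLe (P : Program) (x y : Val) (t : ℕ) : Prop :=
  EvalLe P [x] (.call 0 (.var 0)) y t

/-- A run consists of a variable lookup, the call and the body. Evaluating `e` replaces the lookup,
so the cost of the call itself is already contained in `t`. -/
theorem Program.RunsLe.call_of_shift {P R : Program} {k : ℕ}
    (hR : ∀ i b, P[i]? = some b → R[i + k]? = some (b.shift k)) {ρ : List Val} {e : Expr}
    {x y : Val} {s t : ℕ} (h : P.RunsLe x y t) (he : EvalLe R ρ e x s) :
    EvalLe R ρ (.call k e) y (s + t) := by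
  obtain ⟨r, hr, h⟩ := h
  cases h with
  | call h₁ hi h₂ =>
    cases h₁ with
    | var h₁ =>
      simp only [List.getElem?_cons_zero, Option.some.injEq] at h₁
      subst h₁
      obtain ⟨s', hs, he⟩ := he
      have := hR _ _ hi
      rw [zero_add] at this
      exact ⟨_, by omega, .call he this (h₂.shift hR)⟩

theorem Program.RunsLe.link_left {M : List Expr} {P Q : Program} {ρ : List Val} {e : Expr}
    {x y : Val} {s t : ℕ} (h : P.RunsLe x y t) (he : EvalLe (link M P Q) ρ e x s) :
    EvalLe (link M P Q) ρ (.call M.length e) y (s + t) := by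
  refine h.call_of_shift (fun i b hi => ?_) he
  have hlt : i < P.length := (List.getElem?_eq_some_iff.1 hi).1
  rw [link, List.getElem?_append_right (by omega), List.getElem?_append_left (by simp; omega)]
  simp [hi]

theorem Program.RunsLe.link_right {M : List Expr} {P Q : Program} {ρ : List Val} {e : Expr}
    {x y : Val} {s t : ℕ} (h : Q.RunsLe x y t) (he : EvalLe (link M P Q) ρ e x s) :
    EvalLe (link M P Q) ρ (.call (M.length + P.length) e) y (s + t) := by
  refine h.call_of_shift (fun i b hi => ?_) he
  rw [link, List.getElem?_append_right (by omega), List.getElem?_append_right (by simp; omega)]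
  simp only [List.length_map]
  rw [show i + (M.length + P.length) - M.length - P.length = i by omega]
  simp [hi]

theorem Program.RunsLe.of_single {e : Expr} {x y : Val} {t : ℕ} (h : EvalLe [e] [x] e y t) :
    Program.RunsLe [e] x y (t + 2) :=
  (EvalLe.call (EvalLe.var rfl) rfl h).mono (by omega)

/-! ### Encodings and polynomial bounds -/

/-- A type of data for programs: `enc` is the encoding, `ms` the measure in terms of which
bounds are stated. -/
class Enc (α : Type) where
  enc : α → Val
  ms : α → ℕ

end Holant

/-! ### Calculus of polynomial-time functions: composition, pairs, lists, complex numbers, folds -/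

namespace Holant
open Enc (enc ms)

instance : Enc Unit := ⟨fun _ => .nil, fun _ => 0⟩
instance : Enc ℂ := ⟨fun z => .num z, fun _ => 0⟩
instance : Enc ℕ := ⟨Val.ofNat, fun n => n⟩
instance : Enc Bool := ⟨fun b => bif b then .pair .nil .nil else .nil, fun _ => 0⟩
instance {α β : Type} [Enc α] [Enc β] : Enc (α × β) :=
  ⟨fun x => .pair (enc x.1) (enc x.2), fun x => ms x.1 + ms x.2⟩
instance {α : Type} [Enc α] : Enc (List α) :=
  ⟨fun l => Val.ofList (l.map enc), fun l => (l.map fun a => ms a + 1).sum⟩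
instance {q : ℕ} : Enc (Fin q → ℕ) :=
  ⟨fun c => enc (List.ofFn c), fun c => ms (List.ofFn c)⟩

section
variable {α β γ σ : Type} [Enc α] [Enc β] [Enc γ] [Enc σ]

theorem ms_nil : ms ([] : List α) = 0 := rfl
theorem ms_cons (a : α) (l : List α) : ms (a :: l) = ms a + 1 + ms l := by simp [ms]
theorem ms_prod (a : α) (b : β) : ms (a, b) = ms a + ms b := rfl
theorem ms_append (l l' : List α) : ms (l ++ l') = ms l + ms l' := by simp [ms]

theorem length_le_ms (l : List α) : l.length ≤ ms l := by
  induction l with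
  | nil => simp
  | cons a l ih => rw [ms_cons, List.length_cons]; omega

theorem ms_le_of_mem {a : α} {l : List α} (h : a ∈ l) : ms a ≤ ms l := by
  induction l with
  | nil => simp at h
  | cons b l ih =>
    rw [ms_cons]
    rcases List.mem_cons.1 h with rfl | h
    · omega
    · have := ih h; omega

theorem ms_le_of_sublist {l l' : List α} (h : l.Sublist l') : ms l ≤ ms l' := by
  induction h with
  | slnil => simp
  | cons a _ ih => rw [ms_cons]; omega
  | cons_cons a _ ih => rw [ms_cons, ms_cons]; omega

theorem ms_le_length_mul {l : List α} {b : ℕ} (h : ∀ a ∈ l, ms a ≤ b) :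
    ms l ≤ l.length * (b + 1) := by
  induction l with
  | nil => simp [ms_nil]
  | cons a l ih =>
    rw [ms_cons, List.length_cons, add_mul]
    have := ih fun a ha => h a (List.mem_cons_of_mem _ ha)
    have := h a List.mem_cons_self
    omega

/-- `g` is bounded by a polynomial in the measure. -/
def PBd (g : α → ℕ) : Prop := ∃ k, ∀ a, g a ≤ (ms a + 2) ^ k

theorem PBd.mono {f g : α → ℕ} (hg : PBd g) (h : ∀ a, f a ≤ g a) : PBd f := by
  obtain ⟨k, hk⟩ := hg
  exact ⟨k, fun a => (h a).trans (hk a)⟩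

/-- The base `ms a + 2` is at least `2`, so constants are absorbed by `c < 2 ^ c`. -/
theorem PBd.const (c : ℕ) : PBd (fun _ : α => c) :=
  ⟨c, fun a => (Nat.lt_two_pow_self).le.trans (Nat.pow_le_pow_left (by omega) c)⟩

theorem PBd.ms : PBd (fun a : α => ms a) := ⟨1, fun a => by simp⟩

theorem PBd.add {f g : α → ℕ} (hf : PBd f) (hg : PBd g) : PBd (fun a => f a + g a) := by
  obtain ⟨j, hj⟩ := hf
  obtain ⟨k, hk⟩ := hg
  refine ⟨j + k + 1, fun a => ?_⟩
  have h₁ := (hj a).trans (Nat.pow_le_pow_right (by omega) (Nat.le_add_right j k))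
  have h₂ := (hk a).trans (Nat.pow_le_pow_right (by omega) (Nat.le_add_left k j))
  rw [pow_succ]
  nlinarith [Nat.zero_le (Enc.ms a), Nat.zero_le ((Enc.ms a + 2) ^ (j + k))]

theorem PBd.mul {f g : α → ℕ} (hf : PBd f) (hg : PBd g) : PBd (fun a => f a * g a) := by
  obtain ⟨j, hj⟩ := hf
  obtain ⟨k, hk⟩ := hg
  exact ⟨j + k, fun a => by rw [pow_add]; exact Nat.mul_le_mul (hj a) (hk a)⟩

theorem PBd.pow {f : α → ℕ} (hf : PBd f) (n : ℕ) : PBd (fun a => f a ^ n) := by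
  obtain ⟨j, hj⟩ := hf
  exact ⟨j * n, fun a => by rw [pow_mul]; exact Nat.pow_le_pow_left (hj a) n⟩

theorem PBd.comp {g : β → ℕ} {f : α → β} (hg : PBd g) (hf : PBd (fun a => Enc.ms (f a))) :
    PBd (fun a => g (f a)) := by
  obtain ⟨k, hk⟩ := hg
  have : PBd fun a => (Enc.ms (f a) + 2) ^ k := (hf.add (.const 2)).pow k
  exact this.mono fun a => hk (f a)

/-- `f` is computed by a program in time polynomial in the measure of the argument, and the measure
of its value is polynomially bounded as well. -/
@[fun_prop]
def Poly (f : α → β) : Prop :=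
  ∃ (P : Program) (T : α → ℕ), PBd (fun a => ms (f a)) ∧ PBd T ∧
    ∀ a, P.RunsLe (enc a) (enc (f a)) (T a)

theorem Poly.pbd {f : α → β} (h : Poly f) : PBd (fun a => ms (f a)) := by
  obtain ⟨_, _, h, _⟩ := h
  exact h

/-- A function computed by one non-recursive expression in constant time. -/
theorem Poly.of_expr {f : α → β} (e : Expr) (t : ℕ) (hf : PBd (fun a => ms (f a)))
    (h : ∀ a, EvalLe [e] [enc a] e (enc (f a)) t) : Poly f :=
  ⟨[e], fun _ => t + 2, hf, .const _, fun a => .of_single (h a)⟩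

/-- Only the encoded values matter. -/
theorem Poly.of_enc_eq {f : α → β} {g : α → γ} (hf : Poly f) (h : ∀ a, enc (g a) = enc (f a))
    (hm : PBd (fun a => ms (g a))) : Poly g := by
  obtain ⟨P, T, _, hT, hP⟩ := hf
  exact ⟨P, T, hm, hT, fun a => by rw [h]; exact hP a⟩

theorem Poly.of_eq {f g : α → β} (hf : Poly f) (h : ∀ a, g a = f a) : Poly g :=
  (funext h : g = f) ▸ hf

@[fun_prop]
theorem Poly.id : Poly (fun a : α => a) :=
  .of_expr (.var 0) 1 .ms fun _ => .var rfl

-- This is why `Poly` also bounds the size of the value: the time of `g` is polynomial in `ms (f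
-- a)`, hence in `ms a`.
@[fun_prop]
theorem Poly.comp {g : β → γ} {f : α → β} (hg : Poly g) (hf : Poly f) :
    Poly (fun a => g (f a)) := by
  have hb := hg.pbd.comp hf.pbd
  obtain ⟨P, T, hf', hT, hP⟩ := hf
  obtain ⟨Q, U, _, hU, hQ⟩ := hg
  refine ⟨link [.call (1 + P.length) (.call 1 (.var 0))] P Q, fun a => T a + U (f a) + 4, hb,
    (hT.add (hU.comp hf')).add (.const _), fun a => ?_⟩
  refine (EvalLe.call (EvalLe.var rfl) rfl
    ((hQ (f a)).link_right ((hP a).link_left (EvalLe.var rfl)))).mono ?_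
  beta_reduce
  omega

@[fun_prop]
theorem Poly.prodMk {f : α → β} {g : α → γ} (hf : Poly f) (hg : Poly g) :
    Poly (fun a => (f a, g a)) := by
  obtain ⟨P, T, hf', hT, hP⟩ := hf
  obtain ⟨Q, U, hg', hU, hQ⟩ := hg
  refine ⟨link [.pair (.call 1 (.var 0)) (.call (1 + P.length) (.var 0))] P Q,
    fun a => T a + U a + 6, hf'.add hg', (hT.add hU).add (.const _), fun a => ?_⟩
  refine (EvalLe.call (EvalLe.var rfl) rfl
    (((hP a).link_left (EvalLe.var rfl)).pair ((hQ a).link_right (EvalLe.var rfl)))).mono ?_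
  beta_reduce
  omega

@[fun_prop]
theorem Poly.fst {f : α → β × γ} (hf : Poly f) : Poly (fun a => (f a).1) := by
  have : Poly (fun x : β × γ => x.1) :=
    .of_expr (.caseOf (.var 0) .nil (.var 0)) 3 (PBd.ms.mono fun x => Nat.le_add_right _ _)
      fun _ => .casePair (.var rfl) (.var rfl)
  exact this.comp hf

@[fun_prop]
theorem Poly.snd {f : α → β × γ} (hf : Poly f) : Poly (fun a => (f a).2) := by
  have : Poly (fun x : β × γ => x.2) :=
    .of_expr (.caseOf (.var 0) .nil (.var 1)) 3 (PBd.ms.mono fun x => Nat.le_add_left _ _)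
      fun _ => .casePair (.var rfl) (.var rfl)
  exact this.comp hf

/-- Values that programs can build from nothing. -/
class Constructible (b : β) : Prop where
  poly (b) : Poly (fun _ : Unit => b)

theorem Poly.unit : Poly (fun _ : α => ()) :=
  .of_expr .nil 1 (.const 0) fun _ => .nil

@[fun_prop]
theorem Poly.const (b : β) [h : Constructible b] : Poly (fun _ : α => b) :=
  h.poly.comp Poly.unit

instance : Constructible () := ⟨.unit⟩
instance : Constructible ([] : List β) := ⟨.of_expr .nil 1 (.const 0) fun _ => .nil⟩
instance : Constructible (0 : ℂ) := ⟨.of_expr .zero 1 (.const 0) fun _ => .zero⟩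
instance : Constructible (1 : ℂ) := ⟨.of_expr .one 1 (.const 0) fun _ => .one⟩
instance : Constructible false := ⟨.of_expr .nil 1 (.const 0) fun _ => .nil⟩
instance : Constructible true :=
  ⟨.of_expr (.pair .nil .nil) 3 (.const 0) fun _ => .pair .nil .nil⟩
instance (b : β) (c : γ) [hb : Constructible b] [hc : Constructible c] : Constructible (b, c) :=
  ⟨hb.poly.prodMk hc.poly⟩

@[fun_prop]
theorem Poly.cons {f : α → β} {g : α → List β} (hf : Poly f) (hg : Poly g) :
    Poly (fun a => f a :: g a) :=
  (hf.prodMk hg).of_enc_eq (fun _ => rfl) <| by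
    refine ((hf.pbd.add (.const 1)).add hg.pbd).mono fun a => ?_
    rw [ms_cons]

instance (b : β) (l : List β) [hb : Constructible b] [hl : Constructible l] :
    Constructible (b :: l) := ⟨hb.poly.cons hl.poly⟩

theorem ms_tail_le (l : List β) : ms l.tail ≤ ms l := ms_le_of_sublist l.tail_sublist

@[fun_prop]
theorem Poly.tail {f : α → List β} (hf : Poly f) : Poly (fun a => (f a).tail) := by
  have : Poly (fun l : List β => l.tail) := by
    refine .of_expr (.caseOf (.var 0) .nil (.var 1)) 3 (PBd.ms.mono ms_tail_le) fun l => ?_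
    cases l with
    | nil => exact .caseNil (.var rfl) .nil
    | cons a l => exact .casePair (.var rfl) (.var rfl)
  exact this.comp hf

theorem ms_headD_le (l : List β) (b : β) : ms (l.headD b) ≤ ms l + ms b := by
  cases l with
  | nil => simp
  | cons a l => rw [ms_cons]; simp; omega

@[fun_prop]
theorem Poly.headD {f : α → List β} {g : α → β} (hf : Poly f) (hg : Poly g) :
    Poly (fun a => (f a).headD (g a)) := by
  have : Poly (fun x : List β × β => x.1.headD x.2) := by
    refine .of_expr (.caseOf (.var 0) .nil (.caseOf (.var 0) (.var 1) (.var 0))) 5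
      (PBd.ms.mono fun x => ms_headD_le _ _) fun x => ?_
    obtain ⟨l, b⟩ := x
    cases l with
    | nil => exact .casePair (.var rfl) (.caseNil (.var rfl) (.var rfl))
    | cons a l => exact .casePair (.var rfl) (.casePair (.var rfl) (.var rfl))
  exact this.comp (hf.prodMk hg)

@[fun_prop]
theorem Poly.isEmpty {f : α → List β} (hf : Poly f) : Poly (fun a => (f a).isEmpty) := by
  have : Poly (fun l : List β => l.isEmpty) := by
    refine .of_expr (.caseOf (.var 0) (.pair .nil .nil) .nil) 5 (.const 0) fun l => ?_
    cases l with
    | nil => exact .caseNil (.var rfl) (.pair .nil .nil)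
    | cons a l => exact (EvalLe.casePair (.var rfl) .nil).mono (by norm_num)
  exact this.comp hf

@[fun_prop]
theorem Poly.bif {p : α → Bool} {f g : α → β} (hp : Poly p) (hf : Poly f) (hg : Poly g) :
    Poly (fun a => bif p a then f a else g a) := by
  have : Poly (fun x : Bool × β × β => bif x.1 then x.2.1 else x.2.2) := by
    refine .of_expr (.caseOf (.var 0) .nil (.caseOf (.var 1) .nil (.caseOf (.var 2) (.var 1)
      (.var 2)))) 7 (PBd.ms.mono fun x => ?_) fun x => ?_
    · obtain ⟨_ | _, b, c⟩ := x <;> simp [ms_prod] <;> omega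
    · obtain ⟨_ | _, b, c⟩ := x
      · exact .casePair (.var rfl) (.casePair (.var rfl) (.caseNil (.var rfl) (.var rfl)))
      · exact .casePair (.var rfl) (.casePair (.var rfl) (.casePair (.var rfl) (.var rfl)))
  exact this.comp (hp.prodMk (hf.prodMk hg))

@[fun_prop]
theorem Poly.cadd {f g : α → ℂ} (hf : Poly f) (hg : Poly g) : Poly (fun a => f a + g a) := by
  have : Poly (fun x : ℂ × ℂ => x.1 + x.2) :=
    .of_expr (.caseOf (.var 0) .nil (.add (.var 0) (.var 1))) 5 (.const 0)
      fun _ => .casePair (.var rfl) (.add (.var rfl) (.var rfl))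
  exact this.comp (hf.prodMk hg)

@[fun_prop]
theorem Poly.cmul {f g : α → ℂ} (hf : Poly f) (hg : Poly g) : Poly (fun a => f a * g a) := by
  have : Poly (fun x : ℂ × ℂ => x.1 * x.2) :=
    .of_expr (.caseOf (.var 0) .nil (.mul (.var 0) (.var 1))) 5 (.const 0)
      fun _ => .casePair (.var rfl) (.mul (.var rfl) (.var rfl))
  exact this.comp (hf.prodMk hg)

open Classical in
/-- The equality test for complex numbers. -/
noncomputable def ceq (x y : ℂ) : Bool := decide (x = y)

@[simp]
theorem ceq_iff {x y : ℂ} : ceq x y = true ↔ x = y := by simp [ceq]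

@[fun_prop]
theorem Poly.ceq {f g : α → ℂ} (hf : Poly f) (hg : Poly g) : Poly (fun a => ceq (f a) (g a)) := by
  have : Poly (fun x : ℂ × ℂ => Holant.ceq x.1 x.2) := by
    refine .of_expr (.caseOf (.var 0) .nil (.ifEq (.var 0) (.var 1) (.pair .nil .nil) .nil)) 8
      (.const 0) fun x => ?_
    by_cases h : x.1 = x.2
    · have h' : Holant.ceq x.1 x.2 = true := ceq_iff.2 h
      simp only [h']
      exact .casePair (.var rfl) (.ifTrue (.var rfl) (.var rfl) h (.pair .nil .nil))
    · have h' : Holant.ceq x.1 x.2 = false := by simp [Holant.ceq, h]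
      simp only [h']
      exact (EvalLe.casePair (.var rfl) (.ifFalse (.var rfl) (.var rfl) h .nil)).mono (by norm_num)
  exact this.comp (hf.prodMk hg)

/-- A polynomial-time step may double the accumulator each time, so a bound on all intermediate
results must be supplied. These are exactly the folds over suffixes of the list. -/
theorem Poly.foldr {f : α → List β} {g : α → σ} {h : α → β → σ → σ} (hf : Poly f) (hg : Poly g)
    (hh : Poly (fun x : α × β × σ => h x.1 x.2.1 x.2.2))
    (hb : ∃ B : α → ℕ, PBd B ∧ ∀ a l, l <:+ f a → ms (l.foldr (h a) (g a)) ≤ B a) :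
    Poly (fun a => (f a).foldr (h a) (g a)) := by
  obtain ⟨B, hB, hb⟩ := hb
  have hf' := hf.pbd
  obtain ⟨P, T, -, hT, hP⟩ := Poly.id.prodMk (hf.prodMk hg)
  obtain ⟨Q, U, _, ⟨k, hU⟩, hQ⟩ := hh
  -- The argument is the triple of `a`, the remaining list and the initial value; `a` is passed
  -- along because a function body sees nothing but its argument.
  let loop : Expr := .caseOf (.var 0) .nil (.caseOf (.var 1) .nil (.caseOf (.var 0) (.var 1)
    (.call (2 + P.length) (.pair (.var 4) (.pair (.var 0)
      (.call 1 (.pair (.var 4) (.pair (.var 1) (.var 3)))))))))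
  -- Bounds the cost of every single application of `h`, since both the list element and the
  -- accumulator are bounded in terms of `a`.
  let S : α → ℕ := fun a => (ms a + (ms (f a) + B a) + 2) ^ k
  refine ⟨link [.call 1 (.call 2 (.var 0)), loop] P Q,
    fun a => T a + (ms (f a) + 1) * (S a + 30), hB.mono fun a => hb a _ List.suffix_rfl,
    hT.add ((hf'.add (.const 1)).mul
      ((((PBd.ms.add (hf'.add hB)).add (.const 2)).pow k).add (.const 30))), fun a => ?_⟩
  have key : ∀ l, l <:+ f a → EvalLe (link [.call 1 (.call 2 (.var 0)), loop] P Q)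
      [enc (a, l, g a)] loop (enc (l.foldr (h a) (g a))) (l.length * (S a + 20) + 10) := by
    intro l
    induction l with
    | nil =>
      intro _
      refine (EvalLe.casePair (.var rfl) (.casePair (.var rfl)
        (.caseNil (.var rfl) (.var rfl)))).mono (by simp)
    | cons b l ih =>
      intro hl
      have hl' : l <:+ f a := (List.suffix_cons b l).trans hl
      refine (EvalLe.casePair (.var rfl) (.casePair (.var rfl) (.casePair (.var rfl)
        ((hQ (a, b, l.foldr (h a) (g a))).link_right
          (.pair (.var rfl) (.pair (.var rfl)
            (.call (.pair (.var rfl) (.pair (.var rfl) (.var rfl))) rfl (ih hl')))))))).mono ?_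
      have h₁ := hU (a, b, l.foldr (h a) (g a))
      have h₂ : (ms (a, b, l.foldr (h a) (g a)) + 2) ^ k ≤ S a := by
        refine Nat.pow_le_pow_left ?_ k
        have h₃ : ms b ≤ ms (f a) := ms_le_of_mem (hl.subset List.mem_cons_self)
        have h₄ := hb a l hl'
        rw [ms_prod, ms_prod]
        omega
      rw [List.length_cons, add_mul]
      omega
  refine (EvalLe.call (EvalLe.var rfl) rfl (EvalLe.call ((hP a).link_left (EvalLe.var rfl)) rfl
    (key _ List.suffix_rfl))).mono ?_
  have := Nat.mul_le_mul_right (S a + 20) (length_le_ms (f a))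
  have : (ms (f a) + 1) * (S a + 30) = ms (f a) * (S a + 20) + 10 * ms (f a) + S a + 30 := by ring
  beta_reduce
  omega

end
end Holant

/-! ### Polynomial-time list operations, Booleans and unary arithmetic -/

namespace Holant
open Enc (enc ms)

section
variable {α β γ σ : Type} [Enc α] [Enc β] [Enc γ] [Enc σ]

theorem ms_map_le {β γ : Type} [Enc γ] {l : List β} {h : β → γ} {b : ℕ} (hb : ∀ x ∈ l, ms (h x) ≤ b) :
    ms (l.map h) ≤ l.length * (b + 1) := by
  simpa using ms_le_length_mul (l := l.map h) (b := b) (by simpa using hb)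

@[fun_prop]
theorem Poly.map {f : α → List β} {h : α → β → γ} (hf : Poly f)
    (hh : Poly (fun x : α × β => h x.1 x.2)) : Poly (fun a => (f a).map (h a)) := by
  have key : Poly (fun a => (f a).foldr (fun b l => h a b :: l) []) := by
    refine hf.foldr (h := fun a b l => h a b :: l) (.const []) ?_ ?_
    · exact (hh.comp (f := fun x : α × β × List γ => (x.1, x.2.1)) (by fun_prop)).cons
        (by fun_prop)
    · obtain ⟨k, hk⟩ := hh.pbd
      refine ⟨fun a => ms (f a) * ((ms a + ms (f a) + 2) ^ k + 1),
        hf.pbd.mul ((((PBd.ms.add hf.pbd).add (.const 2)).pow k).add (.const 1)),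
        fun a l hl => ?_⟩
      rw [← List.map_eq_foldr]
      refine (ms_map_le (b := (ms a + ms (f a) + 2) ^ k) fun x hx => ?_).trans
        (Nat.mul_le_mul_right _ (hl.length_le.trans (length_le_ms _)))
      have h₁ := ms_le_of_mem (hl.subset hx)
      exact (hk (a, x)).trans (Nat.pow_le_pow_left (by rw [ms_prod]; omega) k)
  exact key.of_eq fun a => List.map_eq_foldr

@[fun_prop]
theorem Poly.filter {f : α → List β} {p : α → β → Bool} (hf : Poly f)
    (hp : Poly (fun x : α × β => p x.1 x.2)) : Poly (fun a => (f a).filter (p a)) := by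
  have key : Poly (fun a => (f a).foldr (fun b l => bif p a b then b :: l else l) []) := by
    refine hf.foldr (h := fun a b l => bif p a b then b :: l else l) (.const []) ?_
      ⟨_, hf.pbd, fun a l hl => ?_⟩
    · exact (hp.comp (f := fun x : α × β × List β => (x.1, x.2.1)) (by fun_prop)).bif
        (by fun_prop) (by fun_prop)
    · refine ms_le_of_sublist (List.Sublist.trans ?_ hl.sublist)
      rw [show l.foldr (fun b l => bif p a b then b :: l else l) [] = l.filter (p a) by
        induction l with
        | nil => rfl
        | cons b l ih => cases hb : p a b <;> simp [hb, ih ((List.suffix_cons b l).trans hl)]]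
      exact List.filter_sublist
  refine key.of_eq fun a => ?_
  induction f a with
  | nil => rfl
  | cons b l ih => cases hb : p a b <;> simp [hb, ih]

@[fun_prop]
theorem Poly.append {f g : α → List β} (hf : Poly f) (hg : Poly g) :
    Poly (fun a => f a ++ g a) := by
  have key : Poly (fun a => (f a).foldr (fun b l => b :: l) (g a)) := by
    refine hf.foldr (h := fun _ b l => b :: l) hg (by fun_prop) ⟨_, hf.pbd.add hg.pbd,
      fun a l hl => ?_⟩
    rw [List.foldr_cons_eq_append, List.map_id', ms_append]
    exact Nat.add_le_add_right (ms_le_of_sublist hl.sublist) _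
  exact key.of_eq fun a => by simp

@[fun_prop]
theorem Poly.flatten {f : α → List (List β)} (hf : Poly f) : Poly (fun a => (f a).flatten) := by
  have hl : ∀ l : List (List β), ms l.flatten ≤ ms l := by
    intro l
    induction l with
    | nil => exact le_rfl
    | cons a l ih => rw [ms_cons, List.flatten_cons, ms_append]; omega
  have key : Poly (fun a => (f a).foldr (fun b l => b ++ l) []) := by
    refine hf.foldr (h := fun _ b l => b ++ l) (.const []) (by fun_prop) ⟨_, hf.pbd,
      fun a l h => ?_⟩
    rw [show l.foldr (fun b l => b ++ l) [] = l.flatten by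
      clear h; induction l <;> simp_all]
    exact (hl l).trans (ms_le_of_sublist h.sublist)
  exact key.of_eq fun a => by induction f a <;> simp_all

@[fun_prop]
theorem Poly.flatMap {f : α → List β} {h : α → β → List γ} (hf : Poly f)
    (hh : Poly (fun x : α × β => h x.1 x.2)) : Poly (fun a => (f a).flatMap (h a)) :=
  (hf.map hh).flatten.of_eq fun a => by rw [List.flatMap_def]

@[fun_prop]
theorem Poly.not {p : α → Bool} (hp : Poly p) : Poly (fun a => !(p a)) :=
  (hp.bif (.const false) (.const true)).of_eq fun a => by cases p a <;> rfl

@[fun_prop]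
theorem Poly.and {p r : α → Bool} (hp : Poly p) (hr : Poly r) : Poly (fun a => p a && r a) :=
  (hp.bif hr (.const false)).of_eq fun a => by cases p a <;> rfl

@[fun_prop]
theorem Poly.or {p r : α → Bool} (hp : Poly p) (hr : Poly r) : Poly (fun a => p a || r a) :=
  (hp.bif (.const true) hr).of_eq fun a => by cases p a <;> rfl

@[fun_prop]
theorem Poly.any {f : α → List β} {p : α → β → Bool} (hf : Poly f)
    (hp : Poly (fun x : α × β => p x.1 x.2)) : Poly (fun a => (f a).any (p a)) :=
  (hf.filter hp).isEmpty.not.of_eq fun a => by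
    rw [Bool.eq_iff_iff]
    simp

@[fun_prop]
theorem Poly.all {f : α → List β} {p : α → β → Bool} (hf : Poly f)
    (hp : Poly (fun x : α × β => p x.1 x.2)) : Poly (fun a => (f a).all (p a)) :=
  (hf.any (p := fun a b => !(p a b)) hp.not).not.of_eq fun a => by
    rw [Bool.eq_iff_iff]
    simp

/-! Natural numbers -/

/-- Unary numbers and lists of units have the same encoding, so arithmetic becomes list processing.
-/
theorem enc_nat (n : ℕ) : enc n = enc (List.replicate n ()) := by
  simp [enc, Val.ofNat]

theorem ms_nat (n : ℕ) : ms n = n := rfl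

theorem ms_replicate (n : ℕ) : ms (List.replicate n ()) = n := by simp [ms]

theorem Poly.nat_of_replicate {f : α → ℕ} (h : Poly (fun a => List.replicate (f a) ())) :
    Poly f :=
  h.of_enc_eq (fun a => enc_nat _) (h.pbd.mono fun a => by rw [ms_replicate, ms_nat])

@[fun_prop]
theorem Poly.replicate_unit {f : α → ℕ} (h : Poly f) :
    Poly (fun a => List.replicate (f a) ()) :=
  h.of_enc_eq (fun a => (enc_nat _).symm) (h.pbd.mono fun a => by rw [ms_replicate, ms_nat])

@[fun_prop]
theorem Poly.length {f : α → List β} (hf : Poly f) : Poly (fun a => (f a).length) :=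
  nat_of_replicate ((hf.map (h := fun _ _ => ()) (.const ())).of_eq fun a => by simp)

@[fun_prop]
theorem Poly.add {f g : α → ℕ} (hf : Poly f) (hg : Poly g) : Poly (fun a => f a + g a) :=
  nat_of_replicate ((hf.replicate_unit.append hg.replicate_unit).of_eq fun a => by simp)

instance (n : ℕ) : Constructible n := by
  induction n with
  | zero => exact ⟨.nat_of_replicate (.const [])⟩
  | succ n ih => exact ⟨.nat_of_replicate (.cons (.const ()) ih.poly.replicate_unit)⟩

/-- Iterating a function. -/
theorem Poly.iterate {f : α → ℕ} {g : α → σ} {h : α → σ → σ} (hf : Poly f) (hg : Poly g)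
    (hh : Poly (fun x : α × σ => h x.1 x.2))
    (hb : ∃ B : α → ℕ, PBd B ∧ ∀ a, ∀ j ≤ f a, ms ((h a)^[j] (g a)) ≤ B a) :
    Poly (fun a => (h a)^[f a] (g a)) := by
  have hfold : ∀ a (l : List Unit), l.foldr (fun _ s => h a s) (g a) = (h a)^[l.length] (g a) := by
    intro a l
    induction l with
    | nil => rfl
    | cons b l ih => rw [List.foldr_cons, ih, List.length_cons, Function.iterate_succ_apply']
  have key : Poly (fun a => (List.replicate (f a) ()).foldr (fun _ s => h a s) (g a)) := by
    refine hf.replicate_unit.foldr (h := fun a _ s => h a s) hg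
      (hh.comp (f := fun x : α × Unit × σ => (x.1, x.2.2)) (by fun_prop)) ?_
    obtain ⟨B, hB, hb⟩ := hb
    refine ⟨B, hB, fun a l hl => ?_⟩
    rw [hfold]
    exact hb a _ (by simpa using hl.length_le)
  exact key.of_eq fun a => by rw [hfold]; simp

@[fun_prop]
theorem Poly.drop {f : α → List β} {n : α → ℕ} (hf : Poly f) (hn : Poly n) :
    Poly (fun a => (f a).drop (n a)) := by
  have ht : ∀ (l : List β) j, List.tail^[j] l = l.drop j := by
    intro l j
    induction j with
    | zero => rfl
    | succ j ih => rw [Function.iterate_succ_apply', ih, List.tail_drop]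
  have key : Poly (fun a => (fun l : List β => l.tail)^[n a] (f a)) := by
    refine hn.iterate (h := fun _ l => l.tail) hf (by fun_prop) ⟨_, hf.pbd, fun a j _ => ?_⟩
    change ms (List.tail^[j] (f a)) ≤ _
    rw [ht]
    exact ms_le_of_sublist (List.drop_sublist _ _)
  exact key.of_eq fun a => (ht _ _).symm

@[fun_prop]
theorem Poly.sub {f g : α → ℕ} (hf : Poly f) (hg : Poly g) : Poly (fun a => f a - g a) :=
  nat_of_replicate ((hf.replicate_unit.drop hg).of_eq fun a => by simp)

@[fun_prop]
theorem Poly.leb {f g : α → ℕ} (hf : Poly f) (hg : Poly g) :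
    Poly (fun a => decide (f a ≤ g a)) :=
  (hf.sub hg).replicate_unit.isEmpty.of_eq fun a => by
    rw [Bool.eq_iff_iff]
    simp [Nat.sub_eq_zero_iff_le]

@[fun_prop]
theorem Poly.ltb {f g : α → ℕ} (hf : Poly f) (hg : Poly g) :
    Poly (fun a => decide (f a < g a)) :=
  (hg.leb hf).not.of_eq fun a => by rw [Bool.eq_iff_iff]; simp

@[fun_prop]
theorem Poly.eqb {f g : α → ℕ} (hf : Poly f) (hg : Poly g) :
    Poly (fun a => decide (f a = g a)) :=
  ((hf.leb hg).and (hg.leb hf)).of_eq fun a => by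
    rw [Bool.eq_iff_iff]
    simp [le_antisymm_iff]

@[fun_prop]
theorem Poly.take_one {f : α → List β} (hf : Poly f) : Poly (fun a => (f a).take 1) := by
  have : Poly (fun l : List β => l.take 1) := by
    refine .of_expr (.caseOf (.var 0) .nil (.pair (.var 0) .nil)) 5
      (PBd.ms.mono fun l => ms_le_of_sublist (List.take_sublist _ _)) fun l => ?_
    cases l with
    | nil => exact (EvalLe.caseNil (.var rfl) .nil).mono (by norm_num)
    | cons a l => exact .casePair (.var rfl) (.pair (.var rfl) .nil)
  exact this.comp hf

@[fun_prop]
theorem Poly.getD {f : α → List β} {n : α → ℕ} {d : α → β} (hf : Poly f) (hn : Poly n)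
    (hd : Poly d) : Poly (fun a => (f a).getD (n a) (d a)) :=
  ((hf.drop hn).headD hd).of_eq fun a => by
    rw [List.headD_eq_head?_getD, List.head?_drop, List.getD_eq_getElem?_getD]

@[fun_prop]
theorem Poly.range {f : α → ℕ} (hf : Poly f) : Poly (fun a => List.range (f a)) := by
  have hr : ∀ n, ms (List.range n) ≤ n * (n + 1) := fun n => by
    simpa using ms_le_length_mul (l := List.range n) (b := n)
      fun a ha => by rw [ms_nat]; exact (List.mem_range.1 ha).le
  have ht : ∀ j, (fun l : List ℕ => l ++ [l.length])^[j] [] = List.range j := by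
    intro j
    induction j with
    | zero => rfl
    | succ j ih => rw [Function.iterate_succ_apply', ih, List.range_succ, List.length_range]
  have key : Poly (fun a => (fun l : List ℕ => l ++ [l.length])^[f a] []) := by
    refine hf.iterate (h := fun _ l => l ++ [l.length]) (.const []) (by fun_prop)
      ⟨_, hf.pbd.mul (hf.pbd.add (.const 1)), fun a j hj => ?_⟩
    rw [ht]
    exact (hr j).trans (by rw [ms_nat]; gcongr)
  exact key.of_eq fun a => (ht _).symm

end
end Holant

/-! ### Branching recursion in polynomial time -/

namespace Holant
open Enc (enc ms)

section
variable {α β γ σ : Type} [Enc α] [Enc β] [Enc γ] [Enc σ]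

/-- Branching recursion: the value at `a` is combined from the values at the elements of `pre a`. -/
theorem Poly.recurse {pre : α → List α} {comb : α × List β → β} {R : α → β} {μ : α → ℕ}
    (hpre : Poly pre) (hcomb : Poly comb) (hR : ∀ a, R a = comb (a, (pre a).map R))
    (hμ : ∀ a, ((pre a).map μ).sum + 1 ≤ μ a) (hμb : PBd μ) (hms : ∀ a, ∀ b ∈ pre a, ms b ≤ ms a)
    (hRb : PBd (fun a => ms (R a))) : Poly R := by
  obtain ⟨P, T, ⟨l, hl⟩, ⟨j, hT⟩, hP⟩ := hpre
  obtain ⟨Q, U, _, ⟨k, hU⟩, hQ⟩ := hcomb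
  have hRb' := hRb
  obtain ⟨i, hi⟩ := hRb'
  -- `A x` bounds the measure of the list of recursive results, and `W x` the work of one call apart
  -- from its recursive calls, for arguments of measure at most `x`. As `μ` bounds the number of
  -- calls, the total is at most `μ a * W x`.
  let A : ℕ → ℕ := fun x => (x + 2) ^ l * ((x + 2) ^ i + 1)
  let W : ℕ → ℕ := fun x => (x + 2) ^ j + (x + A x + 2) ^ k + 10 * (x + 2) ^ l + 20
  have hWb : PBd (fun a : α => W (ms a)) := by
    have h2 : PBd (fun a : α => ms a + 2) := PBd.ms.add (.const 2)
    have hA : PBd (fun a : α => A (ms a)) := (h2.pow l).mul ((h2.pow i).add (.const 1))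
    exact (((h2.pow j).add (((PBd.ms.add hA).add (.const 2)).pow k)).add
      ((PBd.const 10).mul (h2.pow l))).add (.const 20)
  -- `main` and `mapR` are mutually recursive: `mapR` calls `main` on each element of the list of
  -- predecessors.
  let main : Expr := .call (2 + P.length) (.pair (.var 0) (.call 1 (.call 2 (.var 0))))
  let mapR : Expr := .caseOf (.var 0) .nil (.pair (.call 0 (.var 0)) (.call 1 (.var 1)))
  -- `x` stays the same during the induction; a predecessor has no larger measure, so the same `W x`
  -- serves the whole recursion tree.
  have key : ∀ N x a, μ a ≤ N → ms a ≤ x →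
      EvalLe (link [main, mapR] P Q) [enc a] main (enc (R a)) (μ a * W x) := by
    intro N
    induction N with
    | zero => intro x a hN _; have := hμ a; omega
    | succ N ih =>
      intro x a hN hx
      have hmap : ∀ bs : List α, (∀ b ∈ bs, b ∈ pre a) →
          EvalLe (link [main, mapR] P Q) [enc bs] mapR (enc (bs.map R))
            ((bs.map μ).sum * W x + 10 * bs.length + 5) := by
        intro bs
        induction bs with
        | nil => intro _; exact (EvalLe.caseNil (.var rfl) .nil).mono (by omega)
        | cons b bs ihb =>
          intro hbs
          have hb : b ∈ pre a := hbs b List.mem_cons_self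
          have hle : μ b ≤ ((pre a).map μ).sum :=
            List.single_le_sum (by simp) _ (List.mem_map_of_mem hb)
          refine (EvalLe.casePair (.var rfl) (.pair
            (.call (.var rfl) rfl (ih x b (by have := hμ a; omega) ((hms a b hb).trans hx)))
            (.call (.var rfl) rfl (ihb fun c hc => hbs c (List.mem_cons_of_mem _ hc))))).mono ?_
          rw [List.map_cons, List.sum_cons, List.length_cons, add_mul]
          omega
      rw [hR]
      refine ((hQ (a, (pre a).map R)).link_right (.pair (.var rfl)
        (.call ((hP a).link_left (.var rfl)) rfl (hmap (pre a) fun _ h => h)))).mono ?_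
      have hlen : (pre a).length ≤ (x + 2) ^ l :=
        (length_le_ms _).trans ((hl a).trans (Nat.pow_le_pow_left (by omega) l))
      have h₁ : T a ≤ (x + 2) ^ j := (hT a).trans (Nat.pow_le_pow_left (by omega) j)
      have h₂ : U (a, (pre a).map R) ≤ (x + A x + 2) ^ k := by
        refine (hU _).trans (Nat.pow_le_pow_left ?_ k)
        rw [ms_prod]
        have : ms ((pre a).map R) ≤ A x := (ms_map_le (b := (x + 2) ^ i) fun b hb =>
          (hi b).trans (Nat.pow_le_pow_left (by have := hms a b hb; omega) i)).trans
            (Nat.mul_le_mul_right _ hlen)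
        omega
      have h₃ := Nat.mul_le_mul_right (W x) (hμ a)
      rw [add_mul] at h₃
      simp only [W] at h₃ ⊢
      omega
  refine ⟨link [main, mapR] P Q, fun a => μ a * W (ms a) + 2, hRb,
    (hμb.mul hWb).add (.const 2), fun a => ?_⟩
  refine (EvalLe.call (EvalLe.var rfl) rfl (key _ _ a le_rfl le_rfl)).mono ?_
  beta_reduce
  omega

/-! ### Vectors of natural numbers -/

/-- The list `l` belongs to the program text and not to the input: the program is unrolled over it.
Loops over `[q]` are treated in this way. -/
theorem Poly.all_const {ι : Type} (l : List ι) {p : ι → α → Bool} (h : ∀ i, Poly (p i)) :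
    Poly (fun a => l.all fun i => p i a) := by
  induction l with
  | nil => exact .const true
  | cons i l ih => exact ((h i).and ih).of_eq fun a => by simp

theorem Poly.map_const {ι : Type} (l : List ι) {g : ι → α → β} (h : ∀ i, Poly (g i)) :
    Poly (fun a => l.map fun i => g i a) := by
  induction l with
  | nil => exact .const []
  | cons i l ih => exact ((h i).cons ih).of_eq fun a => by simp

abbrev Vec (q : ℕ) := Fin q → ℕ

variable {q : ℕ}

theorem ms_vec (c : Vec q) : ms c = ms (List.ofFn c) := rfl

theorem Poly.coord {f : α → Vec q} (hf : Poly f) (i : Fin q) : Poly (fun a => f a i) := by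
  have : Poly (fun a => List.ofFn (f a)) := hf.of_enc_eq (fun _ => rfl) hf.pbd
  exact (this.getD (.const i.1) (.const 0)).of_eq fun a => by simp

theorem Poly.vec {f : α → Vec q} (h : ∀ i, Poly (fun a => f a i)) : Poly f := by
  have : Poly (fun a => (List.finRange q).map fun i => f a i) := Poly.map_const _ h
  have h' : Poly (fun a => List.ofFn (f a)) := this.of_eq fun a => by rw [List.ofFn_eq_map]
  exact h'.of_enc_eq (fun _ => rfl) h'.pbd

def vadd (x y : Vec q) : Vec q := fun i => x i + y i
def vsub (x y : Vec q) : Vec q := fun i => x i - y i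
def vle (x y : Vec q) : Bool := (List.finRange q).all fun i => decide (x i ≤ y i)
def veq (x y : Vec q) : Bool := (List.finRange q).all fun i => decide (x i = y i)
def vzero : Vec q := fun _ => 0
def vsingle (i : Fin q) : Vec q := fun j => if j = i then 1 else 0

theorem vle_iff {x y : Vec q} : vle x y = true ↔ x ≤ y := by simp [vle, Pi.le_def]
theorem veq_iff {x y : Vec q} : veq x y = true ↔ x = y := by simp [veq, funext_iff]

@[fun_prop]
theorem Poly.vadd {f g : α → Vec q} (hf : Poly f) (hg : Poly g) :
    Poly (fun a => vadd (f a) (g a)) := .vec fun i => (hf.coord i).add (hg.coord i)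

@[fun_prop]
theorem Poly.vsub {f g : α → Vec q} (hf : Poly f) (hg : Poly g) :
    Poly (fun a => vsub (f a) (g a)) := .vec fun i => (hf.coord i).sub (hg.coord i)

@[fun_prop]
theorem Poly.vle {f g : α → Vec q} (hf : Poly f) (hg : Poly g) :
    Poly (fun a => vle (f a) (g a)) := .all_const _ fun i => (hf.coord i).leb (hg.coord i)

@[fun_prop]
theorem Poly.veq {f g : α → Vec q} (hf : Poly f) (hg : Poly g) :
    Poly (fun a => veq (f a) (g a)) := .all_const _ fun i => (hf.coord i).eqb (hg.coord i)

instance (c : Vec q) : Constructible c := ⟨.vec fun i => .const (c i)⟩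

end
end Holant

namespace Holant
open Enc (enc ms)

abbrev Edge := ℕ × ℕ

/-! ### Bipartite matching -/

def mem (l : List ℕ) (v : ℕ) : Bool := l.any fun w => decide (w = v)

@[simp]
theorem mem_iff {l : List ℕ} {v : ℕ} : mem l v = true ↔ v ∈ l := by simp [mem]

/-- One-step extensions of the alternating paths in `Q`, which are recorded as their last vertex
together with the list of the edges to be added to the matching `m`. -/
def growCands (H m : List Edge) (Q : List (ℕ × List Edge)) : List (ℕ × List Edge) :=
  Q.flatMap fun x => (H.filter fun y => decide (y.1 = x.1)).flatMap fun y =>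
    (m.filter fun z => decide (z.2 = y.2) && !(Q.any fun w => decide (w.1 = z.1))).map
      fun z => (z.1, y :: x.2)

/-- Only one candidate is added at a time, so that no end vertex is recorded twice. -/
def grow (H m : List Edge) (Q : List (ℕ × List Edge)) : List (ℕ × List Edge) :=
  (growCands H m Q).take 1 ++ Q

def startPaths (L : List ℕ) (m : List Edge) : List (ℕ × List Edge) :=
  (L.filter fun l => m.all fun z => !decide (z.1 = l)).map fun l => (l, [])

/-- The vertices on the left that are reached by alternating paths, with such a path. -/
def reach (H : List Edge) (L : List ℕ) (m : List Edge) : List (ℕ × List Edge) :=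
  (grow H m)^[L.length + 1] (startPaths L m)

/-- The augmenting paths found. -/
def augs (H : List Edge) (L : List ℕ) (m : List Edge) : List (List Edge) :=
  (reach H L m).flatMap fun x =>
    (H.filter fun y => decide (y.1 = x.1) && m.all fun z => !decide (z.2 = y.2)).map
      fun y => y :: x.2

/-- A path lists its latest edge first, so `foldr` inserts the edges in the order of the path, each
displacing the matching edge at its right end. -/
def flipPath (m p : List Edge) : List Edge :=
  p.foldr (fun y m => y :: m.filter fun z => !decide (z.2 = y.2)) m

def augment (H : List Edge) (L : List ℕ) (m : List Edge) : List Edge :=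
  flipPath m ((augs H L m).headD [])

/-- Every successful augmentation lengthens the matching, whose length is at most that of `L`; after
`L.length + 1` rounds it is stationary. -/
def maxMatching (H : List Edge) (L : List ℕ) : List Edge := (augment H L)^[L.length + 1] []

def reached (H : List Edge) (L : List ℕ) : List ℕ := (reach H L (maxMatching H L)).map fun x => x.1

/-! ### Splitting an edge set -/

def adjacent (F : List Edge) (u v : ℕ) : Bool :=
  decide (u = v) || F.any fun e =>
    (decide (e.1 = u) && decide (e.2 = v)) || (decide (e.1 = v) && decide (e.2 = u))

def leftPart (n : ℕ) (B : List ℕ) : List ℕ := (List.range n).filter fun v => !mem B v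

/-- Separations become vertex covers. Sets `P ⊇ A` and `Q ⊇ B` form a separation exactly if no `u ∉
Q` is equal or adjacent to a `v ∉ P`; equality expresses that `P` and `Q` cover all vertices. With
the vertices outside `B` on the left and those outside `A` on the right, this says that the left
vertices in `Q` and the right vertices in `P` form a cover. As `|P| + |Q| = n + |P ∩ Q|`, a minimum
cover gives a minimum separator. -/
def bipartite (n : ℕ) (F : List Edge) (A B : List ℕ) : List Edge :=
  (leftPart n B).flatMap fun u => ((leftPart n A).filter fun v => adjacent F u v).map fun v => (u, v)

/-- The right half of Kőnig's cover, the neighbours of the reached set `Z`, together with `A`. The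
left half, the complement of `Z`, is the other side of the separation. -/
def sideOf (n : ℕ) (A : List ℕ) (H : List Edge) (Z : List ℕ) : List ℕ :=
  (List.range n).filter fun v => mem A v || H.any fun y => decide (y.2 = v) && mem Z y.1

/-- The side of `A` in a minimum separation of `A` from `B`. -/
def side (n : ℕ) (F : List Edge) (A B : List ℕ) : List ℕ :=
  sideOf n A (bipartite n F A B) (reached (bipartite n F A B) (leftPart n B))

def inside (P : List ℕ) (F : List Edge) : List Edge := F.filter fun e => mem P e.1 && mem P e.2
def outside (P : List ℕ) (F : List Edge) : List Edge :=
  F.filter fun e => !(mem P e.1 && mem P e.2)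

/-- The degree of `v` in `F`. -/
def dg (F : List Edge) (v : ℕ) : ℕ := (F.filter fun e => decide (e.1 = v) || decide (e.2 = v)).length

/-- The vertices incident both to edges in `F` and to edges of `E` outside `F`. -/
def bdry (n : ℕ) (E F : List Edge) : List ℕ :=
  (List.range n).filter fun v => !decide (dg F v = 0) && decide (dg F v < dg E v)

def subs (l : List ℕ) : List (List ℕ) := l.foldr (fun a L => L ++ L.map fun s => a :: s) [[]]

def splitBy (P : List ℕ) (F : List Edge) : List Edge × List Edge := (inside P F, outside P F)

/-- Discarding splits with an empty part makes the recursion terminate. -/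
def splits (n : ℕ) (F : List Edge) (B : List ℕ) : List (List Edge × List Edge) :=
  ((subs B).map fun A => splitBy (side n F A (B.filter fun v => !mem A v)) F).filter
    fun x => !x.1.isEmpty && !x.2.isEmpty

/-- With truncated subtraction this is the maximum of the two lengths. -/
def width (n : ℕ) (E : List Edge) (x : List Edge × List Edge) : ℕ :=
  (bdry n E x.1).length + ((bdry n E x.2).length - (bdry n E x.1).length)

/-- A split of `F` into two parts with small boundaries. -/
def best (n : ℕ) (E F : List Edge) : List Edge × List Edge :=
  (splits n F (bdry n E F)).foldr
    (fun x b => bif decide (width n E x ≤ width n E b) then x else b) (F.take 1, F.drop 1)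

/-! ### Dynamic programming -/

abbrev Tab (q : ℕ) := List (Vec q × ℂ)
abbrev Inp (q : ℕ) := List (List ℕ × Tab q)
abbrev State (q : ℕ) := List (Vec q)
abbrev Table (q : ℕ) := List (State q × ℂ)

variable {q : ℕ}

noncomputable def look (t : Tab q) (c : Vec q) : List ℂ := (t.filter fun e => veq e.1 c).map fun e => e.2

def tabAt (I : Inp q) (v : ℕ) : Tab q := (I.getD v ([], [])).2

/-- Each entry of the table above `c` is compared with the entry in which `c` has been exchanged for
`c'`. For `c` and `c'` of equal size this decides whether pinning either of them leaves the same
function. -/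
noncomputable def eqvV (t : Tab q) (c c' : Vec q) : Bool :=
  t.all fun e => !(vle c e.1) || ceq ((look t (vadd (vsub e.1 c) c')).headD 0) e.2

noncomputable def eqv (I : Inp q) (s s' : State q) : Bool :=
  (List.range I.length).all fun v => eqvV (tabAt I v) (s.getD v vzero) (s'.getD v vzero)

/-- Add an entry to a table, merging it with an equivalent one. -/
noncomputable def ins (I : Inp q) (x : State q × ℂ) : Table q → Table q
  | [] => [x]
  | y :: T => bif eqv I x.1 y.1 then (y.1, y.2 + x.2) :: T else y :: ins I x T

noncomputable def collapse (I : Inp q) (T : Table q) : Table q := T.foldr (fun x T => ins I x T) []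

/-- All edges at `v` have been processed. -/
noncomputable def finished (I : Inp q) (s : State q) (v : ℕ) : Bool :=
  !veq (s.getD v vzero) vzero && !(look (tabAt I v) (s.getD v vzero)).isEmpty

noncomputable def reduceState (I : Inp q) (s : State q) : State q :=
  (List.range I.length).map fun v => bif finished I s v then vzero else s.getD v vzero

noncomputable def factors (I : Inp q) (s : State q) : List ℂ :=
  (List.range I.length).map fun v =>
    bif finished I s v then (look (tabAt I v) (s.getD v vzero)).headD 0 else 1

noncomputable def reduce (I : Inp q) (x : State q × ℂ) : State q × ℂ :=
  (reduceState I x.1, x.2 * (factors I x.1).prod)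

def addState (I : Inp q) (s s' : State q) : State q :=
  (List.range I.length).map fun v => vadd (s.getD v vzero) (s'.getD v vzero)

noncomputable def mergeTables (I : Inp q) (T T' : Table q) : Table q :=
  collapse I (T.flatMap fun x => T'.map fun y => reduce I (addState I x.1 y.1, x.2 * y.2))

def edgeState (I : Inp q) (e : Edge) (i : Fin q) : State q :=
  (List.range I.length).map fun v =>
    bif decide (e.1 = v) || decide (e.2 = v) then vsingle i else vzero

def zeroState (I : Inp q) : State q := (List.range I.length).map fun _ => vzero

noncomputable def leafTable (I : Inp q) (F : List Edge) : Table q :=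
  bif F.isEmpty then [(zeroState I, 1)]
  else collapse I ((List.finRange q).map fun i => reduce I (edgeState I (F.headD (0, 0)) i, 1))

def edges (I : Inp q) : List Edge :=
  (List.range I.length).flatMap fun u =>
    ((I.getD u ([], [])).1.filter fun v => decide (u < v)).map fun v => (u, v)

theorem splits_lt {n : ℕ} {F : List Edge} {B : List ℕ} {x : List Edge × List Edge}
    (h : x ∈ splits n F B) : (x.1 ++ x.2).Perm F ∧ x.1 ≠ [] ∧ x.2 ≠ [] := by
  simp only [splits, splitBy, List.mem_filter, List.mem_map, Bool.and_eq_true, Bool.not_eq_true',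
    List.isEmpty_eq_false_iff] at h
  obtain ⟨⟨A, -, rfl⟩, h₁, h₂⟩ := h
  exact ⟨List.filter_append_perm _ F, h₁, h₂⟩

theorem best_mem (n : ℕ) (E F : List Edge) :
    best n E F = (F.take 1, F.drop 1) ∨ best n E F ∈ splits n F (bdry n E F) := by
  unfold best
  induction splits n F (bdry n E F) with
  | nil => exact .inl rfl
  | cons x l ih =>
    simp only [List.foldr_cons]
    cases decide (width n E x ≤ _)
    · simp only [cond_false]
      exact ih.imp_right (List.mem_cons_of_mem _)
    · exact .inr (by simp)

theorem best_spec {n : ℕ} {E F : List Edge} (hF : 2 ≤ F.length) :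
    ((best n E F).1 ++ (best n E F).2).Perm F ∧ (best n E F).1 ≠ [] ∧ (best n E F).2 ≠ [] := by
  rcases best_mem n E F with h | h
  · rw [h]
    simp only [List.take_append_drop, List.Perm.refl, true_and]
    constructor <;> rw [← List.length_pos_iff] <;> simp <;> omega
  · exact splits_lt h

theorem best_length {n : ℕ} {E F : List Edge} (hF : 2 ≤ F.length) :
    (best n E F).1.length + (best n E F).2.length = F.length ∧ 0 < (best n E F).1.length ∧
      0 < (best n E F).2.length := by
  obtain ⟨h₁, h₂, h₃⟩ := best_spec (n := n) (E := E) hF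
  exact ⟨by simpa using h₁.length_eq, List.length_pos_iff.2 h₂, List.length_pos_iff.2 h₃⟩

/-- The table of the edge set `F`. -/
noncomputable def solve (I : Inp q) (E F : List Edge) : Table q :=
  if F.length ≤ 1 then leafTable I F
  else mergeTables I (solve I E (best I.length E F).1) (solve I E (best I.length E F).2)
termination_by F.length
decreasing_by all_goals (have := best_length (n := I.length) (E := E) (F := F) (by omega); omega)

/-- The second product supplies the isolated vertices, which no edge ever finishes. The table of any
other vertex has no entry at the zero vector, whence the default `1`. -/
noncomputable def result (I : Inp q) : ℂ :=
  ((solve I (edges I) (edges I)).map fun x => x.2).sum *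
    ((List.range I.length).map fun v => (look (tabAt I v) vzero).headD 1).prod

end Holant

/-! ### Running time of matching, separation and splitting -/

namespace Holant
open Enc (enc ms)

section
variable {α β γ σ : Type} [Enc α] [Enc β] [Enc γ] [Enc σ]

@[fun_prop]
theorem Poly.mem {l : α → List ℕ} {v : α → ℕ} (hl : Poly l) (hv : Poly v) :
    Poly (fun a => mem (l a) (v a)) := by
  unfold Holant.mem; fun_prop

theorem growCands_entry {H m : List Edge} {Q : List (ℕ × List Edge)} {c : ℕ × List Edge}
    (hc : c ∈ growCands H m Q) : ∃ x ∈ Q, ∃ y ∈ H, ∃ z ∈ m, y.1 = x.1 ∧ z.2 = y.2 ∧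
      (∀ w ∈ Q, w.1 ≠ z.1) ∧ c = (z.1, y :: x.2) := by
  simp only [growCands, List.mem_flatMap, List.mem_filter, List.mem_map, Bool.and_eq_true,
    decide_eq_true_eq, Bool.not_eq_true', List.any_eq_false] at hc
  obtain ⟨x, hx, y, ⟨hy, hyx⟩, z, ⟨hz, hzy, hzw⟩, rfl⟩ := hc
  exact ⟨x, hx, y, hy, z, hz, hyx, hzy, hzw, rfl⟩

theorem grow_ms {H m : List Edge} {Q : List (ℕ × List Edge)} {b : ℕ}
    (hQ : ∀ x ∈ Q, ms x.2 ≤ b) : (∀ x ∈ grow H m Q, ms x.2 ≤ b + ms H + 1) ∧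
      ms (grow H m Q) ≤ ms Q + (ms m + b + ms H + 2) := by
  have key : ∀ c ∈ growCands H m Q, ms c.2 ≤ b + ms H + 1 ∧ ms c ≤ ms m + b + ms H + 1 := by
    intro c hc
    obtain ⟨x, hx, y, hy, z, hz, -, -, -, rfl⟩ := growCands_entry hc
    have h₁ := hQ x hx
    have h₂ := ms_le_of_mem hy
    have h₃ := ms_le_of_mem hz
    have h₄ : ms z = ms z.1 + ms z.2 := rfl
    rw [ms_prod, ms_cons]
    omega
  unfold grow
  cases h : growCands H m Q with
  | nil =>
    simp only [List.take_nil, List.nil_append]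
    exact ⟨fun x hx => (hQ x hx).trans (by omega), by omega⟩
  | cons c l =>
    rw [h] at key
    have := key c List.mem_cons_self
    simp only [List.take_succ_cons, List.take_zero, List.cons_append, List.nil_append, ms_cons,
      List.mem_cons, forall_eq_or_imp]
    exact ⟨⟨this.1, fun x hx => (hQ x hx).trans (by omega)⟩, by omega⟩

theorem startPaths_ms (L : List ℕ) (m : List Edge) :
    (∀ x ∈ startPaths L m, ms x.2 ≤ 0) ∧ ms (startPaths L m) ≤ ms L := by
  constructor
  · simp only [startPaths, List.mem_map]
    rintro _ ⟨l, -, rfl⟩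
    exact le_rfl
  · refine le_trans (le_of_eq ?_) (ms_le_of_sublist (List.filter_sublist (p := fun l => m.all fun z => !decide (z.1 = l))))
    simp only [startPaths, ms, List.map_map]
    rfl

/-- A round adds at most one path, which is an old path with one more edge, so the sizes stay
polynomial in the number of rounds. -/
theorem grow_iterate_ms (H : List Edge) (L : List ℕ) (m : List Edge) (j : ℕ) :
    (∀ x ∈ (grow H m)^[j] (startPaths L m), ms x.2 ≤ j * (ms H + 1)) ∧
      ms ((grow H m)^[j] (startPaths L m)) ≤ ms L + j * (ms m + (j * (ms H + 1)) + ms H + 2) := by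
  induction j with
  | zero => simpa using startPaths_ms L m
  | succ j ih =>
    rw [Function.iterate_succ_apply']
    obtain ⟨h₁, h₂⟩ := grow_ms (H := H) (m := m) ih.1
    refine ⟨fun x hx => (h₁ x hx).trans (by ring_nf; omega), h₂.trans ?_⟩
    nlinarith [ih.2, Nat.zero_le (j * (ms H + 1)), Nat.zero_le (ms H), Nat.zero_le j]

@[fun_prop]
theorem Poly.startPaths {L : α → List ℕ} {m : α → List Edge} (hL : Poly L) (hm : Poly m) :
    Poly (fun a => startPaths (L a) (m a)) := by
  unfold Holant.startPaths; fun_prop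

@[fun_prop]
theorem Poly.grow {H m : α → List Edge} {Q : α → List (ℕ × List Edge)} (hH : Poly H) (hm : Poly m)
    (hQ : Poly Q) : Poly (fun a => grow (H a) (m a) (Q a)) := by
  unfold Holant.grow growCands; fun_prop

@[fun_prop]
theorem Poly.reach {H : α → List Edge} {L : α → List ℕ} {m : α → List Edge} (hH : Poly H)
    (hL : Poly L) (hm : Poly m) : Poly (fun a => reach (H a) (L a) (m a)) := by
  unfold Holant.reach
  have hc : PBd (fun a => (L a).length + 1) :=
    (hL.pbd.add (.const 1)).mono fun a => Nat.add_le_add_right (length_le_ms _) 1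
  refine Poly.iterate (h := fun a Q => Holant.grow (H a) (m a) Q) (by fun_prop) (by fun_prop)
    (by fun_prop) ⟨fun a => ms (L a) + ((L a).length + 1) * (ms (m a) +
      (((L a).length + 1) * (ms (H a) + 1)) + ms (H a) + 2), ?_, fun a j hj => ?_⟩
  · exact hL.pbd.add (hc.mul (((hm.pbd.add (hc.mul (hH.pbd.add (.const 1)))).add hH.pbd).add
      (.const 2)))
  · refine (grow_iterate_ms (H a) (L a) (m a) j).2.trans ?_
    beta_reduce
    gcongr

@[fun_prop]
theorem Poly.augs {H : α → List Edge} {L : α → List ℕ} {m : α → List Edge} (hH : Poly H)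
    (hL : Poly L) (hm : Poly m) : Poly (fun a => augs (H a) (L a) (m a)) := by
  unfold Holant.augs; fun_prop

theorem flipPath_ms (m p : List Edge) : ms (flipPath m p) ≤ ms m + ms p := by
  induction p with
  | nil => exact le_rfl
  | cons y p ih =>
    rw [flipPath, List.foldr_cons, ← flipPath, ms_cons, ms_cons]
    have := ms_le_of_sublist
      (List.filter_sublist (p := fun z => !decide (z.2 = y.2)) (l := flipPath m p))
    omega

@[fun_prop]
theorem Poly.flipPath {m p : α → List Edge} (hm : Poly m) (hp : Poly p) :
    Poly (fun a => flipPath (m a) (p a)) := by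
  unfold Holant.flipPath
  refine hp.foldr (h := fun _ y m => y :: m.filter fun z => !decide (z.2 = y.2)) hm
    (by fun_prop) ⟨_, hm.pbd.add hp.pbd, fun a l hl => ?_⟩
  exact (flipPath_ms (m a) l).trans (Nat.add_le_add_left (ms_le_of_sublist hl.sublist) _)

@[fun_prop]
theorem Poly.augment {H : α → List Edge} {L : α → List ℕ} {m : α → List Edge} (hH : Poly H)
    (hL : Poly L) (hm : Poly m) : Poly (fun a => augment (H a) (L a) (m a)) := by
  unfold Holant.augment; fun_prop

theorem augment_ms (H : List Edge) (L : List ℕ) (m : List Edge) :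
    ms (augment H L m) ≤ ms m + ((L.length + 1) * (ms H + 1) + ms H + 1) := by
  refine (flipPath_ms _ _).trans (Nat.add_le_add_left ?_ _)
  cases h : augs H L m with
  | nil => simp [ms_nil]
  | cons p l =>
    have hp : p ∈ augs H L m := by rw [h]; exact List.mem_cons_self
    simp only [augs, List.mem_flatMap, List.mem_map, List.mem_filter] at hp
    obtain ⟨x, hx, y, ⟨hy, -⟩, rfl⟩ := hp
    rw [List.headD_cons, ms_cons]
    have h₁ := (grow_iterate_ms H L m (L.length + 1)).1 x hx
    have h₂ := ms_le_of_mem hy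
    omega

@[fun_prop]
theorem Poly.maxMatching {H : α → List Edge} {L : α → List ℕ} (hH : Poly H)
    (hL : Poly L) : Poly (fun a => maxMatching (H a) (L a)) := by
  unfold Holant.maxMatching
  have hc : PBd (fun a => (L a).length + 1) :=
    (hL.pbd.add (.const 1)).mono fun a => Nat.add_le_add_right (length_le_ms _) 1
  refine Poly.iterate (h := fun a m => Holant.augment (H a) (L a) m) (by fun_prop) (by fun_prop)
    (by fun_prop) ⟨fun a => ((L a).length + 1) *
      (((L a).length + 1) * (ms (H a) + 1) + ms (H a) + 1), ?_, fun a j hj => ?_⟩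
  · exact hc.mul (((hc.mul (hH.pbd.add (.const 1))).add hH.pbd).add (.const 1))
  · have : ms ((fun m => Holant.augment (H a) (L a) m)^[j] []) ≤ j *
        (((L a).length + 1) * (ms (H a) + 1) + ms (H a) + 1) := by
      clear hj
      induction j with
      | zero => simp [ms_nil]
      | succ j ih =>
        rw [Function.iterate_succ_apply']
        refine (augment_ms _ _ _).trans ?_
        rw [Nat.succ_mul j]
        omega
    exact this.trans (Nat.mul_le_mul_right _ hj)

@[fun_prop]
theorem Poly.reached {H : α → List Edge} {L : α → List ℕ} (hH : Poly H)
    (hL : Poly L) : Poly (fun a => reached (H a) (L a)) := by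
  unfold Holant.reached; fun_prop

@[fun_prop]
theorem Poly.leftPart {n : α → ℕ} {B : α → List ℕ} (hn : Poly n) (hB : Poly B) :
    Poly (fun a => leftPart (n a) (B a)) := by
  unfold Holant.leftPart; fun_prop

@[fun_prop]
theorem Poly.adjacent {F : α → List Edge} {u v : α → ℕ} (hF : Poly F) (hu : Poly u) (hv : Poly v) :
    Poly (fun a => adjacent (F a) (u a) (v a)) := by
  unfold Holant.adjacent; fun_prop

@[fun_prop]
theorem Poly.bipartite {n : α → ℕ} {F : α → List Edge} {A B : α → List ℕ} (hn : Poly n)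
    (hF : Poly F) (hA : Poly A) (hB : Poly B) :
    Poly (fun a => bipartite (n a) (F a) (A a) (B a)) := by
  unfold Holant.bipartite; fun_prop

@[fun_prop]
theorem Poly.sideOf {n : α → ℕ} {A : α → List ℕ} {H : α → List Edge} {Z : α → List ℕ}
    (hn : Poly n) (hA : Poly A) (hH : Poly H) (hZ : Poly Z) :
    Poly (fun a => sideOf (n a) (A a) (H a) (Z a)) := by
  unfold Holant.sideOf; fun_prop

@[fun_prop]
theorem Poly.side {n : α → ℕ} {F : α → List Edge} {A B : α → List ℕ} (hn : Poly n)
    (hF : Poly F) (hA : Poly A) (hB : Poly B) :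
    Poly (fun a => side (n a) (F a) (A a) (B a)) := by
  unfold Holant.side; fun_prop

@[fun_prop]
theorem Poly.dg {F : α → List Edge} {v : α → ℕ} (hF : Poly F) (hv : Poly v) :
    Poly (fun a => dg (F a) (v a)) := by
  unfold Holant.dg; fun_prop

@[fun_prop]
theorem Poly.bdry {n : α → ℕ} {E F : α → List Edge} (hn : Poly n) (hE : Poly E) (hF : Poly F) :
    Poly (fun a => bdry (n a) (E a) (F a)) := by
  unfold Holant.bdry; fun_prop

@[fun_prop]
theorem Poly.splitBy {P : α → List ℕ} {F : α → List Edge} (hP : Poly P) (hF : Poly F) :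
    Poly (fun a => splitBy (P a) (F a)) := by
  unfold Holant.splitBy inside outside; fun_prop

@[fun_prop]
theorem Poly.width {n : α → ℕ} {E : α → List Edge} {x : α → List Edge × List Edge} (hn : Poly n)
    (hE : Poly E) (hx : Poly x) : Poly (fun a => width (n a) (E a) (x a)) := by
  unfold Holant.width; fun_prop

theorem subs_cons (v : ℕ) (l : List ℕ) : subs (v :: l) = subs l ++ (subs l).map fun s => v :: s := rfl

theorem length_subs (l : List ℕ) : (subs l).length = 2 ^ l.length := by
  induction l with
  | nil => rfl
  | cons a l ih => rw [subs_cons]; simp [ih, pow_succ]; omega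

theorem mem_subs {l s : List ℕ} : s ∈ subs l ↔ s.Sublist l := by
  induction l generalizing s with
  | nil => simp [subs]
  | cons a l ih =>
    rw [subs_cons, List.mem_append, List.mem_map, List.sublist_cons_iff, ih]
    simp only [ih]
    constructor
    · rintro (h | ⟨r, h, rfl⟩)
      · exact .inl h
      · exact .inr ⟨r, rfl, h⟩
    · rintro (h | ⟨r, rfl, h⟩)
      · exact .inl h
      · exact .inr ⟨r, h, rfl⟩

/-- Enumerating all subsets is polynomial only relative to a measure that dominates `2 ^ l.length`.
For boundaries this is ensured by `RegularInstance.bound`. -/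
theorem Poly.subs {l : α → List ℕ} (hl : Poly l) (hb : PBd (fun a => 2 ^ (l a).length)) :
    Poly (fun a => subs (l a)) := by
  unfold Holant.subs
  refine hl.foldr (h := fun _ v L => L ++ L.map fun s => v :: s) (.const [[]]) (by fun_prop)
    ⟨_, hb.mul (hl.pbd.add (.const 1)), fun a l' hl' => ?_⟩
  refine (ms_le_length_mul (b := ms (l a)) fun s hs => ?_).trans (Nat.mul_le_mul_right _ ?_)
  · exact (ms_le_of_sublist (mem_subs.1 hs)).trans (ms_le_of_sublist hl'.sublist)
  · refine (length_subs l').le.trans (Nat.pow_le_pow_right (by omega) hl'.length_le)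

theorem Poly.best {n : α → ℕ} {E F : α → List Edge} (hn : Poly n) (hE : Poly E) (hF : Poly F)
    (hb : PBd (fun a => 2 ^ (Holant.bdry (n a) (E a) (F a)).length)) :
    Poly (fun a => best (n a) (E a) (F a)) := by
  have hs := (hn.bdry hE hF).subs hb
  have hsp : Poly fun a => splits (n a) (F a) (Holant.bdry (n a) (E a) (F a)) := by
    unfold splits; fun_prop
  have hd : Poly fun a => (F a).drop 1 := by fun_prop
  have ht : Poly fun a => (F a).take 1 := by fun_prop
  unfold Holant.best
  refine hsp.foldr (h := fun a x b => bif decide (Holant.width (n a) (E a) x ≤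
    Holant.width (n a) (E a) b) then x else b) (ht.prodMk hd) (by fun_prop)
    ⟨_, hsp.pbd.add (ht.prodMk hd).pbd, fun a l hl => ?_⟩
  refine le_trans ?_ (Nat.add_le_add_right (ms_le_of_sublist hl.sublist) _)
  clear hl
  induction l with
  | nil => simp
  | cons x l ih =>
    rw [List.foldr_cons, ms_cons]
    cases decide (Holant.width (n a) (E a) x ≤ _) <;> simp only [cond_true, cond_false] <;> omega

end
end Holant

/-! ### Running time of the table operations -/

namespace Holant
open Enc (enc ms)

section
variable {α β γ σ : Type} [Enc α] [Enc β] [Enc γ] [Enc σ] {q : ℕ}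

@[fun_prop]
theorem Poly.csum {f : α → List ℂ} (hf : Poly f) : Poly (fun a => (f a).sum) :=
  hf.foldr (h := fun _ (b s : ℂ) => b + s) (.const 0) (by fun_prop)
    ⟨fun _ => 0, .const 0, fun _ _ _ => le_rfl⟩

@[fun_prop]
theorem Poly.cprod {f : α → List ℂ} (hf : Poly f) : Poly (fun a => (f a).prod) :=
  hf.foldr (h := fun _ (b s : ℂ) => b * s) (.const 1) (by fun_prop)
    ⟨fun _ => 0, .const 0, fun _ _ _ => le_rfl⟩

@[fun_prop]
theorem Poly.look {t : α → Tab q} {c : α → Vec q} (ht : Poly t) (hc : Poly c) :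
    Poly (fun a => look (t a) (c a)) := by
  unfold Holant.look; fun_prop

@[fun_prop]
theorem Poly.tabAt {I : α → Inp q} {v : α → ℕ} (hI : Poly I) (hv : Poly v) :
    Poly (fun a => tabAt (I a) (v a)) := by
  unfold Holant.tabAt; fun_prop

@[fun_prop]
theorem Poly.eqvV {t : α → Tab q} {c c' : α → Vec q} (ht : Poly t) (hc : Poly c) (hc' : Poly c') :
    Poly (fun a => eqvV (t a) (c a) (c' a)) := by
  unfold Holant.eqvV; fun_prop

@[fun_prop]
theorem Poly.eqv {I : α → Inp q} {s s' : α → State q} (hI : Poly I) (hs : Poly s) (hs' : Poly s') :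
    Poly (fun a => eqv (I a) (s a) (s' a)) := by
  unfold Holant.eqv; fun_prop

theorem ins_ms (I : Inp q) (x : State q × ℂ) (T : Table q) : ms (ins I x T) ≤ ms x + 1 + ms T := by
  induction T with
  | nil => rw [ins, ms_cons]
  | cons y T ih =>
    rw [ins]
    cases eqv I x.1 y.1
    · simp only [cond_false, ms_cons]; omega
    · simp only [cond_true, ms_cons]
      have : ms (y.1, y.2 + x.2) = ms y := rfl
      omega

@[fun_prop]
theorem Poly.ins {I : α → Inp q} {x : α → State q × ℂ} {T : α → Table q} (hI : Poly I)
    (hx : Poly x) (hT : Poly T) : Poly (fun a => ins (I a) (x a) (T a)) := by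
  -- The fold also rebuilds the list read so far, because after a hit `ins` needs the untouched tail
  -- and not the result for the tail.
  let h : α → State q × ℂ → Table q × Table q → Table q × Table q := fun a y r =>
    (y :: r.1, bif Holant.eqv (I a) (x a).1 y.1 then (y.1, y.2 + (x a).2) :: r.1 else y :: r.2)
  have hfold : ∀ a (l : Table q), l.foldr (h a) ([], [x a]) = (l, Holant.ins (I a) (x a) l) := by
    intro a l
    induction l with
    | nil => rfl
    | cons y l ih => rw [List.foldr_cons, ih]; rfl
  have key : Poly fun a => (T a).foldr (h a) ([], [x a]) := by
    refine hT.foldr (by fun_prop) (by fun_prop)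
      ⟨_, hT.pbd.add ((hx.pbd.add (.const 1)).add hT.pbd), fun a l hl => ?_⟩
    rw [hfold, ms_prod]
    have h₁ := ins_ms (I a) (x a) l
    have h₂ := ms_le_of_sublist hl.sublist
    omega
  exact key.snd.of_eq fun a => by rw [hfold]

@[fun_prop]
theorem Poly.collapse {I : α → Inp q} {T : α → Table q} (hI : Poly I) (hT : Poly T) :
    Poly (fun a => collapse (I a) (T a)) := by
  unfold Holant.collapse
  refine hT.foldr (h := fun a x T => Holant.ins (I a) x T) (.const []) (by fun_prop)
    ⟨_, hT.pbd, fun a l hl => ?_⟩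
  refine le_trans ?_ (ms_le_of_sublist hl.sublist)
  clear hl
  induction l with
  | nil => exact le_rfl
  | cons x l ih =>
    rw [List.foldr_cons, ms_cons]
    exact (ins_ms _ _ _).trans (by omega)

@[fun_prop]
theorem Poly.finished {I : α → Inp q} {s : α → State q} {v : α → ℕ} (hI : Poly I) (hs : Poly s)
    (hv : Poly v) : Poly (fun a => finished (I a) (s a) (v a)) := by
  unfold Holant.finished; fun_prop

@[fun_prop]
theorem Poly.reduce {I : α → Inp q} {x : α → State q × ℂ} (hI : Poly I) (hx : Poly x) :
    Poly (fun a => reduce (I a) (x a)) := by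
  unfold Holant.reduce reduceState factors; fun_prop

@[fun_prop]
theorem Poly.addState {I : α → Inp q} {s s' : α → State q} (hI : Poly I) (hs : Poly s)
    (hs' : Poly s') : Poly (fun a => addState (I a) (s a) (s' a)) := by
  unfold Holant.addState; fun_prop

@[fun_prop]
theorem Poly.mergeTables {I : α → Inp q} {T T' : α → Table q} (hI : Poly I) (hT : Poly T)
    (hT' : Poly T') : Poly (fun a => mergeTables (I a) (T a) (T' a)) := by
  unfold Holant.mergeTables; fun_prop

@[fun_prop]
theorem Poly.leafTable {I : α → Inp q} {F : α → List Edge} (hI : Poly I) (hF : Poly F) :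
    Poly (fun a => leafTable (I a) (F a)) := by
  unfold Holant.leafTable
  have h₁ : Poly fun a => [(zeroState (I a), (1 : ℂ))] := by
    unfold zeroState; fun_prop
  have h₂ : ∀ i, Poly fun a => Holant.reduce (I a) (edgeState (I a) ((F a).headD (0, 0)) i, 1) := by
    intro i
    unfold edgeState; fun_prop
  exact hF.isEmpty.bif h₁ (hI.collapse (Poly.map_const _ h₂))

@[fun_prop]
theorem Poly.edges {I : α → Inp q} (hI : Poly I) : Poly (fun a => edges (I a)) := by
  unfold Holant.edges; fun_prop

end
end Holant

namespace Holant
open Enc (enc ms)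

/-! ### Correctness of the matching algorithm -/

/-- As long as no fixed point is reached, each iteration raises `len` by at least one; `N + 1`
raises are impossible. -/
theorem iterate_fixed {τ : Type} {f : τ → τ} {len : τ → ℕ} {p : τ → Prop} {N : ℕ}
    (hp : ∀ x, p x → p (f x)) (hN : ∀ x, p x → len x ≤ N)
    (hf : ∀ x, p x → f x = x ∨ len x < len (f x)) {x : τ} (hx : p x) :
    p (f^[N + 1] x) ∧ f (f^[N + 1] x) = f^[N + 1] x := by
  have hpj : ∀ j, p (f^[j] x) := fun j => by
    induction j with
    | zero => exact hx
    | succ j ih => rw [Function.iterate_succ_apply']; exact hp _ ih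
  have key : ∀ j, f (f^[j] x) = f^[j] x ∨ j ≤ len (f^[j] x) := by
    intro j
    induction j with
    | zero => exact .inr (Nat.zero_le _)
    | succ j ih =>
      rw [Function.iterate_succ_apply']
      rcases hf _ (hpj j) with h | h
      · exact .inl (by rw [h, h])
      · rcases ih with h' | h'
        · exact .inl (by rw [h', h'])
        · exact .inr (by omega)
  refine ⟨hpj _, (key (N + 1)).resolve_right fun h => ?_⟩
  have := hN _ (hpj (N + 1))
  omega

structure IsMatching (H m : List Edge) : Prop where
  sub : ∀ z ∈ m, z ∈ H
  fst : (m.map Prod.fst).Nodup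
  snd : (m.map Prod.snd).Nodup

theorem eq_of_nodup_map {α β : Type} {f : α → β} {l : List α} (h : (l.map f).Nodup) {x y : α}
    (hx : x ∈ l) (hy : y ∈ l) (hxy : f x = f y) : x = y :=
  List.inj_on_of_nodup_map h hx hy hxy

/-- `m'` is obtained from the matching `m` by flipping the alternating path `p` that ends in `l`. -/
structure Flipped (H m p m' : List Edge) (l : ℕ) : Prop where
  matching : IsMatching H m'
  length : m'.length = m.length
  free : ∀ z ∈ m', z.1 ≠ l
  mem_iff : ∀ z : Edge, (∀ y ∈ p, z.2 ≠ y.2) → (z ∈ m' ↔ z ∈ m)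

/-- The left end of `y` is free, and the filter removes any conflict at its right end. -/
theorem IsMatching.insert {H m : List Edge} {y : Edge} (h : IsMatching H m) (hy : y ∈ H)
    (hfree : ∀ z ∈ m, z.1 ≠ y.1) :
    IsMatching H (y :: m.filter fun z => !decide (z.2 = y.2)) where
  sub z hz := by
    rcases List.mem_cons.1 hz with rfl | hz
    · exact hy
    · exact h.sub z (List.mem_of_mem_filter hz)
  fst := by
    rw [List.map_cons, List.nodup_cons]
    refine ⟨fun hmem => ?_, h.fst.sublist (List.filter_sublist.map _)⟩
    obtain ⟨z, hz, hzy⟩ := List.mem_map.1 hmem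
    exact hfree z (List.mem_of_mem_filter hz) hzy
  snd := by
    rw [List.map_cons, List.nodup_cons]
    refine ⟨fun hmem => ?_, h.snd.sublist (List.filter_sublist.map _)⟩
    obtain ⟨z, hz, hzy⟩ := List.mem_map.1 hmem
    simp [hzy] at hz

/-- Inserting `y` uses up the free vertex `l` and displaces exactly one edge, `z`. So the size is
unchanged and the left end of `z` becomes the new free vertex. -/
theorem Flipped.extend {H m p m' : List Edge} {l : ℕ} (h : Flipped H m p m' l) {y z : Edge}
    (hy : y ∈ H) (hyl : y.1 = l) (hz : z ∈ m) (hzy : z.2 = y.2) (hp : ∀ w ∈ p, z.2 ≠ w.2) :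
    Flipped H m (y :: p) (y :: m'.filter fun w => !decide (w.2 = y.2)) z.1 := by
  have hz' : z ∈ m' := (h.mem_iff z hp).2 hz
  refine ⟨h.matching.insert hy fun w hw => hyl ▸ h.free w hw, ?_, ?_, ?_⟩
  · have : (m'.filter fun w => decide (w.2 = y.2)) = [z] := by
      have hnd : (m'.filter fun w => decide (w.2 = y.2)).Nodup :=
        (h.matching.fst.of_map _).filter _
      refine List.perm_singleton.1 ((List.perm_ext_iff_of_nodup hnd (List.nodup_singleton z)).2
        fun w => ?_)
      simp only [List.mem_filter, decide_eq_true_eq, List.mem_singleton]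
      exact ⟨fun ⟨hw, hwy⟩ => eq_of_nodup_map h.matching.snd hw hz' (hwy.trans hzy.symm),
        fun e => e ▸ ⟨hz', hzy⟩⟩
    have hlen := (List.filter_append_perm (fun w : Edge => decide (w.2 = y.2)) m').length_eq
    rw [this] at hlen
    simp only [List.length_append, List.length_singleton] at hlen
    rw [List.length_cons, ← h.length]
    omega
  · intro w hw
    rcases List.mem_cons.1 hw with rfl | hw
    · rw [hyl]; exact (h.free z hz').symm
    · intro hwz
      have := eq_of_nodup_map h.matching.fst (List.mem_of_mem_filter hw) hz' hwz
      subst this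
      simp [hzy] at hw
  · intro w hw
    simp only [List.mem_cons, forall_eq_or_imp] at hw
    rw [← h.mem_iff w hw.2]
    simp only [List.mem_cons, List.mem_filter, Bool.not_eq_true', decide_eq_false_iff_not]
    exact ⟨fun h => h.elim (fun e => absurd (e ▸ rfl) hw.1) And.left, fun h => .inr ⟨h, hw.1⟩⟩

/-- The invariant of the search for alternating paths. -/
structure Alternating (H : List Edge) (L : List ℕ) (m : List Edge) (Q : List (ℕ × List Edge)) :
    Prop where
  start : ∀ x ∈ startPaths L m, x ∈ Q
  sub : ∀ x ∈ Q, x.1 ∈ L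
  nodup : (Q.map Prod.fst).Nodup
  partner : ∀ x ∈ Q, ∀ y ∈ x.2, ∃ w ∈ Q, (w.1, y.2) ∈ m
  flipped : ∀ x ∈ Q, Flipped H m x.2 (flipPath m x.2) x.1

theorem grow_eq (H m : List Edge) (Q : List (ℕ × List Edge)) :
    (growCands H m Q = [] ∧ grow H m Q = Q) ∨ ∃ c ∈ growCands H m Q, grow H m Q = c :: Q := by
  unfold grow
  cases h : growCands H m Q with
  | nil => exact .inl ⟨rfl, rfl⟩
  | cons c l => exact .inr ⟨c, List.mem_cons_self, by simp⟩

theorem Alternating.grow {H : List Edge} {L : List ℕ} {m : List Edge} {Q : List (ℕ × List Edge)}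
    (hm : IsMatching H m) (hH : ∀ y ∈ H, y.1 ∈ L) (h : Alternating H L m Q) :
    Alternating H L m (grow H m Q) := by
  rcases grow_eq H m Q with ⟨-, e⟩ | ⟨c, hc, e⟩
  · rwa [e]
  rw [e]
  obtain ⟨x, hx, y, hy, z, hz, hyx, hzy, hnew, rfl⟩ := growCands_entry hc
  refine ⟨fun w hw => List.mem_cons_of_mem _ (h.start w hw), ?_, ?_, ?_, ?_⟩
  · simp only [List.mem_cons, forall_eq_or_imp]
    exact ⟨hH z (hm.sub z hz), h.sub⟩
  · rw [List.map_cons, List.nodup_cons]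
    refine ⟨fun hmem => ?_, h.nodup⟩
    obtain ⟨w, hw, hwz⟩ := List.mem_map.1 hmem
    exact hnew w hw hwz
  · simp only [List.mem_cons, forall_eq_or_imp, exists_eq_or_imp]
    refine ⟨⟨.inl (hzy ▸ hz), fun w hw => .inr (h.partner x hx w hw)⟩,
      fun w hw v hv => .inr (h.partner w hw v hv)⟩
  · simp only [List.mem_cons, forall_eq_or_imp]
    refine ⟨(h.flipped x hx).extend hy hyx hz hzy fun w hw hzw => ?_, h.flipped⟩
    -- If the right end of `z` were already on the path, its matching partner `z.1` would have been
    -- reached before.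
    obtain ⟨v, hv, hvm⟩ := h.partner x hx w hw
    have := eq_of_nodup_map hm.snd hz hvm hzw
    exact hnew v hv (by rw [this])

theorem Alternating.startPaths {H : List Edge} {L : List ℕ} {m : List Edge} (hL : L.Nodup)
    (hm : IsMatching H m) : Alternating H L m (startPaths L m) := by
  have key : ∀ x ∈ Holant.startPaths L m, x.1 ∈ L ∧ x.2 = [] ∧ ∀ z ∈ m, z.1 ≠ x.1 := by
    simp only [Holant.startPaths, List.mem_map, List.mem_filter, List.all_eq_true,
      Bool.not_eq_true', decide_eq_false_iff_not]
    rintro _ ⟨l, ⟨hl, h⟩, rfl⟩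
    exact ⟨hl, rfl, h⟩
  refine ⟨fun _ h => h, fun x hx => (key x hx).1, ?_, fun x hx y hy => ?_, fun x hx => ?_⟩
  · rw [Holant.startPaths, List.map_map]
    exact (List.map_id _).symm ▸ hL.filter _
  · simp [(key x hx).2.1] at hy
  · rw [(key x hx).2.1]
    exact ⟨hm, rfl, (key x hx).2.2, fun _ _ => Iff.rfl⟩

/-- Left ends of recorded paths are distinct elements of `L`, so the search is stationary after
`L.length + 1` rounds, and stationarity means that no extension is left. -/
theorem reach_spec {H : List Edge} {L : List ℕ} {m : List Edge} (hL : L.Nodup)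
    (hm : IsMatching H m) (hH : ∀ y ∈ H, y.1 ∈ L) :
    Alternating H L m (reach H L m) ∧ growCands H m (reach H L m) = [] := by
  have := iterate_fixed (f := grow H m) (len := List.length) (p := Alternating H L m)
    (N := L.length) (fun Q hQ => hQ.grow hm hH)
    (fun Q hQ => by
      rw [← List.length_map (f := Prod.fst)]
      refine (hQ.nodup.subperm fun v hv => ?_).length_le
      obtain ⟨x, hx, rfl⟩ := List.mem_map.1 hv
      exact hQ.sub x hx)
    (fun Q _ => by
      rcases grow_eq H m Q with ⟨-, e⟩ | ⟨c, -, e⟩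
      · exact .inl e
      · exact .inr (by simp [e]))
    (Alternating.startPaths hL hm)
  refine ⟨this.1, ?_⟩
  rcases grow_eq H m (reach H L m) with ⟨h, -⟩ | ⟨c, -, e⟩
  · exact h
  · have h := congrArg List.length (e.symm.trans this.2)
    simp [reach] at h

theorem augment_eq {H : List Edge} {L : List ℕ} {m : List Edge} (hL : L.Nodup)
    (hm : IsMatching H m) (hH : ∀ y ∈ H, y.1 ∈ L) :
    (augs H L m = [] ∧ augment H L m = m) ∨
      (IsMatching H (augment H L m) ∧ m.length < (augment H L m).length) := by
  unfold augment
  cases h : augs H L m with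
  | nil => exact .inl ⟨rfl, rfl⟩
  | cons p l =>
    right
    have hp : p ∈ augs H L m := by rw [h]; exact List.mem_cons_self
    simp only [augs, List.mem_flatMap, List.mem_map, List.mem_filter, Bool.and_eq_true,
      decide_eq_true_eq, List.all_eq_true, Bool.not_eq_true', decide_eq_false_iff_not] at hp
    obtain ⟨x, hx, y, ⟨hy, hyx, hfree⟩, rfl⟩ := hp
    have hA := (reach_spec hL hm hH).1
    have hF := hA.flipped x hx
    rw [List.headD_cons, flipPath, List.foldr_cons, ← flipPath]
    refine ⟨hF.matching.insert hy fun z hz => hyx ▸ hF.free z hz, ?_⟩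
    rw [List.length_cons, List.filter_eq_self.2, hF.length]
    · omega
    · intro z hz
      simp only [Bool.not_eq_true', decide_eq_false_iff_not]
      intro hzy
      -- The new right end is still free after the flip: flipping changes the matching only at right
      -- vertices of the path, and all of these were matched before.
      refine hfree z ((hF.mem_iff z fun w hw hzw => ?_).1 hz) hzy
      obtain ⟨v, -, hvm⟩ := hA.partner x hx w hw
      exact hfree _ hvm (hzw.symm.trans hzy)

/-- Kőnig's theorem: the matched edges certify the vertex cover given by the reached vertices. -/
theorem reached_spec {H : List Edge} {L : List ℕ} (hL : L.Nodup) (hH : ∀ y ∈ H, y.1 ∈ L) :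
    IsMatching H (maxMatching H L) ∧ (∀ l ∈ reached H L, l ∈ L) ∧
      (∀ l ∈ L, l ∉ reached H L → ∃ r, (l, r) ∈ maxMatching H L) ∧
      ∀ y ∈ H, y.1 ∈ reached H L → ∃ l ∈ reached H L, (l, y.2) ∈ maxMatching H L := by
  have hfix := iterate_fixed (f := augment H L) (len := List.length) (p := IsMatching H)
    (N := L.length)
    (fun m hm => by
      rcases augment_eq hL hm hH with ⟨-, e⟩ | h
      · rwa [e]
      · exact h.1)
    (fun m hm => by
      rw [← List.length_map (f := Prod.fst)]
      refine (hm.fst.subperm fun v hv => ?_).length_le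
      obtain ⟨x, hx, rfl⟩ := List.mem_map.1 hv
      exact hH x (hm.sub x hx))
    (fun m hm => by
      rcases augment_eq hL hm hH with ⟨-, e⟩ | h
      · exact .inl e
      · exact .inr h.2)
    (x := []) ⟨by simp, by simp, by simp⟩
  change IsMatching H (maxMatching H L) ∧ augment H L (maxMatching H L) = maxMatching H L at hfix
  obtain ⟨hm, hfix⟩ := hfix
  have haug : augs H L (maxMatching H L) = [] := by
    rcases augment_eq hL hm hH with ⟨h, -⟩ | h
    · exact h
    · rw [hfix] at h; exact absurd h.2 (lt_irrefl _)
  obtain ⟨hA, hg⟩ := reach_spec hL hm hH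
  refine ⟨hm, ?_, ?_, ?_⟩
  · simp only [reached, List.mem_map]
    rintro _ ⟨x, hx, rfl⟩
    exact hA.sub x hx
  · intro l hl hnot
    by_contra! hfree
    refine hnot (List.mem_map.2 ⟨(l, []), hA.start _ ?_, rfl⟩)
    simp only [startPaths, List.mem_map, List.mem_filter, List.all_eq_true, Bool.not_eq_true',
      decide_eq_false_iff_not]
    exact ⟨l, ⟨hl, fun z hz e => hfree z.2 (by rw [← e]; exact hz)⟩, rfl⟩
  · intro y hy hy1
    obtain ⟨x, hx, hxy⟩ := List.mem_map.1 hy1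
    -- An unmatched right neighbour of a reached vertex would complete an augmenting path.
    have h₁ : ∃ z ∈ maxMatching H L, z.2 = y.2 := by
      by_contra! h
      refine List.eq_nil_iff_forall_not_mem.1 haug (y :: x.2) ?_
      simp only [augs, List.mem_flatMap, List.mem_map, List.mem_filter, Bool.and_eq_true,
        decide_eq_true_eq, List.all_eq_true, Bool.not_eq_true', decide_eq_false_iff_not]
      exact ⟨x, hx, y, ⟨hy, hxy.symm, h⟩, rfl⟩
    obtain ⟨z, hz, hzy⟩ := h₁
    refine ⟨z.1, ?_, hzy ▸ hz⟩
    -- Otherwise the path could be extended along `y` and `z`, although the search is exhausted.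
    by_contra hnot
    refine List.eq_nil_iff_forall_not_mem.1 hg (z.1, y :: x.2) ?_
    simp only [growCands, List.mem_flatMap, List.mem_filter, List.mem_map, Bool.and_eq_true,
      decide_eq_true_eq, Bool.not_eq_true', List.any_eq_false]
    exact ⟨x, hx, y, ⟨hy, hxy.symm⟩, z, ⟨hz, hzy, fun w hw e =>
      hnot (List.mem_map.2 ⟨w, hw, e⟩)⟩, rfl⟩

end Holant

namespace Holant
open Enc (enc ms)

/-! ### Correctness of the separation -/

theorem mem_leftPart {n : ℕ} {B : List ℕ} {v : ℕ} : v ∈ leftPart n B ↔ v < n ∧ v ∉ B := by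
  simp only [leftPart, List.mem_filter, List.mem_range, Bool.not_eq_true', ← Bool.not_eq_true,
    mem_iff]

theorem adjacent_iff {F : List Edge} {u v : ℕ} :
    adjacent F u v = true ↔ u = v ∨ (u, v) ∈ F ∨ (v, u) ∈ F := by
  simp only [adjacent, Bool.or_eq_true, decide_eq_true_eq, List.any_eq_true, Bool.and_eq_true]
  refine or_congr Iff.rfl ⟨?_, ?_⟩
  · rintro ⟨⟨a, b⟩, he, ⟨rfl, rfl⟩ | ⟨rfl, rfl⟩⟩
    · exact .inl he
    · exact .inr he
  · rintro (h | h)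
    · exact ⟨_, h, .inl ⟨rfl, rfl⟩⟩
    · exact ⟨_, h, .inr ⟨rfl, rfl⟩⟩

theorem mem_bipartite {n : ℕ} {F : List Edge} {A B : List ℕ} {u v : ℕ} :
    (u, v) ∈ bipartite n F A B ↔
      (u < n ∧ u ∉ B) ∧ (v < n ∧ v ∉ A) ∧ (u = v ∨ (u, v) ∈ F ∨ (v, u) ∈ F) := by
  simp only [bipartite, List.mem_flatMap, List.mem_map, List.mem_filter, mem_leftPart,
    adjacent_iff, Prod.mk.injEq]
  constructor
  · rintro ⟨_, h, _, ⟨h', h''⟩, rfl, rfl⟩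
    exact ⟨h, h', h''⟩
  · rintro ⟨h, h', h''⟩
    exact ⟨u, h, v, ⟨h', h''⟩, rfl, rfl⟩

theorem card_le_of_injOn_map {m : List Edge} {f : Edge → ℕ} (hf : (m.map f).Nodup)
    {p : Edge → Prop} [DecidablePred p] {S : Finset ℕ} (h : ∀ z ∈ m, p z → f z ∈ S) :
    (m.toFinset.filter p).card ≤ S.card := by
  refine Finset.card_le_card_of_injOn f (fun z hz => ?_) fun x hx y hy hxy => ?_
  · simp only [Finset.coe_filter, List.mem_toFinset, Set.mem_ofPred_eq] at hz
    exact h z hz.1 hz.2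
  · simp only [Finset.coe_filter, List.mem_toFinset, Set.mem_ofPred_eq] at hx hy
    exact eq_of_nodup_map hf hx.1 hy.1 hxy

/-- `side` is one side of a separation of `A` from `B` that is as small as any other. -/
theorem side_spec {n k : ℕ} {F : List Edge} {A B : List ℕ} (hF : ∀ e ∈ F, e.1 < n ∧ e.2 < n)
    {P' Q' : Finset ℕ}
    (hPQ : ∀ v < n, v ∈ P' ∨ v ∈ Q') (hA : ∀ v ∈ A, v < n → v ∈ P')
    (hB : ∀ v ∈ B, v < n → v ∈ Q')
    (he : ∀ e ∈ F, (e.1 ∈ P' ∧ e.2 ∈ P') ∨ (e.1 ∈ Q' ∧ e.2 ∈ Q'))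
    (hk : P'.card + Q'.card ≤ n + k) :
    ∃ Q : Finset ℕ, (Q.filter fun v => v ∈ side n F A B).card ≤ k ∧
      (∀ v ∈ B, v < n → v ∈ Q) ∧ (∀ v ∈ A, v < n → v ∈ side n F A B) ∧
      ∀ e ∈ F, (e.1 ∈ side n F A B ∧ e.2 ∈ side n F A B) ∨ (e.1 ∈ Q ∧ e.2 ∈ Q) := by
  classical
  set H := bipartite n F A B with hH
  have hL : (leftPart n B).Nodup := List.nodup_range.filter _
  have hHL : ∀ y ∈ H, y.1 ∈ leftPart n B := by
    rintro ⟨u, v⟩ h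
    rw [hH, mem_bipartite] at h
    exact mem_leftPart.2 h.1
  obtain ⟨hm, hZL, hfree, hclosed⟩ := reached_spec hL hHL
  set Z := reached H (leftPart n B) with hZ
  set m := maxMatching H (leftPart n B) with hmdef
  have hS : ∀ v, v ∈ side n F A B ↔ v < n ∧ (v ∈ A ∨ ∃ y ∈ H, y.2 = v ∧ y.1 ∈ Z) := by
    intro v
    simp only [side, sideOf, List.mem_filter, List.mem_range, Bool.or_eq_true, mem_iff,
      List.any_eq_true, Bool.and_eq_true, decide_eq_true_eq]
    rfl
  set Q := (Finset.range n).filter fun v => v ∉ Z with hQdef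
  set P := (Finset.range n).filter fun v => v ∈ side n F A B with hPdef
  have hmemQ : ∀ v, v ∈ Q ↔ v < n ∧ v ∉ Z := fun v => by simp [hQdef]
  have hmemP : ∀ v, v ∈ P ↔ v ∈ side n F A B := fun v => by
    simp only [hPdef, Finset.mem_filter, Finset.mem_range, and_iff_right_iff_imp]
    exact fun h => ((hS v).1 h).1
  have hcov : ∀ v < n, v ∉ Q → v ∈ side n F A B := by
    intro v hv hvQ
    have hvZ : v ∈ Z := by
      by_contra h
      exact hvQ ((hmemQ v).2 ⟨hv, h⟩)
    by_cases hvA : v ∈ A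
    · exact (hS v).2 ⟨hv, .inl hvA⟩
    · refine (hS v).2 ⟨hv, .inr ⟨(v, v), ?_, rfl, hvZ⟩⟩
      exact mem_bipartite.2 ⟨mem_leftPart.1 (hZL v hvZ), ⟨hv, hvA⟩, .inl rfl⟩
  have hcross : ∀ u v, u < n → v < n → ((u, v) ∈ F ∨ (v, u) ∈ F) → u ∉ side n F A B → v ∈ Q := by
    intro u v hu hv huv hns
    by_contra hvQ
    have hvZ : v ∈ Z := by
      by_contra h
      exact hvQ ((hmemQ v).2 ⟨hv, h⟩)
    refine hns ((hS u).2 ⟨hu, .inr ⟨(v, u), ?_, rfl, hvZ⟩⟩)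
    exact mem_bipartite.2 ⟨mem_leftPart.1 (hZL v hvZ),
      ⟨hu, fun h => hns ((hS u).2 ⟨hu, .inl h⟩)⟩, .inr huv.symm⟩
  refine ⟨Q, ?_, fun v hv hvn => (hmemQ v).2 ⟨hvn, fun h => (mem_leftPart.1 (hZL v h)).2 hv⟩,
    fun v hv hvn => (hS v).2 ⟨hvn, .inl hv⟩, fun e heF => ?_⟩
  · set A' := (Finset.range n).filter fun v => v ∈ A with hA'
    set B' := (Finset.range n).filter fun v => v ∈ B with hB'
    -- Together with `hPcard` this bounds the size of the cover by that of the matching: left cover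
    -- vertices are matched by edges starting outside `Z`, right ones by edges starting in `Z`.
    have hQcard : (Q \ B').card ≤ (m.toFinset.filter fun z => z.1 ∉ Z).card := by
      refine (Finset.card_le_card fun v hv => ?_).trans (Finset.card_image_le (f := Prod.fst))
      simp only [Finset.mem_sdiff, hmemQ, hB', Finset.mem_filter, Finset.mem_range] at hv
      obtain ⟨r, hr⟩ := hfree v (mem_leftPart.2 ⟨hv.1.1, fun h => hv.2 ⟨hv.1.1, h⟩⟩) hv.1.2
      exact Finset.mem_image.2 ⟨(v, r), by simp [hr, hv.1.2], rfl⟩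
    have hPcard : (P \ A').card ≤ (m.toFinset.filter fun z => ¬ z.1 ∉ Z).card := by
      refine (Finset.card_le_card fun v hv => ?_).trans (Finset.card_image_le (f := Prod.snd))
      simp only [Finset.mem_sdiff, hmemP, hS, hA', Finset.mem_filter, Finset.mem_range] at hv
      obtain ⟨⟨hvn, hv1⟩, hv2⟩ := hv
      obtain ⟨y, hy, rfl, hyZ⟩ := hv1.resolve_left fun h => hv2 ⟨hvn, h⟩
      obtain ⟨l, hl, hlm⟩ := hclosed y hy hyZ
      exact Finset.mem_image.2 ⟨(l, y.2), by simp [hlm, hl], rfl⟩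
    have hmcard := Finset.card_filter_add_card_filter_not (s := m.toFinset) (fun z => z.1 ∉ Z)
    have hmem : ∀ z ∈ m, (z.1 < n ∧ z.1 ∉ B) ∧ (z.2 < n ∧ z.2 ∉ A) ∧ (z.1 ∈ Q' ∨ z.2 ∈ P') := by
      rintro ⟨u, v⟩ hz
      have h := mem_bipartite.1 (hm.sub _ hz)
      refine ⟨h.1, h.2.1, ?_⟩
      rcases h.2.2 with rfl | h' | h'
      · exact (hPQ u h.1.1).symm
      · rcases he _ h' with h'' | h''
        · exact .inr h''.2
        · exact .inl h''.1
      · rcases he _ h' with h'' | h''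
        · exact .inr h''.1
        · exact .inl h''.2
    -- Weak duality: every matching edge meets the competing cover, in `Q'` on the left or in `P'`
    -- on the right, and different edges meet it in different vertices.
    have h₁ : (m.toFinset.filter fun z => z.1 ∈ Q').card ≤ (Q' \ B').card :=
      card_le_of_injOn_map hm.fst fun z hz hzQ => by
        simp only [Finset.mem_sdiff, hB', Finset.mem_filter, Finset.mem_range]
        exact ⟨hzQ, fun h => (hmem z hz).1.2 h.2⟩
    have h₂ : (m.toFinset.filter fun z => ¬ z.1 ∈ Q').card ≤ (P' \ A').card :=
      card_le_of_injOn_map hm.snd fun z hz hzQ => by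
        simp only [Finset.mem_sdiff, hA', Finset.mem_filter, Finset.mem_range]
        exact ⟨(hmem z hz).2.2.resolve_left hzQ, fun h => (hmem z hz).2.1.2 h.2⟩
    have h₃ := Finset.card_filter_add_card_filter_not (s := m.toFinset) (fun z => z.1 ∈ Q')
    have hBQ' : B' ⊆ Q' := fun v hv => by
      simp only [hB', Finset.mem_filter, Finset.mem_range] at hv
      exact hB v hv.2 hv.1
    have hAP' : A' ⊆ P' := fun v hv => by
      simp only [hA', Finset.mem_filter, Finset.mem_range] at hv
      exact hA v hv.2 hv.1
    have c₁ := Finset.card_sdiff_add_card_eq_card hBQ'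
    have c₂ := Finset.card_sdiff_add_card_eq_card hAP'
    have c₃ := Finset.le_card_sdiff B' Q
    have c₄ := Finset.le_card_sdiff A' P
    have c₅ : (P ∪ Q).card = n := by
      rw [show P ∪ Q = Finset.range n by
        ext v
        simp only [Finset.mem_union, hmemP, Finset.mem_range]
        refine ⟨fun h => h.elim (fun h => ((hS v).1 h).1) fun h => ((hmemQ v).1 h).1, fun hv => ?_⟩
        by_cases hvQ : v ∈ Q
        · exact .inr hvQ
        · exact .inl (hcov v hv hvQ), Finset.card_range]
    have c₆ := Finset.card_union_add_card_inter P Q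
    have c₇ : (Q.filter fun v => v ∈ side n F A B) = P ∩ Q := by
      ext v
      simp only [Finset.mem_filter, Finset.mem_inter, hmemP, and_comm]
    rw [c₇]
    omega
  · obtain ⟨hu, hv⟩ := hF e heF
    by_cases h₁ : e.1 ∈ side n F A B
    · by_cases h₂ : e.2 ∈ side n F A B
      · exact .inl ⟨h₁, h₂⟩
      · refine .inr ⟨hcross e.2 e.1 hv hu (.inr heF) h₂, ?_⟩
        by_contra h
        exact h₂ (hcov _ hv h)
    · refine .inr ⟨?_, hcross e.1 e.2 hu hv (.inl heF) h₁⟩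
      by_contra h
      exact h₁ (hcov _ hu h)

end Holant

namespace Holant
open Enc (enc ms)

/-! ### Balanced separations -/

section
variable {V : Type*} {G : SimpleGraph V} (D : TreeDecomposition G)

/-- `X` is a union of components of the tree without the node `t`. -/
structure TreeDecomposition.Closed (t : Fin D.m) (X : Finset (Fin D.m)) : Prop where
  notMem : t ∉ X
  adj : ∀ i ∈ X, ∀ j, D.tree.Adj i j → j ∈ X ∨ j = t

variable {D}

/-- The nodes whose bags contain `v` are connected and avoid `t`, while `X` can be left only through
`t`. -/
theorem TreeDecomposition.Closed.mem_of_mem {t : Fin D.m} {X : Finset (Fin D.m)}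
    (h : D.Closed t X) {v : V} (hv : v ∉ D.bag t) {i j : Fin D.m} (hi : v ∈ D.bag i)
    (hj : v ∈ D.bag j) (hiX : i ∈ X) : j ∈ X := by
  obtain ⟨p⟩ := D.connected v ⟨i, hi⟩ ⟨j, hj⟩
  have key : ∀ {a b : {i | v ∈ D.bag i}}, (D.tree.induce {i | v ∈ D.bag i}).Walk a b →
      a.1 ∈ X → b.1 ∈ X := by
    intro a b p
    induction p with
    | nil => exact id
    | @cons a c b hac _ ih =>
      intro ha
      refine ih ((h.adj _ ha c.1 hac).resolve_right fun e => hv ?_)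
      rw [← e]
      exact c.2
  exact key p hiX

variable [DecidableEq V]

/-- The vertices occurring in bags of `X`, but not at `t`. -/
def TreeDecomposition.part (D : TreeDecomposition G) (t : Fin D.m) (X : Finset (Fin D.m)) : Finset V :=
  X.biUnion D.bag \ D.bag t

theorem TreeDecomposition.Closed.separates {t : Fin D.m} {X : Finset (Fin D.m)}
    (h : D.Closed t X) {u v : V} (hu : u ∈ D.part t X) (huv : G.Adj u v) :
    v ∈ D.part t X ∨ v ∈ D.bag t := by
  simp only [part, Finset.mem_sdiff, Finset.mem_biUnion] at hu ⊢
  obtain ⟨⟨i, hi, hui⟩, hut⟩ := hu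
  obtain ⟨j, huj, hvj⟩ := D.edge_mem u v huv
  by_cases hvt : v ∈ D.bag t
  · exact .inr hvt
  · exact .inl ⟨⟨j, h.mem_of_mem hut hui huj hi, hvj⟩, hvt⟩

/-- Descent into the heavy side. While `X` holds more than two thirds of `B`, it is replaced by a
smaller set with more than one third. If `X` has several components, split off the one of `t'`; one
of the two pieces is heavy enough. If `X` is connected, `t` moves to `t'`, which costs at most one
bag, that is at most `k ≤ |B| / 3` vertices. -/
theorem TreeDecomposition.Closed.exists_balanced {k : ℕ} (hk : ∀ i, (D.bag i).card ≤ k)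
    {B : Finset V} (hB : 3 * k ≤ B.card) (N : ℕ) {t : Fin D.m} {X : Finset (Fin D.m)}
    (h : D.Closed t X) (hN : X.card ≤ N) (hX : B.card < 3 * (B ∩ D.part t X).card) :
    ∃ t X, D.Closed t X ∧ B.card < 3 * (B ∩ D.part t X).card ∧
      3 * (B ∩ D.part t X).card ≤ 2 * B.card := by
  classical
  induction N generalizing t X with
  | zero =>
    rw [Nat.le_zero, Finset.card_eq_zero] at hN
    subst hN
    simp [part] at hX
  | succ N ih =>
    by_cases hle : 3 * (B ∩ D.part t X).card ≤ 2 * B.card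
    · exact ⟨t, X, h, hX, hle⟩
    have hne : X.Nonempty := by
      rw [Finset.nonempty_iff_ne_empty]
      rintro rfl
      simp [part] at hX
    -- `t'` is a neighbour of `t` whenever `X` contains one; otherwise any element will do.
    obtain ⟨t', ht', hadj⟩ : ∃ t' ∈ X, ∀ i ∈ X, D.tree.Adj i t → D.tree.Adj t' t := by
      by_cases hex : ∃ i ∈ X, D.tree.Adj i t
      · obtain ⟨i, hi, hit⟩ := hex
        exact ⟨i, hi, fun _ _ _ => hit⟩
      · obtain ⟨i, hi⟩ := hne
        exact ⟨i, hi, fun j hj hjt => absurd ⟨j, hj, hjt⟩ hex⟩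
    set X₁ := X.filter fun i => ∃ p : D.tree.Walk t' i, t ∉ p.support with hX₁
    have hstep : ∀ i ∈ X, ∀ j ∈ X, D.tree.Adj i j → i ∈ X₁ → j ∈ X₁ := by
      intro i _ j hj hij hi
      obtain ⟨-, p, hp⟩ := Finset.mem_filter.1 hi
      refine Finset.mem_filter.2 ⟨hj, p.concat hij, ?_⟩
      rw [SimpleGraph.Walk.support_concat]
      simp only [List.mem_append, List.mem_singleton, not_or]
      exact ⟨hp, fun e => h.notMem (e ▸ hj)⟩
    have ht'₁ : t' ∈ X₁ := Finset.mem_filter.2 ⟨ht', .nil, by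
      simpa using fun e : t = t' => h.notMem (e ▸ ht')⟩
    by_cases heq : X₁ = X
    · have hc : D.Closed t' (X.erase t') := by
        refine ⟨Finset.notMem_erase _ _, fun i hi j hij => ?_⟩
        obtain ⟨hit', hiX⟩ := Finset.mem_erase.1 hi
        rcases h.adj i hiX j hij with hj | rfl
        · by_cases hjt : j = t'
          · exact .inr hjt
          · exact .inl (Finset.mem_erase.2 ⟨hjt, hj⟩)
        · exfalso
          obtain ⟨-, p, hp⟩ := Finset.mem_filter.1 (heq.symm ▸ hiX)
          have ht't := hadj i hiX hij
          have hji : j ≠ i := fun e => h.notMem (e ▸ hiX)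
          have hjt' : j ≠ t' := fun e => h.notMem (e ▸ ht')
          -- Here `j` is the old node `t`. If a second element `i` of the component were adjacent to
          -- it, there would be two paths from `t'` to `i`, one through `j` and one avoiding it.
          let p₁ : D.tree.Path t' i := ⟨.cons ht't (.cons hij.symm .nil), by
            simp [hji, hjt'.symm, Ne.symm hit']⟩
          have := (D.isTree.isAcyclic.subsingleton_path t' i).elim p₁ p.toPath
          have hmem : j ∈ p₁.1.support := by simp [p₁]
          rw [this] at hmem
          exact hp (p.support_toPath_subset_support hmem)
      refine ih hc (by rw [Finset.card_erase_of_mem ht']; omega) ?_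
      have hsub : B ∩ D.part t X ⊆ (B ∩ D.part t' (X.erase t')) ∪ D.bag t' := by
        intro v hv
        simp only [part, Finset.mem_union, Finset.mem_inter, Finset.mem_sdiff, Finset.mem_biUnion,
          Finset.mem_erase] at hv ⊢
        obtain ⟨hvB, ⟨i, hi, hvi⟩, -⟩ := hv
        by_cases hvt : v ∈ D.bag t'
        · exact .inr hvt
        · exact .inl ⟨hvB, ⟨i, ⟨fun e => hvt (e ▸ hvi), hi⟩, hvi⟩, hvt⟩
      have h₁ := (Finset.card_le_card hsub).trans (Finset.card_union_le _ _)
      have h₂ := hk t'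
      omega
    · have hsub₁ : X₁ ⊆ X := Finset.filter_subset _ _
      have hlt₁ : X₁.card < X.card := Finset.card_lt_card (hsub₁.ssubset_of_ne heq)
      have hlt₂ : (X \ X₁).card < X.card :=
        Finset.card_lt_card (Finset.sdiff_ssubset hsub₁ ⟨t', ht'₁⟩)
      have hc₁ : D.Closed t X₁ := by
        refine ⟨fun hm => h.notMem (hsub₁ hm), fun i hi j hij => ?_⟩
        rcases h.adj i (hsub₁ hi) j hij with hj | hj
        · exact .inl (hstep i (hsub₁ hi) j hj hij hi)
        · exact .inr hj
      have hc₂ : D.Closed t (X \ X₁) := by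
        refine ⟨fun hm => h.notMem (Finset.mem_sdiff.1 hm).1, fun i hi j hij => ?_⟩
        obtain ⟨hiX, hi₁⟩ := Finset.mem_sdiff.1 hi
        rcases h.adj i hiX j hij with hj | hj
        · exact .inl (Finset.mem_sdiff.2 ⟨hj, fun hj₁ => hi₁ (hstep j hj i hiX hij.symm hj₁)⟩)
        · exact .inr hj
      have hsub : B ∩ D.part t X ⊆ (B ∩ D.part t X₁) ∪ (B ∩ D.part t (X \ X₁)) := by
        intro v hv
        simp only [part, Finset.mem_union, Finset.mem_inter, Finset.mem_sdiff,
          Finset.mem_biUnion] at hv ⊢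
        obtain ⟨hvB, ⟨i, hi, hvi⟩, hvt⟩ := hv
        by_cases hi₁ : i ∈ X₁
        · exact .inl ⟨hvB, ⟨i, hi₁, hvi⟩, hvt⟩
        · exact .inr ⟨hvB, ⟨i, ⟨hi, hi₁⟩, hvi⟩, hvt⟩
      have h₁ := (Finset.card_le_card hsub).trans (Finset.card_union_le _ _)
      by_cases h₂ : B.card < 3 * (B ∩ D.part t X₁).card
      · exact ih hc₁ (by omega) h₂
      · exact ih hc₂ (by omega) (by omega)

/-- Every set `B` of vertices is split by a set of at most `k` vertices into two parts of at most
two thirds of its size. -/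
theorem TreeDecomposition.exists_balanced_separation [Fintype V] {k : ℕ}
    (hk : ∀ i, (D.bag i).card ≤ k) {B : Finset V}
    (hB : 3 * k ≤ B.card) (hB0 : 0 < B.card) :
    ∃ Y S : Finset V, S.card ≤ k ∧ Disjoint Y S ∧ (∀ u ∈ Y, ∀ v, G.Adj u v → v ∈ Y ∨ v ∈ S) ∧
      3 * (B ∩ Y).card ≤ 2 * B.card ∧ 3 * (B \ Y).card ≤ 2 * B.card := by
  obtain ⟨v, -⟩ := Finset.card_pos.1 hB0
  obtain ⟨t₀, -⟩ := D.vertex_mem v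
  have hc : D.Closed t₀ (Finset.univ.erase t₀) := by
    refine ⟨Finset.notMem_erase _ _, fun i _ j _ => ?_⟩
    by_cases hj : j = t₀
    · exact .inr hj
    · exact .inl (by simp [hj])
  -- The descent starts from all nodes but `t₀`, which miss at most the `k ≤ |B| / 3` vertices of
  -- one bag.
  obtain ⟨t, X, hX, h₁, h₂⟩ := hc.exists_balanced hk hB _ le_rfl <| by
    have hsub : B ⊆ (B ∩ D.part t₀ (Finset.univ.erase t₀)) ∪ D.bag t₀ := by
      intro v hv
      simp only [part, Finset.mem_union, Finset.mem_inter, Finset.mem_sdiff, Finset.mem_biUnion,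
        Finset.mem_erase, Finset.mem_univ, and_true]
      by_cases hvt : v ∈ D.bag t₀
      · exact .inr hvt
      · obtain ⟨i, hi⟩ := D.vertex_mem v
        exact .inl ⟨hv, ⟨i, fun e => hvt (e ▸ hi), hi⟩, hvt⟩
    have h₁ := (Finset.card_le_card hsub).trans (Finset.card_union_le _ _)
    have h₂ := hk t₀
    omega
  refine ⟨D.part t X, D.bag t, hk t, Finset.sdiff_disjoint, fun u hu v huv => hX.separates hu huv,
    h₂, ?_⟩
  have := Finset.card_inter_add_card_sdiff B (D.part t X)
  omega

end
end Holant

namespace Holant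
open Enc (enc ms)

/-! ### The boundaries stay small -/

theorem dg_append (F F' : List Edge) (v : ℕ) : dg (F ++ F') v = dg F v + dg F' v := by
  simp [dg]

theorem dg_perm {F F' : List Edge} (h : F.Perm F') (v : ℕ) : dg F v = dg F' v :=
  (h.filter _).length_eq

theorem dg_cons (e : Edge) (F : List Edge) (v : ℕ) :
    dg (e :: F) v = (if e.1 = v ∨ e.2 = v then 1 else 0) + dg F v := by
  by_cases h : e.1 = v ∨ e.2 = v
  · simp [dg, h, add_comm]
  · simp [dg, h]

theorem dg_ne_zero {F : List Edge} {v : ℕ} : dg F v ≠ 0 ↔ ∃ e ∈ F, e.1 = v ∨ e.2 = v := by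
  rw [dg, ← Nat.pos_iff_ne_zero, List.length_pos_iff_exists_mem]
  simp

theorem mem_bdry {n : ℕ} {E F : List Edge} {v : ℕ} :
    v ∈ bdry n E F ↔ v < n ∧ dg F v ≠ 0 ∧ dg F v < dg E v := by
  simp [bdry]

theorem bdry_nodup (n : ℕ) (E F : List Edge) : (bdry n E F).Nodup := List.nodup_range.filter _

theorem length_bdry_le {n : ℕ} {E F : List Edge} {S : Finset ℕ} (h : ∀ v ∈ bdry n E F, v ∈ S) :
    (bdry n E F).length ≤ S.card := by
  rw [← List.toFinset_card_of_nodup (bdry_nodup n E F)]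
  exact Finset.card_le_card fun v hv => h v (List.mem_toFinset.1 hv)

theorem width_eq (n : ℕ) (E : List Edge) (x : List Edge × List Edge) :
    width n E x = max (bdry n E x.1).length (bdry n E x.2).length := by
  unfold width
  omega

theorem width_best_le (n : ℕ) (E F : List Edge) :
    width n E (best n E F) ≤ width n E (F.take 1, F.drop 1) ∧
      ∀ x ∈ splits n F (bdry n E F), width n E (best n E F) ≤ width n E x := by
  unfold best
  induction splits n F (bdry n E F) with
  | nil => simp
  | cons x l ih =>
    rw [List.foldr_cons]
    set b := l.foldr (fun x b => bif decide (width n E x ≤ width n E b) then x else b)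
      (F.take 1, F.drop 1)
    by_cases h : width n E x ≤ width n E b
    · simp only [h, decide_true, cond_true, List.mem_cons, forall_eq_or_imp, le_refl, true_and]
      exact ⟨h.trans ih.1, fun y hy => h.trans (ih.2 y hy)⟩
    · simp only [h, decide_false, cond_false, List.mem_cons, forall_eq_or_imp]
      exact ⟨ih.1, by omega, ih.2⟩

/-- If `F₂` has no edge at `v`, then `F₁` and `F` have the same degree there. -/
theorem mem_bdry_of_perm {n : ℕ} {E F F₁ F₂ : List Edge} (h : (F₁ ++ F₂).Perm F) {v : ℕ}
    (hv : v ∈ bdry n E F₁) : v ∈ bdry n E F ∨ dg F₂ v ≠ 0 := by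
  by_cases h₂ : dg F₂ v = 0
  · rw [mem_bdry] at hv ⊢
    have := dg_perm h v
    rw [dg_append, h₂, add_zero] at this
    exact .inl (this ▸ hv)
  · exact .inr h₂

/-- The bipartition of the boundary given by a balanced separation is among those tried. The
computed separator for it has at most `k` vertices, and the boundary of either part lies in its
share of `B` together with the separator. -/
theorem exists_split {n k : ℕ} {G : SimpleGraph (Fin n)} {D : TreeDecomposition G}
    (hk : ∀ i, (D.bag i).card ≤ k) {E F : List Edge}
    (hF : ∀ e ∈ F, ∃ (h₁ : e.1 < n) (h₂ : e.2 < n), G.Adj ⟨e.1, h₁⟩ ⟨e.2, h₂⟩)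
    (hB : 3 * k < (bdry n E F).length) :
    ∃ x ∈ splits n F (bdry n E F), 3 * width n E x ≤ 2 * (bdry n E F).length + 3 * k := by
  classical
  set B := bdry n E F with hBdef
  have hBn : ∀ v ∈ B, v < n := fun v hv => (mem_bdry.1 hv).1
  set Bf : Finset (Fin n) := Finset.univ.filter fun v => v.1 ∈ B with hBf
  have hcard : ∀ p : ℕ → Prop, ∀ [DecidablePred p], ∀ S : Finset (Fin n),
      (∀ v : Fin n, v ∈ S ↔ v.1 ∈ B ∧ p v.1) → (B.filter fun v => decide (p v)).length = S.card := by
    intro p _ S hS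
    rw [← List.toFinset_card_of_nodup ((bdry_nodup n E F).filter _),
      ← Finset.card_map Fin.valEmbedding]
    congr 1
    ext v
    simp only [List.mem_toFinset, List.mem_filter, decide_eq_true_eq, Finset.mem_map, hS,
      Fin.valEmbedding_apply]
    exact ⟨fun h => ⟨⟨v, hBn v h.1⟩, h, rfl⟩, fun ⟨w, h, e⟩ => e ▸ h⟩
  have hBcard : Bf.card = B.length := by
    rw [← hcard (fun _ => True) Bf (fun v => by simp [hBf])]
    simp
  obtain ⟨Y, S, hS, hYS, hsep, h₁, h₂⟩ := D.exists_balanced_separation hk (B := Bf) (by omega)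
    (by omega)
  have hYn : ∀ v, v ∈ Y.map Fin.valEmbedding ↔ ∃ h : v < n, (⟨v, h⟩ : Fin n) ∈ Y := by
    intro v
    simp only [Finset.mem_map, Fin.valEmbedding_apply]
    exact ⟨fun ⟨w, hw, e⟩ => e ▸ ⟨w.2, hw⟩, fun ⟨h, hv⟩ => ⟨_, hv, rfl⟩⟩
  set Y' := Y.map Fin.valEmbedding with hY'
  set A := B.filter fun v => decide (v ∈ Y') with hA
  set B' := B.filter fun v => !mem A v with hB'
  have hmemA : ∀ v, v ∈ A ↔ v ∈ B ∧ v ∈ Y' := fun v => by simp [hA]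
  have hmemB' : ∀ v, v ∈ B' ↔ v ∈ B ∧ v ∉ Y' := fun v => by
    simp only [hB', List.mem_filter, Bool.not_eq_true', ← Bool.not_eq_true, mem_iff, hmemA]
    tauto
  have hAcard : A.length = (Bf ∩ Y).card :=
    hcard (fun v => v ∈ Y') _ fun v => by simp [hBf, hYn]
  have hB'card : B'.length = (Bf \ Y).card := by
    rw [← hcard (fun v => v ∉ Y') _ fun v => by simp [hBf, hYn]]
    congr 1
    refine List.filter_congr fun v hv => ?_
    rw [Bool.eq_iff_iff, Bool.not_eq_true', ← Bool.not_eq_true, mem_iff, hmemA]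
    simp [hv]
  -- The competitor comes from the tree decomposition: `Y ∪ S` and the complement of `Y` overlap
  -- exactly in `S`, which has at most `k` elements.
  obtain ⟨Q, hQk, hBQ, hAP, hedge⟩ := side_spec (n := n) (k := k) (F := F) (A := A) (B := B')
    (P' := (Y ∪ S).map Fin.valEmbedding) (Q' := Finset.range n \ Y')
    (fun e he => let ⟨h₁, h₂, _⟩ := hF e he; ⟨h₁, h₂⟩)
    (fun v hv => by
      by_cases h : v ∈ Y'
      · exact .inl (Finset.map_subset_map.2 Finset.subset_union_left h)
      · exact .inr (Finset.mem_sdiff.2 ⟨Finset.mem_range.2 hv, h⟩))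
    (fun v hv _ => Finset.map_subset_map.2 Finset.subset_union_left ((hmemA v).1 hv).2)
    (fun v hv hvn => Finset.mem_sdiff.2 ⟨Finset.mem_range.2 hvn, ((hmemB' v).1 hv).2⟩)
    (fun e he => by
      obtain ⟨hu, hv, huv⟩ := hF e he
      have hP : ∀ w (hw : w < n), (⟨w, hw⟩ ∈ Y ∨ ⟨w, hw⟩ ∈ S) →
          w ∈ (Y ∪ S).map Fin.valEmbedding := fun w hw h =>
        Finset.mem_map.2 ⟨⟨w, hw⟩, Finset.mem_union.2 h, rfl⟩
      by_cases h₁ : (⟨e.1, hu⟩ : Fin n) ∈ Y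
      · exact .inl ⟨hP _ hu (.inl h₁), hP _ hv (hsep _ h₁ _ huv)⟩
      by_cases h₂ : (⟨e.2, hv⟩ : Fin n) ∈ Y
      · exact .inl ⟨hP _ hu (hsep _ h₂ _ huv.symm), hP _ hv (.inl h₂)⟩
      · refine .inr ⟨Finset.mem_sdiff.2 ⟨Finset.mem_range.2 hu, fun h => ?_⟩,
          Finset.mem_sdiff.2 ⟨Finset.mem_range.2 hv, fun h => ?_⟩⟩
        · exact h₁ ((hYn _).1 h).2
        · exact h₂ ((hYn _).1 h).2)
    (by
      have h₃ := Finset.card_union_le Y S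
      have h₄ : Y' ⊆ Finset.range n := fun v hv => Finset.mem_range.2 ((hYn v).1 hv).1
      have h₅ := Finset.card_sdiff_add_card_eq_card h₄
      have h₆ : Y'.card = Y.card := Finset.card_map _
      rw [Finset.card_range] at h₅
      rw [Finset.card_map]
      omega)
  set P := side n F A B' with hP
  set R := Q.filter fun v => v ∈ P with hR
  have hperm : (inside P F ++ outside P F).Perm F := List.filter_append_perm _ F
  have hin : ∀ v, dg (inside P F) v ≠ 0 → v ∈ P := by
    intro v hv
    obtain ⟨e, he, hev⟩ := dg_ne_zero.1 hv
    simp only [inside, List.mem_filter, Bool.and_eq_true, mem_iff] at he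
    rcases hev with rfl | rfl
    · exact he.2.1
    · exact he.2.2
  have hout : ∀ v, dg (outside P F) v ≠ 0 → v ∈ Q := by
    intro v hv
    obtain ⟨e, he, hev⟩ := dg_ne_zero.1 hv
    simp only [outside, List.mem_filter, Bool.not_eq_true', ← Bool.not_eq_true, Bool.and_eq_true,
      mem_iff] at he
    have := (hedge e he.1).resolve_left he.2
    rcases hev with rfl | rfl
    · exact this.1
    · exact this.2
  have hsplit : ∀ v ∈ B, v ∈ A ∨ v ∈ B' := fun v hv => by
    rw [hmemA, hmemB']; tauto
  -- A boundary vertex of the inner part that is not in `A` lies in `Q`, as it belongs to `B'` or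
  -- meets an edge of the outer part.
  have hb₁ : (bdry n E (inside P F)).length ≤ A.length + k := by
    refine (length_bdry_le (S := A.toFinset ∪ R) fun v hv => ?_).trans
      ((Finset.card_union_le _ _).trans (Nat.add_le_add (List.toFinset_card_le _) hQk))
    have hvP := hin v (mem_bdry.1 hv).2.1
    rw [Finset.mem_union, List.mem_toFinset, hR, Finset.mem_filter]
    rcases mem_bdry_of_perm hperm hv with h | h
    · rcases hsplit v h with h' | h'
      · exact .inl h'
      · exact .inr ⟨hBQ v h' (hBn v h), hvP⟩
    · exact .inr ⟨hout v h, hvP⟩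
  have hb₂ : (bdry n E (outside P F)).length ≤ B'.length + k := by
    refine (length_bdry_le (S := B'.toFinset ∪ R) fun v hv => ?_).trans
      ((Finset.card_union_le _ _).trans (Nat.add_le_add (List.toFinset_card_le _) hQk))
    have hvQ := hout v (mem_bdry.1 hv).2.1
    rw [Finset.mem_union, List.mem_toFinset, hR, Finset.mem_filter]
    rcases mem_bdry_of_perm (List.perm_append_comm.trans hperm) hv with h | h
    · rcases hsplit v h with h' | h'
      · exact .inr ⟨hvQ, hAP v h' (hBn v h)⟩
      · exact .inl h'
    · exact .inr ⟨hvQ, hin v h⟩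
  have hbdry : ∀ F', F'.Perm F → (bdry n E F').length = B.length := fun F' h => by
    rw [hBdef]
    unfold bdry
    simp only [dg_perm h]
  refine ⟨splitBy P F, ?_, ?_⟩
  · simp only [splits, List.mem_filter, List.mem_map, Bool.and_eq_true, Bool.not_eq_true',
      List.isEmpty_eq_false_iff]
    -- An empty part would leave all of `F`, with boundary of size `|B|`, to the other; but `2|B|/3
    -- + k < |B|` because `3k < |B|`.
    refine ⟨⟨A, mem_subs.2 List.filter_sublist, rfl⟩, fun h => ?_, fun h => ?_⟩
    · change inside P F = [] at h
      rw [h, List.nil_append] at hperm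
      have := hbdry _ hperm
      omega
    · change outside P F = [] at h
      rw [h, List.append_nil] at hperm
      have := hbdry _ hperm
      omega
  · rw [width_eq]
    simp only [splitBy]
    omega

/-- For `3k < |B| ≤ 3k + 2` the balanced split has width at most `2|B|/3 + k < 3k + 2`. For `|B| ≤
3k`, cutting off one edge adds at most its two ends. -/
theorem width_best {n k : ℕ} {G : SimpleGraph (Fin n)} {D : TreeDecomposition G}
    (hk : ∀ i, (D.bag i).card ≤ k) {E F : List Edge}
    (hF : ∀ e ∈ F, ∃ (h₁ : e.1 < n) (h₂ : e.2 < n), G.Adj ⟨e.1, h₁⟩ ⟨e.2, h₂⟩)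
    (hB : (bdry n E F).length ≤ 3 * k + 2) : width n E (best n E F) ≤ 3 * k + 2 := by
  by_cases h : 3 * k < (bdry n E F).length
  · obtain ⟨x, hx, hxw⟩ := exists_split hk hF h
    have := (width_best_le n E F).2 x hx
    omega
  · refine (width_best_le n E F).1.trans ?_
    rw [width_eq]
    cases F with
    | nil => simp only [List.take_nil, List.drop_nil, max_self]; omega
    | cons e F =>
      simp only [List.take_succ_cons, List.take_zero, List.drop_succ_cons, List.drop_zero]
      have hfirst : ∀ v, dg [e] v ≠ 0 → v ∈ ({e.1, e.2} : Finset ℕ) := by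
        intro v hv
        obtain ⟨e', he', hve⟩ := dg_ne_zero.1 hv
        rw [List.mem_singleton] at he'
        subst he'
        simp only [Finset.mem_insert, Finset.mem_singleton]
        rcases hve with rfl | rfl <;> simp
      have h₁ := length_bdry_le (n := n) (E := E) (F := [e]) (S := {e.1, e.2})
        fun v hv => hfirst v (mem_bdry.1 hv).2.1
      have h₂ := length_bdry_le (n := n) (E := E) (F := F)
          (S := (bdry n E (e :: F)).toFinset ∪ {e.1, e.2}) fun v hv => by
        rw [Finset.mem_union, List.mem_toFinset]
        exact (mem_bdry_of_perm (F₂ := [e]) (List.perm_append_comm (l₂ := [e])) hv).imp id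
          (hfirst v)
      have h₃ := Finset.card_union_le (bdry n E (e :: F)).toFinset {e.1, e.2}
      have h₄ := List.toFinset_card_le (bdry n E (e :: F))
      have h₅ : ({e.1, e.2} : Finset ℕ).card ≤ 2 := Finset.card_le_two
      omega

end Holant

namespace Holant
open Enc (enc ms)

/-! ### Sums over the assignments to a list of edges -/

section
variable {q : ℕ}

/-- The contribution of the edge `e` with value `i` to the count vectors at the vertices. -/
def edgeVec (e : Edge) (i : Fin q) (v : ℕ) : Vec q := if e.1 = v ∨ e.2 = v then vsingle i else 0

/-- The sum of `Φ` at the count vectors of all assignments to the edges of a list. -/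
def edgeSum : List Edge → ((ℕ → Vec q) → ℂ) → ℂ
  | [], Φ => Φ 0
  | e :: F, Φ => ∑ i, edgeSum F fun c => Φ (c + edgeVec e i)

theorem edgeSum_append (F F' : List Edge) (Φ : (ℕ → Vec q) → ℂ) :
    edgeSum (F ++ F') Φ = edgeSum F fun c => edgeSum F' fun c' => Φ (c + c') := by
  induction F generalizing Φ with
  | nil => simp [edgeSum]
  | cons e F ih =>
    simp only [List.cons_append, edgeSum, ih]
    refine Finset.sum_congr rfl fun i _ => ?_
    congr 1; funext c; congr 1; funext c'
    rw [add_right_comm]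

theorem edgeSum_perm {F F' : List Edge} (h : F.Perm F') (Φ : (ℕ → Vec q) → ℂ) :
    edgeSum F Φ = edgeSum F' Φ := by
  induction h generalizing Φ with
  | nil => rfl
  | cons e _ ih => simp only [edgeSum, ih]
  | swap e e' F =>
    simp only [edgeSum]
    rw [Finset.sum_comm]
    simp only [add_right_comm]
  | trans _ _ ih₁ ih₂ => rw [ih₁, ih₂]

theorem edgeSum_add (F : List Edge) (Φ Ψ : (ℕ → Vec q) → ℂ) :
    edgeSum F (fun c => Φ c + Ψ c) = edgeSum F Φ + edgeSum F Ψ := by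
  induction F generalizing Φ Ψ with
  | nil => rfl
  | cons e F ih => simp only [edgeSum, ih, Finset.sum_add_distrib]

theorem edgeSum_mul (F : List Edge) (z : ℂ) (Φ : (ℕ → Vec q) → ℂ) :
    edgeSum F (fun c => z * Φ c) = z * edgeSum F Φ := by
  induction F generalizing Φ with
  | nil => rfl
  | cons e F ih => simp only [edgeSum, ih, Finset.mul_sum]

theorem edgeSum_zero (F : List Edge) : edgeSum F (fun _ : ℕ → Vec q => 0) = 0 := by
  induction F with
  | nil => rfl
  | cons e F ih => simp [edgeSum, ih]

def tot (c : Vec q) : ℕ := ∑ i, c i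

theorem tot_add (c c' : Vec q) : tot (c + c') = tot c + tot c' := Finset.sum_add_distrib

theorem tot_zero : tot (0 : Vec q) = 0 := by simp [tot]

theorem tot_eq_zero {c : Vec q} : tot c = 0 ↔ c = 0 := by
  simp [tot, funext_iff]

theorem tot_vsingle (i : Fin q) : tot (vsingle i) = 1 := by simp [tot, vsingle]

theorem tot_edgeVec (e : Edge) (i : Fin q) (v : ℕ) :
    tot (edgeVec e i v) = if e.1 = v ∨ e.2 = v then 1 else 0 := by
  unfold edgeVec
  split_ifs
  · exact tot_vsingle i
  · exact tot_zero

/-- Only count vectors of the right size matter. -/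
theorem edgeSum_congr {F : List Edge} {Φ Ψ : (ℕ → Vec q) → ℂ}
    (h : ∀ c, (∀ v, tot (c v) = dg F v) → Φ c = Ψ c) : edgeSum F Φ = edgeSum F Ψ := by
  induction F generalizing Φ Ψ with
  | nil => exact h 0 fun v => by simp [tot, dg]
  | cons e F ih =>
    refine Finset.sum_congr rfl fun i _ => ih fun c hc => h _ fun v => ?_
    rw [Pi.add_apply, tot_add, hc, tot_edgeVec, dg_cons, add_comm]

end

/-! ### The tables represent the partial sums -/

section
variable {q : ℕ}

noncomputable def val (I : Inp q) (v : ℕ) (c : Vec q) : ℂ := (look (tabAt I v) c).headD 0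

def st (s : State q) (v : ℕ) : Vec q := s.getD v vzero

/-- The tables are those of functions whose arities are the degrees in `E`. -/
structure WellFormed (I : Inp q) (E : List Edge) : Prop where
  look_ne : ∀ v < I.length, ∀ c, look (tabAt I v) c ≠ [] ↔ tot c = dg E v
  val_eq : ∀ v < I.length, ∀ e ∈ tabAt I v, val I v e.1 = e.2

theorem mem_of_look_ne {t : Tab q} {c : Vec q} (h : look t c ≠ []) : ∃ e ∈ t, e.1 = c := by
  obtain ⟨z, hz⟩ := List.exists_mem_of_ne_nil _ h
  simp only [look, List.mem_map, List.mem_filter, veq_iff] at hz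
  obtain ⟨e, ⟨he, hec⟩, -⟩ := hz
  exact ⟨e, he, hec⟩

variable {I : Inp q} {E : List Edge}

theorem WellFormed.val_eq_zero (hI : WellFormed I E) {v : ℕ} (hv : v < I.length) {c : Vec q}
    (h : tot c ≠ dg E v) : val I v c = 0 := by
  have : look (tabAt I v) c = [] := by
    by_contra h'
    exact h ((hI.look_ne v hv c).1 h')
  simp [val, this]

/-- Because of the equal sizes, `c + x` and `c' + x` both occur in the table or both do not. In the
first case `c + x` is one of the entries tested; in the second both values are the default `0`. -/
theorem WellFormed.eqvV_iff (hI : WellFormed I E) {v : ℕ} (hv : v < I.length) {c c' : Vec q}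
    (h : tot c = tot c') :
    eqvV (tabAt I v) c c' = true ↔ ∀ x, val I v (c + x) = val I v (c' + x) := by
  have h₀ : eqvV (tabAt I v) c c' = true ↔
      ∀ e ∈ tabAt I v, c ≤ e.1 → val I v (e.1 - c + c') = e.2 := by
    simp only [eqvV, List.all_eq_true, Bool.or_eq_true, Bool.not_eq_true', ← Bool.not_eq_true,
      vle_iff, ceq_iff, imp_iff_not_or]
    rfl
  rw [h₀]
  constructor
  · intro h₁ x
    by_cases hx : tot (c + x) = dg E v
    · obtain ⟨e, he, hec⟩ := mem_of_look_ne ((hI.look_ne v hv _).2 hx)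
      have h₂ := h₁ e he (hec ▸ le_self_add)
      rw [← hI.val_eq v hv e he, hec, add_tsub_cancel_left, add_comm x] at h₂
      exact h₂.symm
    · rw [hI.val_eq_zero hv hx, hI.val_eq_zero hv]
      rwa [tot_add, ← h, ← tot_add]
  · intro h₁ e he hce
    rw [add_comm, ← h₁, add_tsub_cancel_of_le hce, hI.val_eq v hv e he]

/-- All edges at `v` are in `F`. -/
def Complete (E F : List Edge) (v : ℕ) : Prop := dg F v = dg E v ∧ dg E v ≠ 0

instance (E F : List Edge) (v : ℕ) : Decidable (Complete E F v) :=
  inferInstanceAs (Decidable (_ ∧ _))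

/-- The states of `T` have the right sizes. -/
def Shaped (I : Inp q) (E F : List Edge) (s : State q) : Prop :=
  ∀ v < I.length, tot (st s v) = if Complete E F v then 0 else dg F v

/-- Families of functions by which the partial sums may be completed. -/
def Admissible (I : Inp q) (E F : List Edge) (φ : ℕ → Vec q → ℂ) : Prop :=
  ∀ v < I.length, dg F v ≠ 0 → ∃ x : Vec q, (Complete E F v → x = 0) ∧ ∀ c, φ v c = val I v (c + x)

/-- A complete vertex contributes `1` because its function value has been moved into the weight. -/
noncomputable def activeProd (I : Inp q) (E F : List Edge) (φ : ℕ → Vec q → ℂ) (s : State q) : ℂ :=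
  ∏ v ∈ Finset.range I.length, if Complete E F v then 1 else φ v (st s v)

noncomputable def tableSum (T : Table q) (Φ : State q → ℂ) : ℂ := (T.map fun y => y.2 * Φ y.1).sum

theorem tableSum_cons (y : State q × ℂ) (T : Table q) (Φ : State q → ℂ) :
    tableSum (y :: T) Φ = y.2 * Φ y.1 + tableSum T Φ := by simp [tableSum]

/-- The table need only agree with the true distribution of count vectors under the functionals the
rest of the instance can apply; this is what survives merging equivalent states. At a vertex without
edges in `F` the family `φ` is unrestricted, as only the zero vector occurs there. -/
structure Represents (I : Inp q) (E F : List Edge) (T : Table q) : Prop where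
  shaped : ∀ y ∈ T, Shaped I E F y.1
  sum_eq : ∀ φ, Admissible I E F φ → tableSum T (activeProd I E F φ) =
    edgeSum F fun c => ∏ v ∈ Finset.range I.length, φ v (c v)

theorem key_ins {x : State q × ℂ} {T : Table q} {y : State q × ℂ} (h : y ∈ ins I x T) :
    y.1 = x.1 ∨ ∃ w ∈ T, w.1 = y.1 := by
  induction T with
  | nil =>
    simp only [ins, List.mem_singleton] at h
    exact .inl (h ▸ rfl)
  | cons w T ih =>
    rw [ins] at h
    cases hw : eqv I x.1 w.1 <;> simp only [hw, cond_true, cond_false, List.mem_cons] at h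
    · rcases h with rfl | h
      · exact .inr ⟨y, List.mem_cons_self, rfl⟩
      · exact (ih h).imp id fun ⟨u, hu, e⟩ => ⟨u, List.mem_cons_of_mem _ hu, e⟩
    · rcases h with rfl | h
      · exact .inr ⟨w, List.mem_cons_self, rfl⟩
      · exact .inr ⟨y, List.mem_cons_of_mem _ h, rfl⟩

theorem key_collapse {T : Table q} {y : State q × ℂ} (h : y ∈ collapse I T) :
    ∃ w ∈ T, w.1 = y.1 := by
  induction T generalizing y with
  | nil => simp [collapse] at h
  | cons x T ih =>
    rcases key_ins (show y ∈ ins I x (collapse I T) from h) with e | ⟨w, hw, e⟩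
    · exact ⟨x, List.mem_cons_self, e.symm⟩
    · obtain ⟨u, hu, e'⟩ := ih hw
      exact ⟨u, List.mem_cons_of_mem _ hu, e'.trans e⟩

theorem tableSum_ins {Φ : State q → ℂ} {x : State q × ℂ} {T : Table q}
    (h : ∀ y ∈ T, eqv I x.1 y.1 = true → Φ x.1 = Φ y.1) :
    tableSum (ins I x T) Φ = x.2 * Φ x.1 + tableSum T Φ := by
  induction T with
  | nil => simp [ins, tableSum]
  | cons y T ih =>
    rw [ins]
    cases hy : eqv I x.1 y.1
    · rw [cond_false, tableSum_cons, tableSum_cons, ih fun w hw => h w (List.mem_cons_of_mem _ hw)]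
      ring
    · rw [cond_true, tableSum_cons, tableSum_cons, h y List.mem_cons_self hy]
      ring

/-- Merging keeps one of the old states as representative, so the assumption on pairs from `T`
covers every comparison made. -/
theorem tableSum_collapse {Φ : State q → ℂ} {T : Table q}
    (h : ∀ x ∈ T, ∀ y ∈ T, eqv I x.1 y.1 = true → Φ x.1 = Φ y.1) :
    tableSum (collapse I T) Φ = tableSum T Φ := by
  induction T with
  | nil => rfl
  | cons x T ih =>
    rw [collapse, List.foldr_cons, ← collapse, tableSum_ins, tableSum_cons,
      ih fun y hy w hw => h y (List.mem_cons_of_mem _ hy) w (List.mem_cons_of_mem _ hw)]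
    intro y hy hxy
    obtain ⟨w, hw, e⟩ := key_collapse hy
    rw [← e] at hxy ⊢
    exact h x List.mem_cons_self w (List.mem_cons_of_mem _ hw) hxy

theorem ins_pairwise {x : State q × ℂ} {T : Table q}
    (h : T.Pairwise fun a b => eqv I b.1 a.1 = false) :
    (ins I x T).Pairwise fun a b => eqv I b.1 a.1 = false := by
  induction T with
  | nil => simp [ins]
  | cons y T ih =>
    rw [List.pairwise_cons] at h
    rw [ins]
    cases hy : eqv I x.1 y.1
    · rw [cond_false, List.pairwise_cons]
      refine ⟨fun w hw => ?_, ih h.2⟩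
      rcases key_ins hw with e | ⟨u, hu, e⟩
      · rw [e, hy]
      · rw [← e]; exact h.1 u hu
    · rw [cond_true, List.pairwise_cons]
      exact h

theorem collapse_pairwise (T : Table q) :
    (collapse I T).Pairwise fun a b => eqv I b.1 a.1 = false := by
  induction T with
  | nil => exact List.Pairwise.nil
  | cons x T ih => exact ins_pairwise ih

theorem eqv_iff {s s' : State q} :
    eqv I s s' = true ↔ ∀ v < I.length, eqvV (tabAt I v) (st s v) (st s' v) = true := by
  simp only [eqv, List.all_eq_true, List.mem_range, st]

theorem WellFormed.activeProd_congr (hI : WellFormed I E) {F : List Edge} {φ : ℕ → Vec q → ℂ}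
    (hφ : Admissible I E F φ) {s s' : State q} (hs : Shaped I E F s) (hs' : Shaped I E F s')
    (h : eqv I s s' = true) : activeProd I E F φ s = activeProd I E F φ s' := by
  refine Finset.prod_congr rfl fun v hv => ?_
  rw [Finset.mem_range] at hv
  by_cases hf : Complete E F v
  · simp [hf]
  · have h₁ := hs v hv
    have h₂ := hs' v hv
    rw [if_neg hf] at h₁ h₂
    rw [if_neg hf, if_neg hf]
    by_cases h₀ : dg F v = 0
    · rw [tot_eq_zero.1 (h₁.trans h₀), tot_eq_zero.1 (h₂.trans h₀)]
    · obtain ⟨x, -, hx⟩ := hφ v hv h₀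
      rw [hx, hx]
      exact (hI.eqvV_iff hv (h₁.trans h₂.symm)).1 (eqv_iff.1 h v hv) x

/-- States before the finished vertices are cleared. -/
def Raw (I : Inp q) (E F : List Edge) (s : State q) : Prop :=
  ∀ v < I.length, if Complete E F v then st s v = 0 ∨ tot (st s v) = dg E v else tot (st s v) = dg F v

theorem st_map_range {f : ℕ → Vec q} {n v : ℕ} (hv : v < n) :
    st ((List.range n).map f) v = f v := by
  simp [st, hv]

/-- A vector occurs in the table exactly if its size is the full degree; the test against zero
excludes isolated vertices and vertices cleared earlier. -/
theorem WellFormed.finished_iff (hI : WellFormed I E) {F : List Edge} {s : State q}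
    (hs : Raw I E F s) {v : ℕ} (hv : v < I.length) :
    finished I s v = true ↔ Complete E F v ∧ st s v ≠ 0 := by
  have h₀ : finished I s v = true ↔ st s v ≠ 0 ∧ tot (st s v) = dg E v := by
    rw [← hI.look_ne v hv]
    simp only [finished, Bool.and_eq_true, Bool.not_eq_true', ← Bool.not_eq_true, veq_iff,
      List.isEmpty_iff]
    rfl
  have := hs v hv
  rw [h₀]
  by_cases hf : Complete E F v
  · rw [if_pos hf] at this
    exact ⟨fun h => ⟨hf, h.1⟩, fun h => ⟨h.2, this.resolve_left h.2⟩⟩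
  · rw [if_neg hf] at this
    refine ⟨fun h => absurd ⟨this.symm.trans h.2, fun h0 => h.1 (tot_eq_zero.1 (h.2.trans h0))⟩ hf,
      fun h => absurd h.1 hf⟩

theorem WellFormed.reduceState_shaped (hI : WellFormed I E) {F : List Edge} {s : State q}
    (hs : Raw I E F s) : Shaped I E F (reduceState I s) := by
  intro v hv
  rw [reduceState, st_map_range hv]
  have h₁ := hI.finished_iff hs hv
  have h₂ := hs v hv
  by_cases hf : Complete E F v
  · rw [if_pos hf]
    cases h : finished I s v
    · have : st s v = 0 := by
        by_contra h0
        simp [h₁.2 ⟨hf, h0⟩] at h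
      exact (congrArg tot this).trans tot_zero
    · exact tot_zero
  · rw [if_neg hf] at h₂ ⊢
    cases h : finished I s v
    · exact h₂
    · exact absurd (h₁.1 h).1 hf

/-- The product belonging to a state in which some vertices have been cleared already. -/
noncomputable def rawProd (I : Inp q) (E F : List Edge) (φ : ℕ → Vec q → ℂ) (s : State q) : ℂ :=
  ∏ v ∈ Finset.range I.length, if Complete E F v ∧ st s v = 0 then 1 else φ v (st s v)

theorem prod_map_range (n : ℕ) (f : ℕ → ℂ) :
    ((List.range n).map f).prod = ∏ v ∈ Finset.range n, f v := by
  simp only [Finset.prod, Finset.range_val, Multiset.range, Multiset.map_coe, Multiset.prod_coe]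

theorem WellFormed.factors_mul (hI : WellFormed I E) {F : List Edge} {s : State q}
    (hs : Raw I E F s) {φ : ℕ → Vec q → ℂ} (hφ : Admissible I E F φ) :
    (factors I s).prod * activeProd I E F φ (reduceState I s) = rawProd I E F φ s := by
  have : (factors I s).prod = ∏ v ∈ Finset.range I.length,
      bif finished I s v then val I v (st s v) else 1 := by
    rw [← prod_map_range]
    rfl
  rw [this, activeProd, ← Finset.prod_mul_distrib]
  refine Finset.prod_congr rfl fun v hv => ?_
  rw [Finset.mem_range] at hv
  rw [reduceState, st_map_range hv]
  have h₁ := hI.finished_iff hs hv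
  by_cases hf : Complete E F v
  · by_cases h0 : st s v = 0
    · have : finished I s v = false := by
        rw [← Bool.not_eq_true, h₁]; tauto
      simp [hf, h0, this]
    · have : finished I s v = true := h₁.2 ⟨hf, h0⟩
      obtain ⟨x, hx, hφx⟩ := hφ v hv (hf.1.symm ▸ hf.2)
      simp [hf, h0, this, hφx, hx hf]
  · have : finished I s v = false := by
      rw [← Bool.not_eq_true, h₁]; tauto
    simp only [hf, this, cond_false, if_false, false_and, one_mul]
    rfl

/-- The common last step for single edges and for unions: it suffices to verify the sum before
clearing and merging. -/
theorem WellFormed.represents_collapse (hI : WellFormed I E) {F : List Edge} {T : Table q}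
    (hT : ∀ y ∈ T, Raw I E F y.1)
    (h : ∀ φ, Admissible I E F φ → tableSum T (rawProd I E F φ) =
      edgeSum F fun c => ∏ v ∈ Finset.range I.length, φ v (c v)) :
    Represents I E F (collapse I (T.map (reduce I))) := by
  have hsh : ∀ y ∈ T.map (reduce I), Shaped I E F y.1 := by
    intro y hy
    obtain ⟨x, hx, rfl⟩ := List.mem_map.1 hy
    exact hI.reduceState_shaped (hT x hx)
  refine ⟨fun y hy => ?_, fun φ hφ => ?_⟩
  · obtain ⟨w, hw, e⟩ := key_collapse hy
    exact e ▸ hsh w hw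
  · rw [tableSum_collapse fun x hx y hy hxy =>
      hI.activeProd_congr hφ (hsh x hx) (hsh y hy) hxy, ← h φ hφ]
    simp only [tableSum, List.map_map]
    congr 1
    refine List.map_congr_left fun x hx => ?_
    simp only [Function.comp, reduce]
    rw [mul_assoc, hI.factors_mul (hT x hx) hφ]

end
end Holant

/-! ### Tables of single edges and of unions, their size, and the final value -/

namespace Holant
open Enc (enc ms)

section
variable {q : ℕ} {I : Inp q} {E : List Edge}

theorem tableSum_append (T T' : Table q) (Φ : State q → ℂ) :
    tableSum (T ++ T') Φ = tableSum T Φ + tableSum T' Φ := by simp [tableSum]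

theorem edgeSum_tableSum (F : List Edge) (T : Table q) (Ψ : State q → (ℕ → Vec q) → ℂ) :
    edgeSum F (fun c => tableSum T fun s => Ψ s c) = tableSum T fun s => edgeSum F (Ψ s) := by
  induction T with
  | nil => exact edgeSum_zero F
  | cons y T ih => simp only [tableSum_cons, edgeSum_add, edgeSum_mul, ih]

theorem dg_nil (v : ℕ) : dg [] v = 0 := rfl

theorem represents_nil : Represents I E [] [(zeroState I, 1)] := by
  have hst : ∀ v < I.length, st (zeroState I) v = 0 := fun v hv => by
    rw [zeroState, st_map_range hv]; rfl
  have hc : ∀ v, ¬ Complete E [] v := fun v h => h.2 (h.1.symm.trans (dg_nil v))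
  refine ⟨fun y hy v hv => ?_, fun φ _ => ?_⟩
  · rw [List.mem_singleton] at hy
    subst hy
    rw [hst v hv, if_neg (hc v), dg_nil, tot_zero]
  · simp only [tableSum, List.map_cons, List.map_nil, List.sum_singleton, one_mul, edgeSum,
      activeProd, hc, if_false, Pi.zero_apply]
    exact Finset.prod_congr rfl fun v hv => by rw [hst v (Finset.mem_range.1 hv)]

theorem WellFormed.represents_singleton (hI : WellFormed I E) (e : Edge) :
    Represents I E [e] (collapse I ((List.finRange q).map fun i => reduce I (edgeState I e i, 1))) := by
  have hst : ∀ i, ∀ v < I.length, st (edgeState I e i) v = edgeVec e i v := fun i v hv => by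
    rw [edgeState, st_map_range hv, edgeVec]
    by_cases h : e.1 = v ∨ e.2 = v
    · rw [if_pos h, ← Bool.decide_or, decide_eq_true h]; rfl
    · rw [if_neg h, ← Bool.decide_or, decide_eq_false h]; rfl
  have htot : ∀ i, ∀ v < I.length, tot (st (edgeState I e i) v) = dg [e] v := fun i v hv => by
    rw [hst i v hv, tot_edgeVec, dg_cons, dg_nil, add_zero]
  have hraw : ∀ i, ∀ v < I.length, ¬(Complete E [e] v ∧ st (edgeState I e i) v = 0) := by
    rintro i v hv ⟨⟨h₁, h₂⟩, h₃⟩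
    have := htot i v hv
    rw [h₃, tot_zero] at this
    omega
  have := hI.represents_collapse (F := [e])
    (T := (List.finRange q).map fun i => (edgeState I e i, (1 : ℂ))) ?_ ?_
  · rwa [List.map_map] at this
  · intro y hy v hv
    obtain ⟨i, -, rfl⟩ := List.mem_map.1 hy
    have := htot i v hv
    split_ifs with h
    · exact .inr (this.trans h.1)
    · exact this
  · intro φ _
    simp only [tableSum, List.map_map, edgeSum, zero_add]
    rw [← Fin.sum_univ_def]
    refine Finset.sum_congr rfl fun i _ => ?_
    simp only [Function.comp, one_mul, rawProd]
    refine Finset.prod_congr rfl fun v hv => ?_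
    rw [Finset.mem_range] at hv
    rw [if_neg (hraw i v hv), hst i v hv]

theorem WellFormed.represents_leaf (hI : WellFormed I E) {F : List Edge} (hF : F.length ≤ 1) :
    Represents I E F (leafTable I F) := by
  match F, hF with
  | [], _ => exact represents_nil
  | [e], _ => exact hI.represents_singleton e

/-- Shifted families stay admissible. For fixed counts `c₂` on `F₂`, the family shifted by `c₂` is
admissible for `F₁`, which brings in `T₁`; for a fixed state of `T₁`, the family shifted by that
state is admissible for `F₂`, which brings in `T₂`. A vertex complete in one part has no edge in the
other, so its value is never shifted. -/
theorem WellFormed.represents_merge (hI : WellFormed I E) {F F₁ F₂ : List Edge} {T₁ T₂ : Table q}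
    (hp : (F₁ ++ F₂).Perm F) (hF : ∀ v, dg F v ≤ dg E v) (h₁ : Represents I E F₁ T₁)
    (h₂ : Represents I E F₂ T₂) : Represents I E F (mergeTables I T₁ T₂) := by
  have hdg : ∀ v, dg F v = dg F₁ v + dg F₂ v := fun v => by rw [← dg_perm hp, dg_append]
  have hst : ∀ s s', ∀ v < I.length, st (addState I s s') v = st s v + st s' v :=
    fun s s' v hv => by rw [addState, st_map_range hv]; rfl
  have hc₁ : ∀ v, Complete E F₁ v → Complete E F v ∧ dg F₂ v = 0 := fun v h => by
    obtain ⟨h, h'⟩ := h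
    have := hF v
    have := hdg v
    exact ⟨⟨by omega, h'⟩, by omega⟩
  have hc₂ : ∀ v, Complete E F₂ v → Complete E F v ∧ dg F₁ v = 0 := fun v h => by
    obtain ⟨h, h'⟩ := h
    have := hF v
    have := hdg v
    exact ⟨⟨by omega, h'⟩, by omega⟩
  have hz₁ : ∀ y ∈ T₁, ∀ v < I.length, Complete E F₁ v ∨ dg F₁ v = 0 → st y.1 v = 0 := by
    intro y hy v hv h
    have := h₁.shaped y hy v hv
    refine tot_eq_zero.1 (this.trans ?_)
    split_ifs with h'
    · rfl
    · exact h.resolve_left h'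
  have hz₂ : ∀ y ∈ T₂, ∀ v < I.length, Complete E F₂ v ∨ dg F₂ v = 0 → st y.1 v = 0 := by
    intro y hy v hv h
    have := h₂.shaped y hy v hv
    refine tot_eq_zero.1 (this.trans ?_)
    split_ifs with h'
    · rfl
    · exact h.resolve_left h'
  have ht₁ : ∀ y ∈ T₁, ∀ v < I.length, ¬ Complete E F₁ v → tot (st y.1 v) = dg F₁ v :=
    fun y hy v hv h => (h₁.shaped y hy v hv).trans (if_neg h)
  have ht₂ : ∀ y ∈ T₂, ∀ v < I.length, ¬ Complete E F₂ v → tot (st y.1 v) = dg F₂ v :=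
    fun y hy v hv h => (h₂.shaped y hy v hv).trans (if_neg h)
  have := hI.represents_collapse (F := F)
    (T := T₁.flatMap fun x => T₂.map fun y => (addState I x.1 y.1, x.2 * y.2)) ?_ ?_
  · rw [List.map_flatMap] at this
    simp only [List.map_map] at this
    exact this
  · intro w hw v hv
    simp only [List.mem_flatMap, List.mem_map] at hw
    obtain ⟨x, hx, y, hy, rfl⟩ := hw
    rw [hst _ _ v hv]
    by_cases c₁ : Complete E F₁ v
    · rw [if_pos (hc₁ v c₁).1, hz₁ x hx v hv (.inl c₁), hz₂ y hy v hv (.inr (hc₁ v c₁).2)]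
      exact .inl (add_zero 0)
    by_cases c₂ : Complete E F₂ v
    · rw [if_pos (hc₂ v c₂).1, hz₂ y hy v hv (.inl c₂), hz₁ x hx v hv (.inr (hc₂ v c₂).2)]
      exact .inl (add_zero 0)
    have ht := ht₁ x hx v hv c₁
    have ht' := ht₂ y hy v hv c₂
    have := hdg v
    rw [tot_add]
    split_ifs with h
    · exact .inr (by rw [← h.1]; omega)
    · omega
  · intro φ hφ
    have hR : (edgeSum F fun c => ∏ v ∈ Finset.range I.length, φ v (c v)) =
        edgeSum F₂ fun c₂ => tableSum T₁ fun s₁ => ∏ v ∈ Finset.range I.length,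
          if Complete E F₁ v then 1 else φ v (st s₁ v + c₂ v) := by
      rw [edgeSum_perm (hp.symm.trans List.perm_append_comm), edgeSum_append]
      -- The size of `c₂` is needed: it forces `c₂ v = 0` where `F₁` is complete, as admissibility
      -- demands.
      refine edgeSum_congr fun c₂ hcc => ?_
      have hφ₁ : Admissible I E F₁ fun v c => φ v (c + c₂ v) := by
        intro v hv h0
        obtain ⟨x, hx, hφx⟩ := hφ v hv (by have := hdg v; omega)
        refine ⟨c₂ v + x, fun h => ?_, fun c => by beta_reduce; rw [hφx, add_assoc]⟩
        rw [hx (hc₁ v h).1, tot_eq_zero.1 ((hcc v).trans (hc₁ v h).2), add_zero]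
      have := h₁.sum_eq _ hφ₁
      change (tableSum T₁ fun s₁ => ∏ v ∈ Finset.range I.length,
        if Complete E F₁ v then 1 else φ v (st s₁ v + c₂ v)) = _ at this
      rw [this]
      refine congrArg (edgeSum F₁) (funext fun c => Finset.prod_congr rfl fun v _ => ?_)
      rw [Pi.add_apply, add_comm]
    rw [hR, edgeSum_tableSum]
    have hL : tableSum (T₁.flatMap fun x => T₂.map fun y => (addState I x.1 y.1, x.2 * y.2))
        (rawProd I E F φ) = (T₁.map fun x => x.2 * tableSum T₂ fun s₂ =>
          rawProd I E F φ (addState I x.1 s₂)).sum := by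
      clear hR h₁ hz₁ ht₁
      induction T₁ with
      | nil => rfl
      | cons x T ih =>
        rw [List.flatMap_cons, tableSum_append, ih, List.map_cons, List.sum_cons]
        congr 1
        simp only [tableSum, List.map_map, Function.comp_def, mul_assoc, List.sum_map_mul_left]
    rw [hL, tableSum]
    congr 1
    refine List.map_congr_left fun x hx => ?_
    congr 1
    have hφ₂ : Admissible I E F₂ fun v c =>
        if Complete E F₁ v then 1 else φ v (st x.1 v + c) := by
      intro v hv h0
      have hn : ¬ Complete E F₁ v := fun h => h0 (hc₁ v h).2
      obtain ⟨w, hw, hφw⟩ := hφ v hv (by have := hdg v; omega)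
      refine ⟨st x.1 v + w, fun h => ?_, fun c => ?_⟩
      · rw [hw (hc₂ v h).1, hz₁ x hx v hv (.inr (hc₂ v h).2), add_zero]
      · beta_reduce
        rw [if_neg hn, hφw]
        congr 1
        abel
    rw [← h₂.sum_eq _ hφ₂]
    simp only [tableSum]
    congr 1
    refine List.map_congr_left fun y hy => ?_
    congr 1
    refine Finset.prod_congr rfl fun v hv => ?_
    rw [Finset.mem_range] at hv
    rw [hst _ _ v hv]
    by_cases c₁ : Complete E F₁ v
    · simp [c₁, (hc₁ v c₁).1, hz₁ x hx v hv (.inl c₁), hz₂ y hy v hv (.inr (hc₁ v c₁).2)]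
    by_cases c₂ : Complete E F₂ v
    · simp [c₂, (hc₂ v c₂).1, hz₂ y hy v hv (.inl c₂), hz₁ x hx v hv (.inr (hc₂ v c₂).2)]
    -- A vertex completed only by the union has a merged state of size equal to its positive degree,
    -- so it cannot be mistaken for a cleared one.
    have hn : ¬ (Complete E F v ∧ st x.1 v + st y.1 v = 0) := by
      rintro ⟨⟨h, h'⟩, h0⟩
      have ht := ht₁ x hx v hv c₁
      have ht' := ht₂ y hy v hv c₂
      have hs := congrArg tot h0
      rw [tot_add, tot_zero] at hs
      have := hdg v
      omega
    beta_reduce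
    rw [if_neg hn, if_neg c₁, if_neg c₂]

theorem WellFormed.represents_solve (hI : WellFormed I E) (N : ℕ) {F : List Edge}
    (hN : F.length ≤ N) (hF : ∀ v, dg F v ≤ dg E v) : Represents I E F (solve I E F) := by
  induction N generalizing F with
  | zero =>
    rw [solve, if_pos (by omega)]
    exact hI.represents_leaf (by omega)
  | succ N ih =>
    rw [solve]
    split_ifs with h
    · exact hI.represents_leaf h
    · have hl := best_length (n := I.length) (E := E) (F := F) (by omega)
      have hs := (best_spec (n := I.length) (E := E) (F := F) (by omega)).1
      have hdg : ∀ v, dg (best I.length E F).1 v + dg (best I.length E F).2 v = dg F v :=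
        fun v => by rw [← dg_append, dg_perm hs]
      exact hI.represents_merge hs hF
        (ih (by omega) fun v => by have := hdg v; have := hF v; omega)
        (ih (by omega) fun v => by have := hdg v; have := hF v; omega)

theorem solve_pairwise (F : List Edge) :
    (solve I E F).Pairwise fun a b => eqv I b.1 a.1 = false := by
  rw [solve]
  split_ifs
  · unfold leafTable
    cases F.isEmpty
    · exact collapse_pairwise _
    · exact List.pairwise_singleton _ _
  · exact collapse_pairwise _

/-- The number of classes of count vectors of a given size at every vertex is at most `C`. -/
def Regular (I : Inp q) (C : ℕ) : Prop :=
  ∀ v < I.length, ∀ k, ∃ κ : Vec q → Fin C, ∀ c c', tot c = k → tot c' = k → κ c = κ c' →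
    ∀ x, val I v (c + x) = val I v (c' + x)

/-- Off the boundary all states are zero, since the vertex is complete or has no edge in `F`. Thus
the classes at the boundary vertices determine a state up to equivalence, and the states of the
table are pairwise inequivalent. -/
theorem WellFormed.length_le (hI : WellFormed I E) {C : ℕ} (hC : Regular I C) {F : List Edge}
    (hF : ∀ v, dg F v ≤ dg E v) {T : Table q} (hT : ∀ y ∈ T, Shaped I E F y.1)
    (hpw : T.Pairwise fun a b => eqv I b.1 a.1 = false) :
    T.length ≤ C ^ (bdry I.length E F).length := by
  classical
  choose κ hκ using fun v : {v // v ∈ (bdry I.length E F).toFinset} =>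
    hC v.1 (mem_bdry.1 (List.mem_toFinset.1 v.2)).1 (dg F v.1)
  let key : State q × ℂ → ({v // v ∈ (bdry I.length E F).toFinset} → Fin C) :=
    fun y v => κ v (st y.1 v)
  have hnd : (T.map key).Nodup := by
    rw [List.Nodup, List.pairwise_map]
    refine (List.Pairwise.and_mem.1 hpw).imp fun {a b} hab hkey => ?_
    obtain ⟨ha, hb, hab⟩ := hab
    rw [← Bool.not_eq_true, eqv_iff] at hab
    refine hab fun v hv => ?_
    have ha := hT a ha v hv
    have hb := hT b hb v hv
    rw [hI.eqvV_iff hv (hb.trans ha.symm)]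
    intro x
    by_cases hvb : v ∈ bdry I.length E F
    · have hnc : ¬ Complete E F v := fun h => by
        have := (mem_bdry.1 hvb).2.2
        have := h.1
        omega
      rw [if_neg hnc] at ha hb
      exact hκ ⟨v, List.mem_toFinset.2 hvb⟩ _ _ hb ha (congrFun hkey _).symm x
    · have h0 : (if Complete E F v then 0 else dg F v) = 0 := by
        split_ifs with h
        · rfl
        · by_contra h0
          refine hvb (mem_bdry.2 ⟨hv, h0, lt_of_le_of_ne (hF v) fun e => h ⟨e, ?_⟩⟩)
          omega
      rw [tot_eq_zero.1 (ha.trans h0), tot_eq_zero.1 (hb.trans h0)]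
  have := hnd.length_le_card
  rwa [List.length_map, Fintype.card_fun, Fintype.card_fin, Fintype.card_coe,
    List.toFinset_card_of_nodup (bdry_nodup _ _ _)] at this

/-- With all edges taken, every vertex of positive degree is complete. Taking `φ = val I`, only the
isolated vertices are left over, at the zero vector. -/
theorem WellFormed.result_eq (hI : WellFormed I (edges I)) :
    result I = edgeSum (edges I) fun c => ∏ v ∈ Finset.range I.length, val I v (c v) := by
  have hR := hI.represents_solve _ le_rfl fun _ => le_rfl
  rw [← hR.sum_eq (val I) fun v _ _ => ⟨0, fun _ => rfl, fun c => by rw [add_zero]⟩, result,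
    prod_map_range, tableSum, ← List.sum_map_mul_right]
  congr 1
  refine List.map_congr_left fun y hy => ?_
  congr 1
  refine Finset.prod_congr rfl fun v hv => ?_
  rw [Finset.mem_range] at hv
  have hl := hI.look_ne v hv vzero
  rw [show tot (vzero : Vec q) = 0 from tot_zero] at hl
  by_cases h0 : dg (edges I) v = 0
  · have hn : ¬ Complete (edges I) (edges I) v := fun h => h.2 h0
    rw [if_neg hn]
    have hst := hR.shaped y hy v hv
    rw [if_neg hn, h0, tot_eq_zero] at hst
    rw [hst]
    have hne := hl.2 h0.symm
    unfold val
    change (look (tabAt I v) 0).headD 1 = _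
    change look (tabAt I v) 0 ≠ [] at hne
    cases h : look (tabAt I v) 0 with
    | nil => exact absurd h hne
    | cons z l => rfl
  · rw [if_pos ⟨rfl, h0⟩]
    have : look (tabAt I v) vzero = [] := by
      by_contra h
      exact h0 (hl.1 h).symm
    rw [this]
    rfl

end
end Holant

/-! ### The encoded input: value tables and edge list -/

namespace Holant
open Enc (enc ms)

section
variable {q : ℕ}

/-- The table of a symmetric function. -/
noncomputable def tableOf {d : ℕ} (f : (Fin d → Fin q) → ℂ) : Tab q :=
  (List.Nat.antidiagonalTuple q d).attach.map fun c =>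
    (c.1, atCounts f c.1 (List.Nat.mem_antidiagonalTuple.1 c.2))

noncomputable def input (Ω : Instance q) : Inp q :=
  List.ofFn fun v : Fin Ω.n => (List.ofFn fun i => (Ω.nbr v i : ℕ), tableOf (Ω.f v))

theorem enc_tableOf {d : ℕ} (f : (Fin d → Fin q) → ℂ) : enc (tableOf f) = encodeFun f := by
  simp only [enc, tableOf, encodeFun, List.map_map, List.map_ofFn]
  rfl

theorem enc_input (Ω : Instance q) : enc (input Ω) = Ω.encode := by
  have h : ∀ v, enc (List.ofFn fun i => (Ω.nbr v i : ℕ)) =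
      Val.ofList (List.ofFn fun i => Val.ofNat (Ω.nbr v i)) := fun v => by
    simp only [enc, List.map_ofFn]
    rfl
  change Val.ofList ((input Ω).map enc) = _
  rw [input, List.map_ofFn, Instance.encode]
  congr 2
  funext v
  change Val.pair (enc _) (enc _) = _
  rw [h, enc_tableOf]

theorem mem_tableOf {d : ℕ} {f : (Fin d → Fin q) → ℂ} {e : Vec q × ℂ} :
    e ∈ tableOf f ↔ ∃ h : ∑ i, e.1 i = d, e.2 = atCounts f e.1 h := by
  simp only [tableOf, List.mem_map, List.mem_attach, true_and, Subtype.exists]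
  constructor
  · rintro ⟨c, hc, rfl⟩
    exact ⟨List.Nat.mem_antidiagonalTuple.1 hc, rfl⟩
  · rintro ⟨h, he⟩
    exact ⟨e.1, List.Nat.mem_antidiagonalTuple.2 h, by rw [← he]⟩

theorem mem_look {t : Tab q} {c : Vec q} {z : ℂ} : z ∈ look t c ↔ (c, z) ∈ t := by
  simp only [look, List.mem_map, List.mem_filter, veq_iff]
  constructor
  · rintro ⟨⟨c', z'⟩, ⟨h, rfl⟩, rfl⟩
    exact h
  · intro h
    exact ⟨_, ⟨h, rfl⟩, rfl⟩

theorem look_tableOf {d : ℕ} {f : (Fin d → Fin q) → ℂ} {c : Vec q} (h : ∑ i, c i = d) :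
    (look (tableOf f) c).headD 0 = atCounts f c h := by
  have hmem : atCounts f c h ∈ look (tableOf f) c := mem_look.2 (mem_tableOf.2 ⟨h, rfl⟩)
  cases hl : look (tableOf f) c with
  | nil => simp [hl] at hmem
  | cons z l =>
    have hz : z ∈ look (tableOf f) c := by rw [hl]; exact List.mem_cons_self
    obtain ⟨_, hz'⟩ := mem_tableOf.1 (mem_look.1 hz)
    exact hz'

theorem look_tableOf_ne {d : ℕ} {f : (Fin d → Fin q) → ℂ} {c : Vec q} :
    look (tableOf f) c ≠ [] ↔ tot c = d := by
  constructor
  · intro h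
    obtain ⟨z, hz⟩ := List.exists_mem_of_ne_nil _ h
    exact (mem_tableOf.1 (mem_look.1 hz)).1
  · intro h h'
    have : atCounts f c h ∈ look (tableOf f) c := mem_look.2 (mem_tableOf.2 ⟨h, rfl⟩)
    simp [h'] at this

theorem length_input (Ω : Instance q) : (input Ω).length = Ω.n := by simp [input]

theorem tabAt_input (Ω : Instance q) (v : Fin Ω.n) : tabAt (input Ω) v = tableOf (Ω.f v) := by
  simp [tabAt, input]

theorem mem_edges (Ω : Instance q) {e : Edge} : e ∈ edges (input Ω) ↔
    e.1 < e.2 ∧ ∃ (h₁ : e.1 < Ω.n) (h₂ : e.2 < Ω.n), Ω.graph.Adj ⟨e.1, h₁⟩ ⟨e.2, h₂⟩ := by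
  obtain ⟨u, v⟩ := e
  simp only [edges, length_input, List.mem_flatMap, List.mem_range, List.mem_map, List.mem_filter,
    decide_eq_true_eq, Prod.mk.injEq]
  constructor
  · rintro ⟨u', hu, v', ⟨hv, huv⟩, rfl, rfl⟩
    simp only [input, List.getD_eq_getElem?_getD, List.getElem?_ofFn, hu, dite_true,
      Option.getD_some, List.mem_ofFn] at hv
    obtain ⟨i, rfl⟩ := hv
    exact ⟨huv, hu, (Ω.nbr _ i).2, Ω.adj_nbr _ i⟩
  · rintro ⟨huv, hu, hv, h⟩
    refine ⟨u, hu, v, ⟨?_, huv⟩, rfl, rfl⟩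
    simp only [input, List.getD_eq_getElem?_getD, List.getElem?_ofFn, hu, dite_true,
      Option.getD_some, List.mem_ofFn]
    have hr := Finset.range_orderEmbOfFin (Ω.graph.neighborFinset ⟨u, hu⟩) rfl
    have hm : (⟨v, hv⟩ : Fin Ω.n) ∈ (Ω.graph.neighborFinset ⟨u, hu⟩ : Set (Fin Ω.n)) := by
      simpa using h
    rw [← hr] at hm
    obtain ⟨i, hi⟩ := hm
    exact ⟨i, congrArg Fin.val hi⟩

theorem nodup_edges (Ω : Instance q) : (edges (input Ω)).Nodup := by
  refine List.nodup_flatMap.2 ⟨fun u hu => ?_, ?_⟩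
  · rw [length_input, List.mem_range] at hu
    refine List.Nodup.map (fun a b h => (Prod.mk.inj h).2) (List.Nodup.filter _ ?_)
    simp only [input, List.getD_eq_getElem?_getD, List.getElem?_ofFn, hu, dite_true,
      Option.getD_some]
    refine List.nodup_ofFn.2 fun i j h => ?_
    exact (Finset.orderEmbOfFin _ _).injective (Fin.val_injective h)
  · refine List.nodup_range.imp fun {a b} hab => ?_
    simp only [Function.onFun, List.disjoint_left, List.mem_map]
    rintro _ ⟨x, -, rfl⟩ ⟨y, -, h⟩
    exact hab (Prod.mk.inj h).1.symm

theorem dg_edges (Ω : Instance q) (v : Fin Ω.n) :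
    dg (edges (input Ω)) v = Ω.graph.degree v := by
  rw [dg, ← List.toFinset_card_of_nodup ((nodup_edges Ω).filter _),
    ← SimpleGraph.card_neighborFinset_eq_degree, ← Finset.card_map Fin.valEmbedding]
  refine Finset.card_nbij' (fun e => if e.1 = v then e.2 else e.1)
    (fun w => (min v.1 w, max v.1 w)) ?_ ?_ ?_ ?_
  · rintro ⟨a, b⟩ he
    simp only [List.coe_toFinset, List.mem_filter, Set.mem_ofPred_eq, mem_edges, Bool.or_eq_true,
      decide_eq_true_eq] at he
    obtain ⟨⟨hab, ha, hb, h⟩, h'⟩ := he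
    simp only [Finset.coe_map, Set.mem_image, Finset.mem_coe, SimpleGraph.mem_neighborFinset,
      Fin.valEmbedding_apply]
    rcases h' with rfl | rfl
    · exact ⟨⟨b, hb⟩, h, by simp⟩
    · exact ⟨⟨a, ha⟩, h.symm, by simp [hab.ne]⟩
  · intro w hw
    simp only [Finset.coe_map, Set.mem_image, Finset.mem_coe, SimpleGraph.mem_neighborFinset,
      Fin.valEmbedding_apply] at hw
    obtain ⟨w, hw, rfl⟩ := hw
    have hne : v.1 ≠ w.1 := fun h => hw.ne (Fin.ext h)
    simp only [List.coe_toFinset, List.mem_filter, Set.mem_ofPred_eq, mem_edges, Bool.or_eq_true,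
      decide_eq_true_eq]
    rcases hne.lt_or_gt with h | h
    · simp only [min_eq_left h.le, max_eq_right h.le]
      exact ⟨⟨h, v.2, w.2, hw⟩, by simp⟩
    · simp only [min_eq_right h.le, max_eq_left h.le]
      exact ⟨⟨h, w.2, v.2, hw.symm⟩, by simp⟩
  · rintro ⟨a, b⟩ he
    simp only [List.coe_toFinset, List.mem_filter, Set.mem_ofPred_eq, mem_edges, Bool.or_eq_true,
      decide_eq_true_eq] at he
    obtain ⟨⟨hab, -⟩, h'⟩ := he
    rcases h' with rfl | rfl
    · simp [hab.le]
    · simp [hab.le, hab.ne]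
  · intro w hw
    simp only [Finset.coe_map, Set.mem_image, Finset.mem_coe, SimpleGraph.mem_neighborFinset,
      Fin.valEmbedding_apply] at hw
    obtain ⟨w, hw, rfl⟩ := hw
    have hne : v.1 ≠ w.1 := fun h => hw.ne (Fin.ext h)
    rcases hne.lt_or_gt with h | h
    · simp [h.le]
    · simp [h.le, h.ne]

theorem wellFormed_input (Ω : Instance q) : WellFormed (input Ω) (edges (input Ω)) where
  look_ne v hv c := by
    rw [length_input] at hv
    lift v to Fin Ω.n using hv
    rw [tabAt_input, look_tableOf_ne, dg_edges]
  val_eq v hv e he := by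
    rw [length_input] at hv
    lift v to Fin Ω.n using hv
    rw [tabAt_input] at he
    obtain ⟨h, he⟩ := mem_tableOf.1 he
    rw [val, tabAt_input, look_tableOf h, he]

/-! ### The Holant as a sum over count vectors -/

/-- The count vector of the arguments of a function. -/
def counts {d : ℕ} (x : Fin d → Fin q) : Vec q := ∑ j, vsingle (x j)

theorem counts_apply {d : ℕ} (x : Fin d → Fin q) (i : Fin q) :
    counts x i = Fintype.card {j // x j = i} := by
  rw [counts, Finset.sum_apply, Fintype.card_subtype, Finset.card_filter]
  refine Finset.sum_congr rfl fun j _ => ?_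
  simp [vsingle, eq_comm]

theorem tot_counts {d : ℕ} (x : Fin d → Fin q) : tot (counts x) = d := by
  simp only [tot, counts, Finset.sum_apply]
  rw [Finset.sum_comm]
  simp [vsingle]

/-- Fibres of equal size can be matched up, which gives a permutation carrying `y` to `x`. -/
theorem IsSymmetric.eq_of_counts {d : ℕ} {f : (Fin d → Fin q) → ℂ} (hf : IsSymmetric f)
    {x y : Fin d → Fin q} (h : counts x = counts y) : f x = f y := by
  have e : ∀ i, {j // x j = i} ≃ {j // y j = i} := fun i =>
    Fintype.equivOfCardEq (by rw [← counts_apply, ← counts_apply, h])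
  rw [← hf (Equiv.ofFiberEquiv e) y]
  congr 1
  funext j
  exact (Equiv.ofFiberEquiv_map e j).symm

theorem counts_get (l : List (Fin q)) : counts l.get = fun i => l.count i := by
  induction l with
  | nil => funext i; simp [counts]
  | cons a l ih =>
    have h : counts (a :: l).get = vsingle a + counts l.get := by
      rw [counts, counts]
      exact Fin.sum_univ_succ (n := l.length) (fun j => vsingle ((a :: l).get j))
    rw [h, ih]
    funext i
    rw [Pi.add_apply, vsingle, List.count_cons, add_comm]
    by_cases hi : a = i
    · simp [hi]
    · simp [hi, Ne.symm hi]

theorem counts_cast {d d' : ℕ} (h : d = d') (x : Fin d' → Fin q) :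
    counts (fun j : Fin d => x (j.cast h)) = counts x := by
  subst h; rfl

theorem count_countWord (c : Vec q) (i : Fin q) : (countWord c).count i = c i := by
  rw [countWord, List.count_flatMap]
  simp only [Function.comp_def, List.count_replicate]
  rw [← Fin.sum_univ_def]
  simp

theorem atCounts_counts {d : ℕ} {f : (Fin d → Fin q) → ℂ} (hf : IsSymmetric f)
    (x : Fin d → Fin q) (h : ∑ i, counts x i = d) : atCounts f (counts x) h = f x := by
  refine hf.eq_of_counts ?_
  rw [counts_cast _ (countWord (counts x)).get, counts_get]
  funext i
  exact count_countWord _ i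

theorem val_input (Ω : Instance q) (v : Fin Ω.n) (x : Fin (Ω.graph.degree v) → Fin q) :
    val (input Ω) v (counts x) = Ω.f v x := by
  rw [val, tabAt_input, look_tableOf (tot_counts x)]
  exact atCounts_counts (Ω.symm v) x _

theorem edgeSum_eq_sum (F : List Edge) (Φ : (ℕ → Vec q) → ℂ) :
    edgeSum F Φ = ∑ τ : Fin F.length → Fin q, Φ (∑ j, edgeVec (F.get j) (τ j)) := by
  induction F generalizing Φ with
  | nil => simp [edgeSum]
  | cons e F ih =>
    simp only [edgeSum, ih]
    rw [← Finset.sum_product', Finset.univ_product_univ]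
    refine Fintype.sum_equiv (Fin.consEquiv fun _ => Fin q) _ _ fun x => ?_
    congr 1
    rw [add_comm]
    exact (Fin.sum_univ_succ (n := F.length) fun j : Fin (F.length + 1) =>
      edgeVec ((e :: F).get j) ((Fin.consEquiv fun _ => Fin q) x j)).symm

/-- An edge of the list, as an edge of the graph. -/
def edgeOf (Ω : Instance q) (e : {e // e ∈ edges (input Ω)}) : Ω.graph.edgeSet :=
  ⟨s(⟨e.1.1, ((mem_edges Ω).1 e.2).2.1⟩, ⟨e.1.2, ((mem_edges Ω).1 e.2).2.2.1⟩),
    ((mem_edges Ω).1 e.2).2.2.2⟩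

theorem edgeOf_injective (Ω : Instance q) : Function.Injective (edgeOf Ω) := by
  intro e e' h
  have h₁ := ((mem_edges Ω).1 e.2).1
  have h₂ := ((mem_edges Ω).1 e'.2).1
  have h₃ := Sym2.eq_iff.1 (congrArg Subtype.val h)
  simp only [Fin.ext_iff] at h₃
  exact Subtype.ext (Prod.ext (by omega) (by omega))

theorem edgeOf_surjective (Ω : Instance q) : Function.Surjective (edgeOf Ω) := by
  rintro ⟨e, he⟩
  induction e using Sym2.ind with
  | _ a b =>
    have hab : Ω.graph.Adj a b := he
    rcases lt_or_gt_of_ne hab.ne with h | h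
    · exact ⟨⟨(a.1, b.1), (mem_edges Ω).2 ⟨h, a.2, b.2, hab⟩⟩, rfl⟩
    · exact ⟨⟨(b.1, a.1), (mem_edges Ω).2 ⟨h, b.2, a.2, hab.symm⟩⟩, Subtype.ext Sym2.eq_swap⟩

theorem mem_edgeOf (Ω : Instance q) (e : {e // e ∈ edges (input Ω)}) (v : Fin Ω.n) :
    v ∈ (edgeOf Ω e).1 ↔ e.1.1 = v ∨ e.1.2 = v := by
  simp only [edgeOf, Sym2.mem_iff, Fin.ext_iff, eq_comm]

noncomputable def edgeEquiv (Ω : Instance q) :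
    Fin (edges (input Ω)).length ≃ Ω.graph.edgeSet :=
  Equiv.ofBijective (fun j => edgeOf Ω ⟨(edges (input Ω)).get j, List.get_mem _ j⟩)
    ⟨fun _ _ h => (nodup_edges Ω).injective_get
      (congrArg Subtype.val (edgeOf_injective Ω h)), fun e => by
      obtain ⟨⟨x, hx⟩, rfl⟩ := edgeOf_surjective Ω e
      obtain ⟨j, rfl⟩ := List.get_of_mem hx
      exact ⟨j, rfl⟩⟩

theorem mem_edgeEquiv (Ω : Instance q) (j : Fin (edges (input Ω)).length) (v : Fin Ω.n) :
    v ∈ (edgeEquiv Ω j).1 ↔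
      ((edges (input Ω)).get j).1 = v ∨ ((edges (input Ω)).get j).2 = v :=
  mem_edgeOf Ω _ v

/-- The edges containing `v` are in bijection with the indices of its neighbours. -/
theorem sum_edgeVec (Ω : Instance q) (σ : Ω.graph.edgeSet → Fin q) (v : Fin Ω.n) :
    (∑ j, edgeVec ((edges (input Ω)).get j) (σ (edgeEquiv Ω j))) v =
      counts fun i => σ (Ω.incEdge v i) := by
  classical
  rw [Finset.sum_apply]
  have h₁ : ∀ j, edgeVec ((edges (input Ω)).get j) (σ (edgeEquiv Ω j)) v =
      if v ∈ (edgeEquiv Ω j).1 then vsingle (σ (edgeEquiv Ω j)) else 0 := fun j => by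
    rw [edgeVec]
    simp only [mem_edgeEquiv]
  simp only [h₁]
  rw [(edgeEquiv Ω).sum_comp fun e => if v ∈ e.1 then vsingle (σ e) else 0, ← Finset.sum_filter,
    counts]
  symm
  refine Finset.sum_bij (fun i _ => Ω.incEdge v i) (fun i _ => ?_) (fun i _ j _ h => ?_)
    (fun e he => ?_) fun _ _ => rfl
  · simp [Instance.incEdge]
  · exact (Finset.orderEmbOfFin _ _).injective (Sym2.congr_right.1 (congrArg Subtype.val h))
  · obtain ⟨e, heE⟩ := e
    simp only [Finset.mem_filter, Finset.mem_univ, true_and] at he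
    obtain ⟨w, rfl⟩ := Sym2.mem_iff_exists.1 he
    have hr := Finset.range_orderEmbOfFin (Ω.graph.neighborFinset v) rfl
    have hm : w ∈ (Ω.graph.neighborFinset v : Set (Fin Ω.n)) := by
      simpa using heE
    rw [← hr] at hm
    obtain ⟨i, hi⟩ := hm
    exact ⟨i, Finset.mem_univ _, Subtype.ext (congrArg (fun w => s(v, w)) hi)⟩

theorem result_input (Ω : Instance q) : result (input Ω) = Ω.hol := by
  rw [(wellFormed_input Ω).result_eq, edgeSum_eq_sum, Instance.hol, length_input]
  symm
  refine Fintype.sum_equiv ((edgeEquiv Ω).arrowCongr (Equiv.refl (Fin q))).symm _ _ fun σ => ?_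
  rw [Finset.prod_range]
  refine Finset.prod_congr rfl fun v _ => ?_
  rw [← val_input, ← sum_edgeVec]
  rfl

end
end Holant

namespace Holant
open Enc (enc ms)

section
variable {q : ℕ}

/-! ### Regularity -/

theorem exists_counts {k : ℕ} {c : Vec q} (h : tot c = k) : ∃ τ : Fin k → Fin q, counts τ = c := by
  have hl : k = (countWord c).length := h.symm.trans (length_countWord c).symm
  refine ⟨fun j => (countWord c).get (j.cast hl), ?_⟩
  rw [counts_cast hl, counts_get]
  funext i
  exact count_countWord c i

theorem counts_append {d l k : ℕ} (h : d = l + k) (ξ : Fin l → Fin q) (τ : Fin k → Fin q) :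
    counts (Fin.append ξ τ ∘ Fin.cast h) = counts τ + counts ξ := by
  subst h
  simp only [counts, Fin.cast_refl, Function.comp_id, Fin.sum_univ_add, Fin.append_left,
    Fin.append_right]
  rw [add_comm]

theorem exists_code {τ β : Type} [Finite τ] [Nonempty τ] (g : τ → β) {C : ℕ}
    (h : (Set.range g).ncard ≤ C) : 0 < C ∧ ∃ κ : τ → Fin C, ∀ a b, κ a = κ b → g a = g b := by
  have hfin := Set.finite_range g
  have hpos : 0 < (Set.range g).ncard := (Set.ncard_pos hfin).2 (Set.range_nonempty g)
  refine ⟨by omega, ?_⟩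
  have := hfin.fintype
  rw [Set.ncard_eq_toFinset_card', Set.toFinset_card] at h
  obtain ⟨e⟩ := Function.Embedding.nonempty_of_card_le (α := Set.range g) (β := Fin C)
    (by simpa using h)
  exact ⟨fun a => e ⟨g a, a, rfl⟩, fun a b hab => congrArg Subtype.val (e.injective hab)⟩

/-- A count vector `c` of size `k` is realised by a tuple and classified by the function left after
pinning that tuple. The vectors `x` of complementary size are the count vectors of the remaining
arguments; for other sizes both values vanish. -/
theorem regular_input (hq : 0 < q) {Ω : Instance q} {C : ℕ} (h : ∀ v, IsRegular C (Ω.f v)) :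
    Regular (input Ω) C := by
  classical
  intro v hv k
  have hv' := hv
  rw [length_input] at hv'
  lift v to Fin Ω.n using hv'
  have : Nonempty (Fin q) := ⟨⟨0, hq⟩⟩
  have hW := wellFormed_input Ω
  by_cases hk : k ≤ Ω.graph.degree v
  · have hd : Ω.graph.degree v = (Ω.graph.degree v - k) + k := by omega
    obtain ⟨-, κ, hκ⟩ := exists_code _ (h v _ k hd)
    have hw : ∀ c : Vec q, ∃ τ : Fin k → Fin q, tot c = k → counts τ = c := fun c => by
      by_cases hc : tot c = k
      · exact (exists_counts hc).imp fun _ h _ => h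
      · exact ⟨fun _ => ⟨0, hq⟩, fun h => absurd h hc⟩
    choose w hw using hw
    refine ⟨fun c => κ (w c), fun c c' hc hc' hcc x => ?_⟩
    by_cases hx : tot (c + x) = Ω.graph.degree v
    · have hx' : tot x = Ω.graph.degree v - k := by rw [tot_add] at hx; omega
      obtain ⟨ξ, rfl⟩ := exists_counts hx'
      have := congrFun (hκ _ _ hcc) ξ
      simp only [pin] at this
      rw [← val_input, ← val_input, counts_append, counts_append, hw c hc, hw c' hc'] at this
      exact this
    · rw [hW.val_eq_zero hv (by rwa [dg_edges]), hW.val_eq_zero hv]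
      rwa [dg_edges, tot_add, hc', ← hc, ← tot_add]
  -- Beyond the degree all values are zero, so one class suffices; it exists because pinning no
  -- argument yields one function, whence `0 < C`.
  · obtain ⟨hC, -⟩ := exists_code _ (h v (Ω.graph.degree v) 0 rfl)
    refine ⟨fun _ => ⟨0, hC⟩, fun c c' hc hc' _ x => ?_⟩
    rw [hW.val_eq_zero hv, hW.val_eq_zero hv] <;> rw [dg_edges, tot_add] <;> omega

/-! ### The size of the input -/

theorem ms_vec_eq (c : Vec q) : ms c = tot c + q := by
  rw [ms_vec]
  change ((List.ofFn c).map fun a => a + 1).sum = _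
  rw [List.map_ofFn, List.sum_ofFn, tot]
  simp [Finset.sum_add_distrib]

theorem length_antidiagonalTuple_le (d : ℕ) :
    (List.Nat.antidiagonalTuple q d).length ≤ (d + 1) ^ q := by
  rw [← List.toFinset_card_of_nodup (List.Nat.nodup_antidiagonalTuple q d)]
  have h : (Fintype.piFinset fun _ : Fin q => Finset.range (d + 1)).card = (d + 1) ^ q := by simp
  rw [← h]
  refine Finset.card_le_card fun c hc => ?_
  rw [List.mem_toFinset, List.Nat.mem_antidiagonalTuple] at hc
  rw [Fintype.mem_piFinset]
  intro i
  have := Finset.single_le_sum (f := c) (fun _ _ => Nat.zero_le _) (Finset.mem_univ i)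
  rw [Finset.mem_range]
  omega

theorem ms_tableOf_le {d : ℕ} (f : (Fin d → Fin q) → ℂ) :
    ms (tableOf f) ≤ (d + 1) ^ q * (d + q + 1) := by
  refine (ms_le_length_mul (b := d + q) fun e he => ?_).trans (Nat.mul_le_mul_right _ ?_)
  · obtain ⟨h, -⟩ := mem_tableOf.1 he
    change ms e.1 + 0 ≤ _
    rw [ms_vec_eq, tot, h, add_zero]
  · rw [tableOf, List.length_map, List.length_attach]
    exact length_antidiagonalTuple_le d

theorem ms_input_le (Ω : Instance q) :
    ms (input Ω) ≤ Ω.n * (Ω.n * (Ω.n + 1) + (Ω.n + 1) ^ q * (Ω.n + q + 1) + 1) := by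
  refine (ms_le_length_mul (b := Ω.n * (Ω.n + 1) + (Ω.n + 1) ^ q * (Ω.n + q + 1)) fun e he => ?_).trans
    (by rw [length_input])
  obtain ⟨v, rfl⟩ := List.mem_ofFn.1 he
  have hd : Ω.graph.degree v ≤ Ω.n := by
    simpa using (Ω.graph.degree_lt_card_verts v).le
  rw [ms_prod]
  refine add_le_add ((ms_le_length_mul (b := Ω.n) fun w hw => ?_).trans ?_)
    ((ms_tableOf_le _).trans ?_)
  · obtain ⟨i, rfl⟩ := List.mem_ofFn.1 hw
    exact (Ω.nbr v i).2.le
  · rw [List.length_ofFn]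
    exact Nat.mul_le_mul_right _ hd
  · gcongr

/-! ### The tables are small -/

theorem best_sublist (n : ℕ) (E F : List Edge) :
    (best n E F).1.Sublist F ∧ (best n E F).2.Sublist F := by
  rcases best_mem n E F with h | h
  · rw [h]
    exact ⟨List.take_sublist _ _, List.drop_sublist _ _⟩
  · simp only [splits, splitBy, List.mem_filter, List.mem_map] at h
    obtain ⟨⟨A, -, h⟩, -⟩ := h
    rw [← h]
    exact ⟨List.filter_sublist, List.filter_sublist⟩

theorem dg_le_of_sublist {F F' : List Edge} (h : F.Sublist F') (v : ℕ) : dg F v ≤ dg F' v :=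
  (h.filter _).length_le

theorem length_state {I : Inp q} {E F : List Edge} {y : State q × ℂ} (hy : y ∈ solve I E F) :
    y.1.length = I.length := by
  have hr : ∀ s, (reduceState I s).length = I.length := fun s => by simp [reduceState]
  rw [solve] at hy
  split_ifs at hy
  · unfold leafTable at hy
    cases h : F.isEmpty <;> simp only [h, cond_true, cond_false] at hy
    · obtain ⟨w, hw, e⟩ := key_collapse hy
      obtain ⟨i, -, rfl⟩ := List.mem_map.1 hw
      rw [← e]
      exact hr _
    · rw [List.mem_singleton] at hy
      simp [hy, zeroState]
  · obtain ⟨w, hw, e⟩ := key_collapse hy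
    simp only [List.mem_flatMap, List.mem_map] at hw
    obtain ⟨x, -, z, -, rfl⟩ := hw
    rw [← e]
    exact hr _

theorem WellFormed.ms_solve_le {I : Inp q} {E F : List Edge} (hI : WellFormed I E) {C : ℕ}
    (hC : Regular I C) (hF : F.Sublist E) :
    ms (solve I E F) ≤ C ^ (bdry I.length E F).length * (I.length * (E.length + q + 1) + 1) := by
  have hdg := dg_le_of_sublist hF
  have hR := hI.represents_solve _ le_rfl hdg
  refine (ms_le_length_mul (b := I.length * (E.length + q + 1)) fun y hy => ?_).trans
    (Nat.mul_le_mul_right _ (hI.length_le hC hdg hR.shaped (solve_pairwise F)))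
  change ms y.1 + 0 ≤ _
  rw [add_zero, ← length_state hy]
  refine ms_le_length_mul fun c hc => ?_
  obtain ⟨v, hv, rfl⟩ := List.getElem_of_mem hc
  have h := hR.shaped y hy v (length_state hy ▸ hv)
  have hst : st y.1 v = y.1[v] := by simp [st, hv]
  rw [hst] at h
  rw [ms_vec_eq, h]
  have h₁ := hdg v
  have h₂ : dg E v ≤ E.length := List.length_filter_le _ _
  split_ifs <;> omega

/-! ### The running time -/

/-- The infimum is attained because the decomposition with a single bag shows that the set is
nonempty. -/
theorem exists_treeDecomposition {n : ℕ} (G : SimpleGraph (Fin n)) :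
    ∃ D : TreeDecomposition G, ∀ i, (D.bag i).card ≤ treewidth G + 1 := by
  have : {w | ∃ D : TreeDecomposition G, ∀ i, (D.bag i).card ≤ w + 1}.Nonempty := by
    refine ⟨n, ⟨1, ⊥, ⟨?_, SimpleGraph.isAcyclic_bot⟩, fun _ => Finset.univ,
      fun v => ⟨0, Finset.mem_univ v⟩, fun u v _ => ⟨0, Finset.mem_univ u, Finset.mem_univ v⟩,
      fun v => ?_⟩, fun _ => ?_⟩
    · exact SimpleGraph.connected_iff_exists_forall_reachable _ |>.2
        ⟨0, fun w => by rw [Subsingleton.elim w 0]⟩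
    · intro a b
      rw [Subsingleton.elim a b]
    · simp
  exact Nat.sInf_mem this

/-- An instance all of whose functions are `C`-regular. -/
structure RegularInstance (q : ℕ) where
  Ω : Instance q
  C : ℕ
  pos : 0 < q
  regular : ∀ v, IsRegular C (Ω.f v)

namespace RegularInstance

/-- The exponent is `3 * (tw + 1) + 2`, the bound on all boundaries. The base dominates both `2`,
for the subsets of a boundary, and `C`, for the tables. -/
noncomputable def bound (x : RegularInstance q) : ℕ := (x.C + 2) ^ (3 * treewidth x.Ω.graph + 5)

/-- The encoding forgets `C`, while the measure charges for it and for the treewidth. Thus a program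
polynomial in this measure is uniform in `C`. -/
noncomputable instance : Enc (RegularInstance q) :=
  ⟨fun x => enc (input x.Ω), fun x => x.bound + ms (input x.Ω)⟩

theorem poly_input : Poly (fun x : RegularInstance q => input x.Ω) :=
  .of_expr (.var 0) 1 (PBd.ms.mono fun _ => Nat.le_add_left _ _) fun _ => .var rfl

end RegularInstance

/-- A set of edges arising in the decomposition. -/
structure Piece (q : ℕ) where
  x : RegularInstance q
  F : List Edge
  sub : F.Sublist (edges (input x.Ω))
  bdry_le : (bdry x.Ω.n (edges (input x.Ω)) F).length ≤ 3 * treewidth x.Ω.graph + 5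

namespace Piece

noncomputable abbrev I (y : Piece q) : Inp q := input y.x.Ω
noncomputable abbrev E (y : Piece q) : List Edge := edges y.I

/-- The measure does not involve `F`, so both parts of a split have the measure of the whole. -/
noncomputable instance : Enc (Piece q) :=
  ⟨fun y => enc (y.I, y.E, y.F), fun y => y.x.bound + ms y.I + ms y.E⟩

theorem ms_eq (y : Piece q) : ms y = y.x.bound + ms y.I + ms y.E := rfl

theorem poly_data : Poly (fun y : Piece q => (y.I, y.E, y.F)) := by
  refine .of_expr (.var 0) 1 ((PBd.ms.add .ms).mono fun y => ?_) fun _ => .var rfl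
  have := ms_le_of_sublist y.sub
  rw [ms_prod, ms_prod, ms_eq]
  change ms y.F ≤ ms y.E at this
  omega

@[fun_prop]
theorem poly_I : Poly (fun y : Piece q => y.I) := poly_data.fst
@[fun_prop]
theorem poly_E : Poly (fun y : Piece q => y.E) := poly_data.snd.fst
@[fun_prop]
theorem poly_F : Poly (fun y : Piece q => y.F) := poly_data.snd.snd

theorem pow_le_bound (y : Piece q) {b : ℕ} (hb : b ≤ y.x.C + 2) :
    b ^ (bdry y.I.length y.E y.F).length ≤ y.x.bound := by
  rw [length_input]
  exact (Nat.pow_le_pow_left hb _).trans (Nat.pow_le_pow_right (by omega) y.bdry_le)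

theorem poly_best : Poly (fun y : Piece q => best y.I.length y.E y.F) := by
  refine poly_I.length.best poly_E poly_F (PBd.ms.mono fun y => ?_)
  have := y.pow_le_bound (b := 2) (by omega)
  rw [ms_eq]
  omega

/-- The tree decomposition enters only here, as a witness that good splits exist; `k = tw + 1` turns
`3k + 2` into `3 tw + 5`. -/
theorem width_le (y : Piece q) :
    (bdry y.x.Ω.n y.E (best y.I.length y.E y.F).1).length ≤ 3 * treewidth y.x.Ω.graph + 5 ∧
    (bdry y.x.Ω.n y.E (best y.I.length y.E y.F).2).length ≤ 3 * treewidth y.x.Ω.graph + 5 := by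
  obtain ⟨D, hD⟩ := exists_treeDecomposition y.x.Ω.graph
  have := width_best (E := y.E) (F := y.F) hD
    (fun e he => ((mem_edges y.x.Ω).1 (y.sub.subset he)).2) (y.bdry_le.trans (by omega))
  rw [width_eq, max_le_iff] at this
  rw [length_input]
  exact ⟨this.1.trans (by omega), this.2.trans (by omega)⟩

noncomputable def left (y : Piece q) : Piece q :=
  ⟨y.x, (best y.I.length y.E y.F).1, (best_sublist _ _ _).1.trans y.sub, y.width_le.1⟩

noncomputable def right (y : Piece q) : Piece q :=
  ⟨y.x, (best y.I.length y.E y.F).2, (best_sublist _ _ _).2.trans y.sub, y.width_le.2⟩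

noncomputable def parts (y : Piece q) : List (Piece q) :=
  bif decide (y.F.length ≤ 1) then [] else [y.left, y.right]

theorem poly_parts : Poly (parts (q := q)) := by
  have hb := poly_best (q := q)
  have h : Poly fun y : Piece q => bif decide (y.F.length ≤ 1) then [] else
      [(y.I, y.E, (best y.I.length y.E y.F).1), (y.I, y.E, (best y.I.length y.E y.F).2)] := by
    have h₁ := hb.fst
    have h₂ := hb.snd
    exact Poly.bif (by fun_prop) (.const [])
      ((poly_I.prodMk (poly_E.prodMk h₁)).cons ((poly_I.prodMk (poly_E.prodMk h₂)).cons (.const [])))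
  refine h.of_enc_eq (fun y => ?_) (((PBd.ms.add .ms).add (.const 2)).mono fun y => ?_)
  · unfold parts
    cases decide (y.F.length ≤ 1) <;> rfl
  · unfold parts
    cases decide (y.F.length ≤ 1)
    · change ms [y.left, y.right] ≤ _
      rw [ms_cons, ms_cons, ms_nil]
      have h₁ : ms y.left = ms y := rfl
      have h₂ : ms y.right = ms y := rfl
      omega
    · exact Nat.zero_le _

theorem poly_solve : Poly (fun y : Piece q => solve y.I y.E y.F) := by
  -- A binary recursion tree with `|F|` leaves has `2(|F| - 1) + 1` nodes; truncated subtraction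
  -- gives `1` for empty `F`.
  refine Poly.recurse (pre := parts) (μ := fun y => 2 * (y.F.length - 1) + 1)
    (comb := fun z => bif decide (z.1.F.length ≤ 1) then leafTable z.1.I z.1.F else
      mergeTables z.1.I (z.2.headD []) (z.2.tail.headD [])) poly_parts ?_ ?_ ?_ ?_ ?_ ?_
  · have hF : Poly fun z : Piece q × List (Table q) => z.1.F := poly_F.comp (Poly.fst .id)
    have hI : Poly fun z : Piece q × List (Table q) => z.1.I := poly_I.comp (Poly.fst .id)
    exact Poly.bif (hF.length.leb (.const 1)) (hI.leafTable hF)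
      (hI.mergeTables (by fun_prop) (by fun_prop))
  · intro y
    rw [solve]
    unfold parts
    by_cases h : y.F.length ≤ 1
    · simp [h]
    · simp only [h, if_false, decide_false, cond_false, List.map_cons, List.map_nil]
      rfl
  · intro y
    unfold parts
    by_cases h : y.F.length ≤ 1
    · simp [h]
    · have := best_length (n := y.I.length) (E := y.E) (F := y.F) (by omega)
      simp only [h, decide_false, cond_false, List.map_cons, List.map_nil, List.sum_cons,
        List.sum_nil, left, right]
      omega
  · refine (((PBd.const 2).mul .ms).add (.const 1)).mono fun y => ?_
    have h₁ := length_le_ms y.E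
    have h₂ := y.sub.length_le
    have h₃ := y.ms_eq
    change y.F.length ≤ y.E.length at h₂
    omega
  · intro y z hz
    unfold parts at hz
    cases h : decide (y.F.length ≤ 1) <;>
      simp only [h, cond_true, cond_false, List.mem_cons, List.not_mem_nil, or_false] at hz
    rcases hz with rfl | rfl <;> exact le_rfl
  · refine (PBd.ms.mul (((PBd.ms (α := Piece q)).mul ((PBd.ms.add (.const q)).add
      (.const 1))).add (.const 1))).mono fun y => ?_
    refine ((wellFormed_input y.x.Ω).ms_solve_le (regular_input y.x.pos y.x.regular) y.sub).trans ?_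
    have h₁ := y.pow_le_bound (b := y.x.C) (by omega)
    have h₂ := length_le_ms y.E
    have h₃ := length_le_ms y.I
    have h₄ := y.ms_eq
    change y.x.C ^ (bdry y.I.length y.E y.F).length * (y.I.length * (y.E.length + q + 1) + 1) ≤ _
    refine Nat.mul_le_mul (by omega) (Nat.add_le_add_right (Nat.mul_le_mul (by omega) ?_) 1)
    omega

end Piece

/-- The piece consisting of all edges. -/
noncomputable def RegularInstance.whole (x : RegularInstance q) : Piece q :=
  ⟨x, edges (input x.Ω), List.Sublist.refl _, by
    have : bdry x.Ω.n (edges (input x.Ω)) (edges (input x.Ω)) = [] := by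
      refine List.eq_nil_iff_forall_not_mem.2 fun v hv => ?_
      exact absurd (mem_bdry.1 hv).2.2 (lt_irrefl _)
    rw [this]
    exact Nat.zero_le _⟩

theorem RegularInstance.poly_whole : Poly (whole (q := q)) := by
  have hE : Poly fun x : RegularInstance q => edges (input x.Ω) := poly_input.edges
  refine Poly.of_enc_eq
    (f := fun x : RegularInstance q => (input x.Ω, edges (input x.Ω), edges (input x.Ω)))
    (poly_input.prodMk (hE.prodMk hE)) (fun x => rfl) ((PBd.ms.add hE.pbd).mono fun x => ?_)
  exact (Piece.ms_eq x.whole).le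

theorem RegularInstance.poly_solve : Poly fun x : RegularInstance q =>
    solve (input x.Ω) (edges (input x.Ω)) (edges (input x.Ω)) :=
  Poly.comp (g := fun y : Piece q => solve y.I y.E y.F) Piece.poly_solve poly_whole

theorem Poly.prod_range {α : Type} [Enc α] {I : α → Inp q} (hI : Poly I) {g : Inp q → ℕ → ℂ}
    (hg : Poly fun z : Inp q × ℕ => g z.1 z.2) :
    Poly fun a => ((List.range (I a).length).map (g (I a))).prod :=
  (Poly.map (h := fun a v => g (I a) v) hI.length.range
    (hg.comp ((hI.comp (Poly.fst .id)).prodMk (Poly.snd .id)))).cprod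

theorem RegularInstance.poly_result :
    Poly (fun x : RegularInstance q => result (input x.Ω)) := by
  have h₁ : Poly fun x : RegularInstance q =>
      ((solve (input x.Ω) (edges (input x.Ω)) (edges (input x.Ω))).map fun x => x.2).sum :=
    (poly_solve.map (h := fun _ y => y.2) (by fun_prop)).csum
  exact h₁.cmul (poly_input.prod_range
    (g := fun I v => (look (tabAt I v) vzero).headD 1) (by fun_prop))

end
end Holant

theorem mainTheorem2 (q : ℕ) (hq : 2 ≤ q) :
    ∃ P : Holant.Program, ∀ C : ℕ, ∃ (K : ℕ) (p : Polynomial ℕ),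
      ∀ Ω : Holant.Instance q, (∀ v, Holant.IsRegular C (Ω.f v)) →
        ∃ t : ℕ, t ≤ 2 ^ (K * Holant.treewidth Ω.graph) * p.eval Ω.n ∧
          P.Runs Ω.encode (Holant.Val.num Ω.hol) t := by
  open Polynomial in
  -- The program is fixed before `C`, which is a component of the argument.
  obtain ⟨P, T, -, ⟨k, hT⟩, hP⟩ := Holant.RegularInstance.poly_result (q := q)
  -- Of the summand `3`, two units are the offset in `PBd`; the third allows the sum of the two
  -- parts of the measure to be bounded by their product.
  let s : Polynomial ℕ := X * (X * (X + 1) + (X + 1) ^ q * (X + C q + 1) + 1) + 3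
  -- The exponent `(c + 2) * (3 tw + 5) * k` is divided into its part linear in the treewidth and a
  -- constant.
  refine ⟨P, fun c => ⟨(c + 2) * 3 * k, C (2 ^ ((c + 2) * 5 * k)) * s ^ k, fun Ω hΩ => ?_⟩⟩
  let x : Holant.RegularInstance q := ⟨Ω, c, by omega, hΩ⟩
  obtain ⟨t, ht, h⟩ := hP x
  refine ⟨t, ht.trans ((hT x).trans ?_), ?_⟩
  · have hs : Holant.Enc.ms (Holant.input Ω) + 3 ≤ s.eval Ω.n := by
      simpa [s] using Holant.ms_input_le Ω
    have hb : x.bound ≤ 2 ^ ((c + 2) * (3 * Holant.treewidth Ω.graph + 5)) := by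
      rw [pow_mul]
      exact Nat.pow_le_pow_left Nat.lt_two_pow_self.le _
    have hb' : 1 ≤ 2 ^ ((c + 2) * (3 * Holant.treewidth Ω.graph + 5)) := Nat.one_le_two_pow
    have hx : Holant.Enc.ms x + 2 ≤
        2 ^ ((c + 2) * (3 * Holant.treewidth Ω.graph + 5)) * s.eval Ω.n := by
      change x.bound + Holant.Enc.ms (Holant.input Ω) + 2 ≤ _
      nlinarith
    refine (Nat.pow_le_pow_left hx k).trans (le_of_eq ?_)
    rw [eval_mul, eval_C, eval_pow, mul_pow, ← pow_mul, ← mul_assoc, ← pow_add]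
    congr 2
    ring
  · have h' := h
    change Holant.Eval P [Holant.Enc.enc (Holant.input Ω)] _ (Holant.Val.num (Holant.result _)) t at h'
    rwa [Holant.enc_input, Holant.result_input] at h'
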